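/- Let $\mathfrak{sp}_{2n}=\mathfrak n^+\oplus\mathfrak h\oplus\mathfrak n^-$ be the complex symplectic Lie algebra with its standard Cartan decomposition, with simple roots $\alpha_1,\dots,\alpha_n$ ($\alpha_n$ the long one) and fundamental weights $\omega_1,\dots,\omega_n$. Its positive roots are $$\alpha_{i,j}=\alpha_i+\dots+\alpha_j\ (1\le i\le j\le n),\qquad \alpha_{i,\overline j}=\alpha_i+\dots+\alpha_n+\alpha_{n-1}+\dots+\alpha_j\ (1\le i\le j\le n),$$ where $\alpha_{i,\overline n}=\alpha_{i,n}$. Write $\alpha_{\overline j}=\alpha_{j,\overline j}$, and let $J=\{1<\dots<n<\overline{n-1}<\dots<\overline 1\}$; for $x\in J$ let $x+1$ denote the next larger letter. For each positive root $\alpha$ fix a nonzero root vector $f_\alpha\in\mathfrak n^-_{-\alpha}$. A symplectic Dyck path is a sequence $(p(0),\dots,p(k))$, $k\ge0$, of positive roots such that $p(0)=\alpha_i$ for some $i$, $p(k)=\alpha_j$ or $p(k)=\alpha_{\overline j}$ for some $j\ge i$, and whenever $p(s)=\alpha_{r,q}$ with $s<k$, then $p(s+1)=\alpha_{r,q+1}$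 or $p(s+1)=\alpha_{r+1,q}$. Let $\lambda=m_1\omega_1+\dots+m_n\omega_n$ with $m_i\in\mathbb Z_{\ge0}$, and let $V(\lambda)$ be the irreducible $\mathfrak{sp}_{2n}$-module with highest weight $\lambda$ and highest weight vector $v_\lambda$. Let $S(\lambda)$ be the set of families $\mathbf s=(s_\alpha)_{\alpha>0}$ of non-negative integers such that, for every symplectic Dyck path $(p(0),\dots,p(k))$ with $p(0)=\alpha_i$, $$s_{p(0)}+\dots+s_{p(k)}\le m_i+\dots+m_j\ \text{ if } p(k)=\alpha_j,\qquad s_{p(0)}+\dots+s_{p(k)}\le m_i+\dots+m_n\ \text{ if } p(k)=\alpha_{\overline j}.$$ Put $\operatorname{wt}(\mathbf s)=\sum_{\alpha>0}s_\alpha\,\alpha$. Then: (i) For each $\mathbf s\in S(\lambda)$ choose an arbitrary order of the factors of $\prod_{\alpha>0}f_\alpha^{s_\alpha}$ (each $f_\alpha$ occurring $s_\alpha$ times), and let $f^{\mathbf s}\in U(\mathfrak n^-)$ be the resulting ordered product. Then the vectors $f^{\mathbf s}v_\lambda$, $\mathbf s\in S(\lambda)$, form a basis of $V(\lambda)$.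 (ii) $S(\lambda)$ is finite, $V(\lambda)$ is finite-dimensional, and $\dim V(\lambda)=\#S(\lambda)$. (iii) $\operatorname{char}V(\lambda)=\sum_{\mathbf s\in S(\lambda)}e^{\lambda-\operatorname{wt}(\mathbf s)}$, where $\operatorname{char}V=\sum_\mu\dim(V_\mu)\,e^\mu$. -/

import Mathlib

attribute [local instance 100] LieRing.ofAssociativeRing

namespace SymplecticPBW

noncomputable section

/-! ### The symplectic Lie algebra and its standard Cartan subalgebra -/

/-- The complex symplectic Lie algebra `𝔰𝔭₂ₙ`. -/
abbrev Sp (n : ℕ) : LieSubalgebra ℂ (Matrix (Fin n ⊕ Fin n) (Fin n ⊕ Fin n) ℂ) :=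
  LieAlgebra.Symplectic.sp (Fin n) ℂ

/-- The Cartan subalgebra `𝔥` of `𝔰𝔭₂ₙ`: its diagonal matrices `diag(a₁, …, aₙ, -a₁, …, -aₙ)`. -/
def cartan (n : ℕ) : LieSubalgebra ℂ (Sp n) where
  carrier := {x | (x : Matrix (Fin n ⊕ Fin n) (Fin n ⊕ Fin n) ℂ).IsDiag}
  add_mem' hx hy := Matrix.IsDiag.add hx hy
  zero_mem' := Matrix.isDiag_zero
  smul_mem' c _ hx := Matrix.IsDiag.smul c hx
  lie_mem' {x y} hx hy := by
    have hx' : (x : Matrix (Fin n ⊕ Fin n) (Fin n ⊕ Fin n) ℂ).IsDiag := hx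
    have hy' : (y : Matrix (Fin n ⊕ Fin n) (Fin n ⊕ Fin n) ℂ).IsDiag := hy
    change (((⁅x, y⁆ : Sp n)) : Matrix (Fin n ⊕ Fin n) (Fin n ⊕ Fin n) ℂ).IsDiag
    rw [LieSubalgebra.coe_bracket, Ring.lie_def, ← hx'.diagonal_diag, ← hy'.diagonal_diag,
      Matrix.diagonal_mul_diagonal, Matrix.diagonal_mul_diagonal]
    exact (Matrix.isDiag_diagonal _).sub (Matrix.isDiag_diagonal _)

instance (n : ℕ) : IsLieAbelian (cartan n) where
  trivial x y := by
    have hx : ((x : Sp n) : Matrix (Fin n ⊕ Fin n) (Fin n ⊕ Fin n) ℂ).IsDiag := x.2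
    have hy : ((y : Sp n) : Matrix (Fin n ⊕ Fin n) (Fin n ⊕ Fin n) ℂ).IsDiag := y.2
    apply Subtype.ext
    apply Subtype.ext
    rw [LieSubalgebra.coe_bracket, LieSubalgebra.coe_bracket, Ring.lie_def,
      ← hx.diagonal_diag, ← hy.diagonal_diag,
      Matrix.diagonal_mul_diagonal, Matrix.diagonal_mul_diagonal]
    simp [mul_comm]

/-- Weights: linear functionals on the Cartan subalgebra. -/
abbrev Weight (n : ℕ) : Type := Module.Dual ℂ (cartan n)

/-- The functional `εᵢ : diag(a₁, …, aₙ, -a₁, …, -aₙ) ↦ aᵢ`. -/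
def eps {n : ℕ} (i : Fin n) : Weight n where
  toFun h := ((h : Sp n) : Matrix (Fin n ⊕ Fin n) (Fin n ⊕ Fin n) ℂ) (Sum.inl i) (Sum.inl i)
  map_add' _ _ := rfl
  map_smul' _ _ := rfl

/-- The simple roots of type `Cₙ`: `αᵢ = εᵢ - εᵢ₊₁` for `i < n`, and `αₙ = 2 εₙ`
(here and below, indices run through `Fin n`, that is, they are shifted by one). -/
def simpleRoot {n : ℕ} (i : Fin n) : Weight n :=
  if h : (i : ℕ) + 1 < n then eps i - eps ⟨(i : ℕ) + 1, h⟩ else (2 : ℂ) • eps i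

/-- The fundamental weights `ωᵢ = ε₁ + ⋯ + εᵢ`. -/
def fundWeight {n : ℕ} (i : Fin n) : Weight n := ∑ k ∈ Finset.Iic i, eps k

/-- The dominant integral weight `λ = m₁ ω₁ + ⋯ + mₙ ωₙ`. -/
def domWeight {n : ℕ} (m : Fin n → ℕ) : Weight n := ∑ i, m i • fundWeight i

/-! ### Positive roots -/

/-- Labels of the positive roots `α_{i,q}` of `𝔰𝔭₂ₙ`, where the row `i` lies in `{1, …, n}` and the
column `q` in the alphabet `J = {1 < ⋯ < n < \overline{n-1} < ⋯ < \overline{1}}`.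
Counting from `0`, the alphabet `J` is `{0, …, 2n-2}`, the letter `q ≤ n-1` stands for itself, and
the barred letter `\overline{j}` is the number `2n-2-j`. The pairs `(i, q)` that occur are those with
`i ≤ q ≤ \overline{i}`. -/
@[ext] structure PosRoot (n : ℕ) where
  row : ℕ
  col : ℕ
  row_lt : row < n
  row_le_col : row ≤ col
  col_le : col ≤ 2 * n - 2 - row

/-- The label of `αᵢ = α_{i,i}`. -/
def PosRoot.simple {n : ℕ} (i : Fin n) : PosRoot n :=
  ⟨i, i, i.2, le_rfl, by omega⟩

/-- The label of `α_{\overline{j}} = α_{j,\overline{j}}`. -/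
def PosRoot.highest {n : ℕ} (j : Fin n) : PosRoot n :=
  ⟨j, 2 * n - 2 - j, j.2, by omega, le_rfl⟩

/-- The simple root `α_{|x|}` for a letter `x` of the alphabet `J`, where `|j| = |\overline{j}| = j`. -/
def letterRoot (n : ℕ) (x : ℕ) : Weight n :=
  if h : min x (2 * n - 2 - x) < n then simpleRoot ⟨min x (2 * n - 2 - x), h⟩ else 0

/-- The root with a given label:
`α_{i,j} = αᵢ + ⋯ + αⱼ` and `α_{i,\overline{j}} = αᵢ + ⋯ + αₙ + αₙ₋₁ + ⋯ + αⱼ`,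
in both cases the sum of the simple roots of all letters between the row and the column. -/
def PosRoot.root {n : ℕ} (β : PosRoot n) : Weight n :=
  ∑ x ∈ Finset.Icc β.row β.col, letterRoot n x

/-- The `n²` labels are finite in number. -/
instance (n : ℕ) : Finite (PosRoot n) :=
  Finite.of_injective
    (fun β : PosRoot n => ((⟨β.row, β.row_lt⟩, ⟨β.col, by have := β.col_le; have := β.row_lt; omega⟩) :
      Fin n × Fin (2 * n)))
    (fun β γ h => by
      simp only [Prod.mk.injEq, Fin.mk.injEq] at h
      exact PosRoot.ext h.1 h.2)

instance (n : ℕ) : Fintype (PosRoot n) := Fintype.ofFinite _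

instance (n : ℕ) : DecidableEq (PosRoot n) := fun β γ =>
  decidable_of_iff (β.row = γ.row ∧ β.col = γ.col)
    ⟨fun h => PosRoot.ext h.1 h.2, fun h => h ▸ ⟨rfl, rfl⟩⟩

/-- The root space of `𝔰𝔭₂ₙ` for `χ`. -/
def rootSpace {n : ℕ} (χ : Weight n) : LieSubmodule ℂ (cartan n) (Sp n) :=
  LieModule.weightSpace (Sp n) χ

/-- `𝔫⁺`, generated by the root spaces of the positive roots. -/
def nPlus (n : ℕ) : LieSubalgebra ℂ (Sp n) :=
  LieSubalgebra.lieSpan ℂ (Sp n) (⋃ β : PosRoot n, (rootSpace β.root : Set (Sp n)))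

/-- `𝔫⁻`, generated by the root spaces of the negative roots. -/
def nMinus (n : ℕ) : LieSubalgebra ℂ (Sp n) :=
  LieSubalgebra.lieSpan ℂ (Sp n) (⋃ β : PosRoot n, (rootSpace (-β.root) : Set (Sp n)))

/-- A choice of nonzero root vectors `f_β ∈ 𝔫⁻_{-β}`, one for each positive root `β`. -/
structure IsRootVectors {n : ℕ} (f : PosRoot n → nMinus n) : Prop where
  ne_zero : ∀ β, f β ≠ 0
  mem_rootSpace : ∀ β, (f β : Sp n) ∈ rootSpace (-β.root)

/-! ### Symplectic Dyck paths, the polytope and its integral points -/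

/-- `γ` may follow `β = α_{r,q}` on a Dyck path: `γ = α_{r,q+1}` or `γ = α_{r+1,q}`. -/
def DyckStep {n : ℕ} (β γ : PosRoot n) : Prop :=
  (γ.row = β.row ∧ γ.col = β.col + 1) ∨ (γ.row = β.row + 1 ∧ γ.col = β.col)

/-- `p` is a symplectic Dyck path from `αᵢ` to the root `ω`, where `ω` is `αⱼ` or
`α_{\overline{j}}` for some `j ≥ i`. -/
structure IsDyckPath {n : ℕ} (p : List (PosRoot n)) (i : Fin n) (ω : PosRoot n) : Prop where
  head : p.head? = some (PosRoot.simple i)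
  last : p.getLast? = some ω
  isEnd : ∃ j : Fin n, i ≤ j ∧ (ω = PosRoot.simple j ∨ ω = PosRoot.highest j)
  step : p.IsChain DyckStep

/-- The polytope `P(λ) ⊆ ℝ_{≥0}^{n²}` for `λ = m₁ ω₁ + ⋯ + mₙ ωₙ`. -/
def polytope {n : ℕ} (m : Fin n → ℕ) : Set (PosRoot n → ℝ) :=
  {s | (∀ β, 0 ≤ s β) ∧
    ∀ (p : List (PosRoot n)) (i j : Fin n),
      (IsDyckPath p i (PosRoot.simple j) →
        (p.map s).sum ≤ ∑ k ∈ Finset.Icc i j, (m k : ℝ)) ∧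
      (IsDyckPath p i (PosRoot.highest j) →
        (p.map s).sum ≤ ∑ k ∈ Finset.Ici i, (m k : ℝ))}

/-- The set `S(λ)` of integral points of `P(λ)`, as multi-exponents. -/
def S {n : ℕ} (m : Fin n → ℕ) : Set (PosRoot n → ℕ) :=
  {s | (fun β => (s β : ℝ)) ∈ polytope m}

/-- The weight `wt(s) = ∑ s_β β` of a multi-exponent. -/
def wt {n : ℕ} (s : PosRoot n → ℕ) : Weight n := ∑ β, s β • β.root

/-! ### Highest weight modules, ordered monomials, characters -/

section Module

variable {n : ℕ} {V : Type*} [AddCommGroup V] [Module ℂ V] [LieRingModule (Sp n) V]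
  [LieModule ℂ (Sp n) V]

/-- `v` is a highest weight vector of weight `χ`. -/
structure IsHighestWeightVector (χ : Weight n) (v : V) : Prop where
  ne_zero : v ≠ 0
  mem_weightSpace : v ∈ LieModule.weightSpace V (χ : cartan n → ℂ)
  nPlus_lie : ∀ x ∈ nPlus n, ⁅x, v⁆ = 0

variable (n V) in
/-- The action of the enveloping algebra `U(𝔫⁻)` on an `𝔰𝔭₂ₙ`-module. -/
def envAction : UniversalEnvelopingAlgebra ℂ (nMinus n) →ₐ[ℂ] Module.End ℂ V :=
  UniversalEnvelopingAlgebra.lift ℂ (LieModule.toEnd ℂ (nMinus n) V)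

/-- The product in `U(𝔫⁻)`, in the given order, of the root vectors `f_β` for the labels `β` listed
in `w`. -/
def orderedMonomial (f : PosRoot n → nMinus n) (w : List (PosRoot n)) :
    UniversalEnvelopingAlgebra ℂ (nMinus n) :=
  (w.map fun β => UniversalEnvelopingAlgebra.ι ℂ (f β)).prod

/-- `w` is an arrangement of the factors of `∏ f_β^{s_β}`: each `β` occurs in it `s_β` times. -/
def IsArrangement (s : PosRoot n → ℕ) (w : List (PosRoot n)) : Prop :=
  ∀ β, w.count β = s β

variable (n V) in
/-- The formal character `∑_μ dim(V_μ) e^μ` of a finite-dimensional `𝔰𝔭₂ₙ`-module,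
in the group ring of the group of weights. -/
def formalChar : AddMonoidAlgebra ℤ (Weight n) :=
  ∑ᶠ μ : Weight n, AddMonoidAlgebra.single μ
    (Module.finrank ℂ (LieModule.weightSpace V (μ : cartan n → ℂ)) : ℤ)

end Module

end

end SymplecticPBW

namespace SymplecticPBW

noncomputable section

/-! The symplectic algebra is the symmetric square of its natural module, so every negative root
vector is a product of two basis vectors, its letters: one given by the row of the label, the other
by the letter that follows its column. The vertices of a Dyck path form a chain for the product
order on labels, and `S m` is cut out by inequalities over chains (`mem_S_iff`).

Spanning. A product of two vectors with suitable supports acts nilpotently on the highest weight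
vector, and the order of nilpotency is controlled by the right side of one of the inequalities.
Expanding a vanishing power, modulo the Borel part and shorter words, gives a polynomial identity in
the coordinates of these vectors. Each coefficient is a relation between monomials with the same
letters, and among those the monomial supported on a chain is the largest
(`lex_lt_of_letterDegree_eq`). So a monomial that violates an inequality is a combination of smaller
ones (`mem_lowerSpan_of_chain`), and descent along the monomial order ends in `S m`
(`wordAct_mem_span`).

Independence. For a fundamental weight the points of `S` are antichains. In a tensor power of the
natural module, acting on a wedge of basis vectors, each of them is detected by a coordinate,
triangularly for the same monomial order (`fundVec_detected`). Detection is compatible with tensor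
products (`IsDetected.tensor`), and a point for a sum of fundamental weights is a sum of points for
the summands (`exists_add_of_mem_S`). Hence every dominant weight has a concrete model in which the
monomials are independent.

Comparison. The model carries a contravariant Hermitian form. Inside the product of the irreducible
module and the model, the submodule generated by the pair of highest weight vectors is therefore the
graph of an isomorphism (`IsModel.exists_equiv`). Finite dimensionality is a consequence and is
nowhere assumed. Other root vectors differ from the standard ones by nonzero scalars, and the
character is read off from the weights of the basis. -/

/-! ### Chains of labels -/

/-- Labels are read row by row. -/
def readingIndex {n : ℕ} (β : PosRoot n) : ℕ ×ₗ ℕ := toLex (β.row, β.col)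

theorem readingIndex_injective {n : ℕ} : Function.Injective (readingIndex (n := n)) :=
  fun β γ h => by
    have h' := congrArg ofLex h
    simp only [readingIndex, ofLex_toLex, Prod.mk.injEq] at h'
    exact PosRoot.ext h'.1 h'.2

/-- Both halves of the proof rest on this order: comparing rows first makes chain monomials
lexicographically largest among those with the same letters, and makes antichain monomials
lexicographically smallest among the shortest words reaching the same tensor coordinate. -/
instance (n : ℕ) : LinearOrder (PosRoot n) :=
  { PartialOrder.lift readingIndex (readingIndex_injective (n := n)) with
    le_total := fun β γ => le_total (readingIndex β) (readingIndex γ)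
    toDecidableLE := fun β γ => inferInstanceAs (Decidable (readingIndex β ≤ readingIndex γ))
    toDecidableEq := inferInstance }

theorem PosRoot.lt_iff {n : ℕ} {β γ : PosRoot n} :
    β < γ ↔ β.row < γ.row ∨ β.row = γ.row ∧ β.col < γ.col := by
  change (toLex (β.row, β.col) : ℕ ×ₗ ℕ) < toLex (γ.row, γ.col) ↔ _
  rw [Prod.Lex.toLex_lt_toLex]

/-- The product order on labels. -/
def Below {n : ℕ} (β γ : PosRoot n) : Prop := β.row ≤ γ.row ∧ β.col ≤ γ.col

/-- Pairwise comparability for the product order. -/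
def IsLabelChain {n : ℕ} (C : Finset (PosRoot n)) : Prop :=
  ∀ β ∈ C, ∀ γ ∈ C, Below β γ ∨ Below γ β

theorem IsLabelChain.mono {n : ℕ} {C D : Finset (PosRoot n)} (h : IsLabelChain D) (hC : C ⊆ D) :
    IsLabelChain C := fun β hβ γ hγ => h β (hC hβ) γ (hC hγ)

/-- The path is built from its starting point. If all other members of the chain lie in later
columns, the step goes along the row. Otherwise one of them shares the column of `a`, and
comparability with it pushes all others into later rows, so the step goes to the next row. The
number `d` counts the remaining steps. -/
theorem exists_path_of_chain {n : ℕ} (s : PosRoot n → ℕ) (d : ℕ) :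
    ∀ (a z : PosRoot n) (C : Finset (PosRoot n)), z.row + z.col = a.row + a.col + d →
      z ∈ C → IsLabelChain C → (∀ c ∈ C, Below a c ∧ Below c z) →
      ∃ p : List (PosRoot n), p.head? = some a ∧ p.getLast? = some z ∧ p.IsChain DyckStep ∧
        ∑ c ∈ C, s c ≤ (p.map s).sum := by
  induction d with
  | zero =>
    intro a z C hd hz hC hb
    have haz : a = z := by
      have := (hb z hz).1
      exact PosRoot.ext (by unfold Below at this; omega) (by unfold Below at this; omega)
    subst haz
    refine ⟨[a], rfl, rfl, List.isChain_singleton _, ?_⟩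
    have : C ⊆ {a} := by
      intro c hc
      have := hb c hc
      unfold Below at this
      exact Finset.mem_singleton.2 (PosRoot.ext (by omega) (by omega))
    simpa using Finset.sum_le_sum_of_subset (f := s) this
  | succ d ih =>
    intro a z C hd hz hC hb
    have hza : z ≠ a := by rintro rfl; omega
    have key : ∃ a' : PosRoot n, DyckStep a a' ∧ ∀ c ∈ C, c ≠ a → Below a' c := by
      by_cases hr : ∀ c ∈ C, c ≠ a → a.col + 1 ≤ c.col
      · have h1 := hr z hz hza
        have h2 := (hb z hz).1
        unfold Below at h2
        refine ⟨⟨a.row, a.col + 1, a.row_lt, by have := a.row_le_col; omega, by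
          have := z.col_le; omega⟩, Or.inl ⟨rfl, rfl⟩, fun c hc hca => ⟨?_, hr c hc hca⟩⟩
        exact (hb c hc).1.1
      · push Not at hr
        obtain ⟨c, hc, hca, hcc⟩ := hr
        have h2 := (hb c hc).1
        unfold Below at h2
        have h3 : a.row < c.row := by
          by_contra h
          exact hca (PosRoot.ext (by omega) (by omega))
        refine ⟨⟨a.row + 1, a.col, by have := c.row_lt; omega, by have := c.row_le_col; omega, by
          have := c.col_le; omega⟩, Or.inr ⟨rfl, rfl⟩, fun e he hea => ⟨?_, (hb e he).1.2⟩⟩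
        have h4 := (hb e he).1
        unfold Below at h4
        by_contra h
        have h5 : e.row = a.row := by dsimp only at h; omega
        have h6 : e.col ≠ a.col := fun h6 => hea (PosRoot.ext h5 h6)
        have h7 := hC e he c hc
        unfold Below at h7
        omega
    obtain ⟨a', hs, hb'⟩ := key
    obtain ⟨p, hp1, hp2, hp3, hp4⟩ := ih a' z (C.erase a)
      (by rcases hs with hs | hs <;> omega) (Finset.mem_erase.2 ⟨hza, hz⟩)
      (hC.mono (Finset.erase_subset _ _))
      (fun c hc => ⟨hb' c (Finset.mem_of_mem_erase hc) (Finset.ne_of_mem_erase hc),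
        (hb c (Finset.mem_of_mem_erase hc)).2⟩)
    refine ⟨a :: p, rfl, ?_, ?_, ?_⟩
    · rw [List.getLast?_cons, hp2]; rfl
    · rw [List.isChain_cons]
      refine ⟨fun y hy => ?_, hp3⟩
      rw [hp1] at hy
      simp only [Option.mem_def, Option.some.injEq] at hy
      exact hy ▸ hs
    · rw [List.map_cons, List.sum_cons]
      have : ∑ c ∈ C, s c ≤ s a + ∑ c ∈ C.erase a, s c := by
        rw [← Finset.sum_insert (Finset.notMem_erase a C)]
        exact Finset.sum_le_sum_of_subset (fun c hc => by
          by_cases h : c = a <;> simp [h, hc])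
      omega

theorem dyck_pairwise {n : ℕ} {p : List (PosRoot n)} (h : p.IsChain DyckStep) :
    p.Pairwise (fun β γ => Below β γ ∧ β.row + β.col < γ.row + γ.col) := by
  have : IsTrans (PosRoot n) (fun β γ => Below β γ ∧ β.row + β.col < γ.row + γ.col) :=
    ⟨fun a b c h1 h2 => by unfold Below at *; omega⟩
  rw [← List.isChain_iff_pairwise]
  refine h.imp fun a b hab => ?_
  unfold Below
  rcases hab with hab | hab <;> omega

theorem below_of_dyck {n : ℕ} {p : List (PosRoot n)} (h : p.IsChain DyckStep) {a z : PosRoot n}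
    (ha : p.head? = some a) (hz : p.getLast? = some z) :
    IsLabelChain p.toFinset ∧ p.Nodup ∧ ∀ c ∈ p, Below a c ∧ Below c z := by
  have hp := dyck_pairwise h
  refine ⟨?_, ?_, ?_⟩
  · intro β hβ γ hγ
    rw [List.mem_toFinset] at hβ hγ
    by_cases e : β = γ
    · subst e; exact Or.inl ⟨le_rfl, le_rfl⟩
    · have : Std.Symm (fun β γ : PosRoot n => Below β γ ∨ Below γ β) := ⟨fun _ _ h => h.symm⟩
      exact (hp.imp (S := fun β γ => Below β γ ∨ Below γ β) (fun h => Or.inl h.1)).forall hβ hγ e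
  · refine hp.imp fun h e => ?_
    subst e; omega
  · intro c hc
    constructor
    · obtain ⟨q, rfl⟩ : ∃ q, p = a :: q := by
        cases p with
        | nil => simp at ha
        | cons x q => simp at ha; exact ⟨q, by rw [ha]⟩
      rcases List.mem_cons.1 hc with rfl | hc
      · exact ⟨le_rfl, le_rfl⟩
      · exact ((List.pairwise_cons.1 hp).1 c hc).1
    · obtain ⟨q, rfl⟩ := List.getLast?_eq_some_iff.1 hz
      rcases List.mem_append.1 hc with hc | hc
      · exact ((List.pairwise_append.1 hp).2.2 c hc z (by simp)).1
      · simp at hc; subst hc; exact ⟨le_rfl, le_rfl⟩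

/-- The inequalities defining `S(λ)`, expressed by chains of labels. -/
structure ChainBound {n : ℕ} (m : Fin n → ℕ) (s : PosRoot n → ℕ) : Prop where
  inner : ∀ (C : Finset (PosRoot n)) (i j : Fin n), IsLabelChain C →
    (∀ β ∈ C, (i : ℕ) ≤ β.row ∧ β.col ≤ j) → ∑ β ∈ C, s β ≤ ∑ k ∈ Finset.Icc i j, m k
  outer : ∀ (C : Finset (PosRoot n)) (i : Fin n), IsLabelChain C →
    (∀ β ∈ C, (i : ℕ) ≤ β.row) → ∑ β ∈ C, s β ≤ ∑ k ∈ Finset.Ici i, m k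

/-- A path is a chain. Conversely a chain within the given bounds, with an admissible end point
adjoined, is contained in a path, and enlarging a chain only enlarges the sum because `s` is
nonnegative. -/
theorem mem_S_iff {n : ℕ} {m : Fin n → ℕ} {s : PosRoot n → ℕ} :
    s ∈ S m ↔ ChainBound m s := by
  have cast1 : ∀ (p : List (PosRoot n)) (T : Finset (Fin n)),
      (p.map (fun β => (s β : ℝ))).sum ≤ ∑ k ∈ T, (m k : ℝ) ↔
        (p.map s).sum ≤ ∑ k ∈ T, m k := by
    intro p T
    have : (p.map (fun β => (s β : ℝ))).sum = ((p.map s).sum : ℕ) := by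
      rw [Nat.cast_list_sum, List.map_map]; rfl
    rw [this, ← Nat.cast_sum, Nat.cast_le]
  constructor
  · rintro ⟨-, h⟩
    constructor
    · intro C i j hC hb
      rcases C.eq_empty_or_nonempty with rfl | ⟨c, hc⟩
      · simp
      have hij : i ≤ j := by
        have := hb c hc; have := c.row_le_col
        exact Fin.le_def.2 (by omega)
      have hj : Below (PosRoot.simple i) (PosRoot.simple j) := ⟨hij, hij⟩
      obtain ⟨p, h1, h2, h3, h4⟩ := exists_path_of_chain s (2 * (j - i)) (PosRoot.simple i)
        (PosRoot.simple j) (insert (PosRoot.simple j) C)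
        (by have := Fin.le_def.1 hij; simp only [PosRoot.simple]; omega)
        (Finset.mem_insert_self _ _)
        (by
          intro β hβ γ hγ
          rw [Finset.mem_insert] at hβ hγ
          have aux : ∀ c ∈ C, Below c (PosRoot.simple j) := fun c hc =>
            ⟨c.row_le_col.trans (hb c hc).2, (hb c hc).2⟩
          rcases hβ with rfl | hβ <;> rcases hγ with rfl | hγ
          · exact Or.inl ⟨le_rfl, le_rfl⟩
          · exact Or.inr (aux _ hγ)
          · exact Or.inl (aux _ hβ)
          · exact hC _ hβ _ hγ)
        (by
          intro c hc
          rcases Finset.mem_insert.1 hc with rfl | hc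
          · exact ⟨hj, ⟨le_rfl, le_rfl⟩⟩
          · exact ⟨⟨(hb c hc).1, (hb c hc).1.trans c.row_le_col⟩,
              ⟨c.row_le_col.trans (hb c hc).2, (hb c hc).2⟩⟩)
      have h5 := (cast1 p _).1 ((h p i j).1 ⟨h1, h2, ⟨j, hij, Or.inl rfl⟩, h3⟩)
      exact (Finset.sum_le_sum_of_subset (Finset.subset_insert _ _)).trans (h4.trans h5)
    · intro C i hC hb
      rcases C.eq_empty_or_nonempty with rfl | hne
      · simp
      obtain ⟨c, hc, hmax⟩ := C.exists_max_image (fun c => c.row + c.col) hne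
      have hcz : ∀ e ∈ C, Below e c := by
        intro e he
        rcases hC e he c hc with h | h
        · exact h
        · have := hmax e he
          unfold Below at *
          omega
      have hic : i ≤ (⟨c.row, c.row_lt⟩ : Fin n) := Fin.le_def.2 (hb c hc)
      -- The largest member of the chain selects the end point: the last label of its row.
      set j : Fin n := ⟨c.row, c.row_lt⟩ with hj
      have hcj : Below c (PosRoot.highest j) := ⟨le_rfl, c.col_le⟩
      have hij : Below (PosRoot.simple i) (PosRoot.highest j) := ⟨hic, by
        have := c.row_le_col; have := c.col_le; have := hb c hc
        simp only [PosRoot.simple, PosRoot.highest, hj]; omega⟩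
      have hCj : ∀ e ∈ C, Below e (PosRoot.highest j) := fun e he =>
        ⟨(hcz e he).1.trans hcj.1, (hcz e he).2.trans hcj.2⟩
      obtain ⟨p, h1, h2, h3, h4⟩ := exists_path_of_chain s
        ((PosRoot.highest j).row + (PosRoot.highest j).col - 2 * i) (PosRoot.simple i)
        (PosRoot.highest j) (insert (PosRoot.highest j) C)
        (by
          have h1 := hij.1; have h2 := hij.2
          simp only [PosRoot.simple] at *; omega)
        (Finset.mem_insert_self _ _)
        (by
          intro β hβ γ hγ
          rw [Finset.mem_insert] at hβ hγ
          rcases hβ with rfl | hβ <;> rcases hγ with rfl | hγ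
          · exact Or.inl ⟨le_rfl, le_rfl⟩
          · exact Or.inr (hCj _ hγ)
          · exact Or.inl (hCj _ hβ)
          · exact hC _ hβ _ hγ)
        (by
          intro e he
          rcases Finset.mem_insert.1 he with rfl | he
          · exact ⟨hij, ⟨le_rfl, le_rfl⟩⟩
          · exact ⟨⟨hb e he, (hb e he).trans e.row_le_col⟩, hCj e he⟩)
      have h5 := (cast1 p _).1 ((h p i j).2 ⟨h1, h2, ⟨j, hic, Or.inr rfl⟩, h3⟩)
      exact (Finset.sum_le_sum_of_subset (Finset.subset_insert _ _)).trans (h4.trans h5)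
  · intro h
    refine ⟨fun β => Nat.cast_nonneg _, fun p i j => ⟨fun hp => ?_, fun hp => ?_⟩⟩
    · rw [cast1]
      obtain ⟨h1, h2, h3⟩ := below_of_dyck hp.step hp.head hp.last
      rw [← List.sum_toFinset s h2]
      exact h.inner _ i j h1 fun β hβ =>
        ⟨(h3 β (List.mem_toFinset.1 hβ)).1.1, (h3 β (List.mem_toFinset.1 hβ)).2.2⟩
    · rw [cast1]
      obtain ⟨h1, h2, h3⟩ := below_of_dyck hp.step hp.head hp.last
      rw [← List.sum_toFinset s h2]
      exact h.outer _ i h1 fun β hβ => (h3 β (List.mem_toFinset.1 hβ)).1.1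

theorem finite_S {n : ℕ} (m : Fin n → ℕ) : (S m).Finite := by
  refine (Set.finite_Iic (fun _ : PosRoot n => ∑ k, m k)).subset fun s hs β => ?_
  have h := (mem_S_iff.1 hs).outer {β} ⟨β.row, β.row_lt⟩
    (by intro γ hγ δ hδ
        rw [Finset.mem_singleton] at hγ hδ
        subst hγ; subst hδ; exact Or.inl ⟨le_rfl, le_rfl⟩)
    (by intro γ hγ; rw [Finset.mem_singleton] at hγ; subst hγ; exact le_rfl)
  rw [Finset.sum_singleton] at h
  exact h.trans (Finset.sum_le_univ_sum_of_nonneg (fun _ => Nat.zero_le _))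

/-! ### The Minkowski property -/

/-- The summand `s₂` is the indicator of the minimal labels, in the product order, of the support of
`s` in rows up to `l`; these form an antichain. For the rest, the only dangerous chains are those
that miss `s₂` although their bound drops by one. Such a chain either extends downwards by a minimal
label, so its sum was not maximal, or is supported in rows after `l`, where the two bounds agree.
Since `m` vanishes before `l`, the extended chain may start in row `0` at no cost. -/
theorem exists_add_of_mem_S {n : ℕ} {m : Fin n → ℕ} {l : Fin n} (hl : ∀ k < l, m k = 0)
    {s : PosRoot n → ℕ} (hs : s ∈ S (m + Pi.single l 1)) :
    ∃ s₁ ∈ S m, ∃ s₂ ∈ S (Pi.single l 1 : Fin n → ℕ), s = s₁ + s₂ := by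
  classical
  have H := mem_S_iff.1 hs
  have single_sum : ∀ T : Finset (Fin n), ∑ k ∈ T, (Pi.single l 1 : Fin n → ℕ) k =
      if l ∈ T then 1 else 0 := by
    intro T; simp [Pi.single_apply]
  let A : Finset (PosRoot n) := Finset.univ.filter fun β => β.row ≤ l ∧ s β ≠ 0
  have memA : ∀ β, β ∈ A ↔ β.row ≤ l ∧ s β ≠ 0 := fun β => by simp [A]
  let s₂ : PosRoot n → ℕ := fun β =>
    if β ∈ A ∧ ∀ γ ∈ A, Below γ β → γ = β then 1 else 0
  have hs₂ : ∀ β, s₂ β ≤ s β := by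
    intro β
    simp only [s₂]
    split_ifs with h
    · have := ((memA β).1 h.1).2; omega
    · omega
  -- The bound on a label ending before column `l` is a sum of values of `m` at indices below `l`,
  -- hence `0`.
  have zero_of_col : ∀ β : PosRoot n, β.col < l → s β = 0 := by
    intro β hβ
    have h := H.inner {β} ⟨β.row, β.row_lt⟩ ⟨β.col, hβ.trans l.2⟩
      (by intro γ hγ δ hδ
          rw [Finset.mem_singleton] at hγ hδ
          subst hγ; subst hδ; exact Or.inl ⟨le_rfl, le_rfl⟩)
      (by intro γ hγ; rw [Finset.mem_singleton] at hγ; subst hγ; exact ⟨le_rfl, le_rfl⟩)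
    rw [Finset.sum_singleton] at h
    have h0 : ∑ k ∈ Finset.Icc (⟨β.row, β.row_lt⟩ : Fin n) ⟨β.col, hβ.trans l.2⟩,
        (m + Pi.single l 1 : Fin n → ℕ) k = 0 := by
      refine Finset.sum_eq_zero fun k hk => ?_
      have hk' : k < l := lt_of_le_of_lt (Finset.mem_Icc.1 hk).2 (Fin.lt_def.2 hβ)
      simp [hl k hk', hk'.ne]
    omega
  have below_min : ∀ β ∈ A, ∃ γ ∈ A, Below γ β ∧ s₂ γ = 1 := by
    intro β hβ
    obtain ⟨γ, hγ, hmin⟩ := (A.filter fun γ => Below γ β).exists_min_image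
      (fun γ => γ.row + γ.col) ⟨β, Finset.mem_filter.2 ⟨hβ, le_rfl, le_rfl⟩⟩
    rw [Finset.mem_filter] at hγ
    refine ⟨γ, hγ.1, hγ.2, if_pos ⟨hγ.1, fun δ hδ hδγ => ?_⟩⟩
    have := hmin δ (by
      rw [Finset.mem_filter]
      exact ⟨hδ, hδγ.1.trans hγ.2.1, hδγ.2.trans hγ.2.2⟩)
    unfold Below at hδγ
    exact PosRoot.ext (by omega) (by omega)
  have s₂_eq : ∀ β, s₂ β ≠ 0 → β ∈ A ∧ (∀ γ ∈ A, Below γ β → γ = β) ∧ s₂ β = 1 := by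
    intro β h
    simp only [s₂] at h ⊢
    split_ifs at h ⊢ with h'
    · exact ⟨h'.1, h'.2, rfl⟩
    · exact absurd rfl h
  have chain_le_one : ∀ C : Finset (PosRoot n), IsLabelChain C → ∑ β ∈ C, s₂ β ≤ 1 := by
    intro C hC
    by_cases h : ∃ β ∈ C, s₂ β ≠ 0
    · obtain ⟨β, hβC, hβ⟩ := h
      have e := s₂_eq β hβ
      rw [Finset.sum_eq_single β, e.2.2]
      · intro γ hγ hne
        by_contra h0
        have e' := s₂_eq γ h0
        rcases hC β hβC γ hγ with h | h
        · exact hne (e'.2.1 β e.1 h).symm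
        · exact hne (e.2.1 γ e'.1 h)
      · intro h; exact absurd hβC h
    · push Not at h
      rw [Finset.sum_eq_zero h]; omega
  -- a uniform bound for the difference on chains whose bound drops
  have drop : ∀ (C : Finset (PosRoot n)) (i : Fin n), IsLabelChain C → i ≤ l →
      (∀ β ∈ C, (i : ℕ) ≤ β.row) → ∀ M : ℕ,
      (∀ (D : Finset (PosRoot n)), IsLabelChain D →
        (∀ β ∈ D, ∃ γ ∈ C, β.col ≤ γ.col) → ∑ β ∈ D, s β ≤ M + 1) →
      ((∀ β ∈ C, s β ≠ 0 → (l : ℕ) < β.row) → ∑ β ∈ C, s β ≤ M) →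
      ∑ β ∈ C, (s β - s₂ β) ≤ M := by
    intro C i hC hil hb M hD hE
    by_cases h : ∃ β ∈ C, s₂ β ≠ 0
    · obtain ⟨β, hβC, hβ⟩ := h
      have e := s₂_eq β hβ
      have h1 := hD C hC (fun β hβ => ⟨β, hβ, le_rfl⟩)
      have h2 : ∑ γ ∈ C, (s γ - s₂ γ) + ∑ γ ∈ C, s₂ γ = ∑ γ ∈ C, s γ := by
        rw [← Finset.sum_add_distrib]
        exact Finset.sum_congr rfl fun γ _ => Nat.sub_add_cancel (hs₂ γ)
      have h3 : 1 ≤ ∑ γ ∈ C, s₂ γ := by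
        rw [← e.2.2]; exact Finset.single_le_sum (fun _ _ => Nat.zero_le _) hβC
      omega
    · push Not at h
      have e1 : ∑ β ∈ C, (s β - s₂ β) = ∑ β ∈ C, s β :=
        Finset.sum_congr rfl fun β hβ => by rw [h β hβ]; rfl
      rw [e1]
      by_cases hne : ∃ β ∈ C, s β ≠ 0 ∧ β.row ≤ l
      · obtain ⟨β₀, hβ₀C, hβ₀⟩ := hne
        obtain ⟨β, hβ, hmin⟩ := (C.filter fun β => s β ≠ 0 ∧ β.row ≤ l).exists_min_image
          (fun γ => γ.row + γ.col) ⟨β₀, by simp [hβ₀C, hβ₀]⟩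
        rw [Finset.mem_filter] at hβ
        -- A minimal label below the lowest support point of the chain; adjoining it keeps a chain
        -- and adds at least one to the sum.
        obtain ⟨γ, hγA, hγβ, hγ⟩ := below_min β ((memA β).2 ⟨hβ.2.2, hβ.2.1⟩)
        have hγC : γ ∉ C := fun hc => by have := h γ hc; omega
        have below_all : ∀ δ ∈ C, s δ ≠ 0 → Below γ δ := by
          intro δ hδ h0
          have : Below β δ := by
            rcases hC β hβ.1 δ hδ with h1 | h1
            · exact h1
            · have h2 := hmin δ (by
                rw [Finset.mem_filter]; exact ⟨hδ, h0, h1.1.trans hβ.2.2⟩)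
              unfold Below at *; omega
          exact ⟨hγβ.1.trans this.1, hγβ.2.trans this.2⟩
        have := hD (insert γ (C.filter fun β => s β ≠ 0)) (by
            intro δ hδ ε hε
            rw [Finset.mem_insert, Finset.mem_filter] at hδ hε
            rcases hδ with rfl | hδ <;> rcases hε with rfl | hε
            · exact Or.inl ⟨le_rfl, le_rfl⟩
            · exact Or.inl (below_all _ hε.1 hε.2)
            · exact Or.inr (below_all _ hδ.1 hδ.2)
            · exact hC _ hδ.1 _ hε.1)
          (by
            intro δ hδ
            rw [Finset.mem_insert, Finset.mem_filter] at hδ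
            rcases hδ with rfl | hδ
            · exact ⟨β, hβ.1, hγβ.2⟩
            · exact ⟨δ, hδ.1, le_rfl⟩)
        rw [Finset.sum_insert (by simp [hγC]), Finset.sum_filter_ne_zero] at this
        have := ((memA γ).1 hγA).2
        omega
      · push Not at hne
        exact hE hne
  refine ⟨fun β => s β - s₂ β, mem_S_iff.2 ⟨?_, ?_⟩, s₂, mem_S_iff.2 ⟨?_, ?_⟩, ?_⟩
  · intro C i j hC hb
    by_cases hil : i ≤ l
    · by_cases hjl : l ≤ j
      · have hmem : l ∈ Finset.Icc i j := Finset.mem_Icc.2 ⟨hil, hjl⟩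
        refine drop C i hC hil (fun β hβ => (hb β hβ).1) _ ?_ ?_
        · intro D hD hDC
          have := H.inner D ⟨0, i.pos⟩ j hD (fun β hβ => ⟨Nat.zero_le _, by
            obtain ⟨γ, hγ, h⟩ := hDC β hβ
            exact h.trans (hb γ hγ).2⟩)
          simp only [Pi.add_apply, Finset.sum_add_distrib, single_sum] at this
          rw [if_pos (Finset.mem_Icc.2 ⟨Fin.le_def.2 (Nat.zero_le _), hjl⟩)] at this
          refine this.trans (Nat.add_le_add_right (le_of_eq ?_) 1)
          refine (Finset.sum_subset (Finset.Icc_subset_Icc (Fin.le_def.2 (Nat.zero_le _)) le_rfl)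
            fun k hk hk' => hl k ?_).symm
          rw [Finset.mem_Icc] at hk hk'
          exact lt_of_lt_of_le (not_le.1 fun h => hk' ⟨h, hk.2⟩) hil
        · intro hE
          -- The support starts after row `l`, and the interval of indices beginning at `l + 1` no
          -- longer contains `l`.
          by_cases hlj : (l : ℕ) + 1 < n
          · rw [← Finset.sum_filter_ne_zero]
            refine (H.inner _ ⟨l + 1, hlj⟩ j (hC.mono (Finset.filter_subset _ _)) ?_).trans ?_
            · intro β hβ
              rw [Finset.mem_filter] at hβ
              exact ⟨hE β hβ.1 hβ.2, (hb β hβ.1).2⟩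
            · simp only [Pi.add_apply, Finset.sum_add_distrib, single_sum]
              rw [if_neg (by
                rw [Finset.mem_Icc]; rintro ⟨h, -⟩
                have := Fin.le_def.1 h; dsimp only at this; omega), add_zero]
              exact Finset.sum_le_sum_of_subset (Finset.Icc_subset_Icc
                (hil.trans (Fin.le_def.2 (by simp))) le_rfl)
          · rw [Finset.sum_eq_zero]
            · exact Nat.zero_le _
            · intro β hβ
              by_contra h0
              have := hE β hβ h0; have := β.row_lt; omega
      · rw [Finset.sum_eq_zero]
        · exact Nat.zero_le _
        · intro β hβ
          rw [zero_of_col β (lt_of_le_of_lt (hb β hβ).2 (Fin.lt_def.1 (not_le.1 hjl))), Nat.zero_sub]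
    · refine (Finset.sum_le_sum fun β _ => Nat.sub_le _ _).trans
        ((H.inner C i j hC hb).trans (le_of_eq ?_))
      simp only [Pi.add_apply, Finset.sum_add_distrib, single_sum]
      rw [if_neg (fun h => hil (Finset.mem_Icc.1 h).1), add_zero]
  · intro C i hC hb
    by_cases hil : i ≤ l
    · refine drop C i hC hil hb _ ?_ ?_
      · intro D hD hDC
        have := H.outer D ⟨0, i.pos⟩ hD (fun β hβ => Nat.zero_le _)
        simp only [Pi.add_apply, Finset.sum_add_distrib, single_sum] at this
        rw [if_pos (Finset.mem_Ici.2 (Fin.le_def.2 (Nat.zero_le _)))] at this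
        refine this.trans (Nat.add_le_add_right (le_of_eq ?_) 1)
        refine (Finset.sum_subset (Finset.Ici_subset_Ici.2 (Fin.le_def.2 (Nat.zero_le _)))
          fun k hk hk' => hl k ?_).symm
        rw [Finset.mem_Ici] at hk'
        exact lt_of_lt_of_le (not_le.1 hk') hil
      · intro hE
        by_cases hlj : (l : ℕ) + 1 < n
        · rw [← Finset.sum_filter_ne_zero]
          refine (H.outer _ ⟨l + 1, hlj⟩ (hC.mono (Finset.filter_subset _ _)) ?_).trans ?_
          · intro β hβ
            rw [Finset.mem_filter] at hβ
            exact hE β hβ.1 hβ.2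
          · simp only [Pi.add_apply, Finset.sum_add_distrib, single_sum]
            rw [if_neg (by
              rw [Finset.mem_Ici]; intro h
              have := Fin.le_def.1 h; dsimp only at this; omega), add_zero]
            exact Finset.sum_le_sum_of_subset (Finset.Ici_subset_Ici.2
              (hil.trans (Fin.le_def.2 (by simp))))
        · rw [Finset.sum_eq_zero]
          · exact Nat.zero_le _
          · intro β hβ
            by_contra h0
            have := hE β hβ h0; have := β.row_lt; omega
    · refine (Finset.sum_le_sum fun β _ => Nat.sub_le _ _).trans
        ((H.outer C i hC hb).trans (le_of_eq ?_))
      simp only [Pi.add_apply, Finset.sum_add_distrib, single_sum]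
      rw [if_neg (fun h => hil (Finset.mem_Ici.1 h)), add_zero]
  · intro C i j hC hb
    rw [single_sum]
    split_ifs with h
    · exact chain_le_one C hC
    · rw [Finset.sum_eq_zero]
      intro β hβ
      by_contra h0
      have e := (memA β).1 (s₂_eq β h0).1
      have h1 : (l : ℕ) ≤ β.col := by
        by_contra h1
        exact e.2 (zero_of_col β (not_le.1 h1))
      exact h (Finset.mem_Icc.2 ⟨Fin.le_def.2 ((hb β hβ).1.trans e.1),
        Fin.le_def.2 (h1.trans (hb β hβ).2)⟩)
  · intro C i hC hb
    rw [single_sum]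
    split_ifs with h
    · exact chain_le_one C hC
    · rw [Finset.sum_eq_zero]
      intro β hβ
      by_contra h0
      have e := (memA β).1 (s₂_eq β h0).1
      exact h (Finset.mem_Ici.2 (Fin.le_def.2 ((hb β hβ).trans e.1)))
  · funext β
    exact (Nat.sub_add_cancel (hs₂ β)).symm

/-! ### Letters and degrees -/

/-- The root vector for `-β` maps the basis vector `row β` to a multiple of the basis vector
`tgt β`. -/
def PosRoot.tgt {n : ℕ} (β : PosRoot n) : Fin n ⊕ Fin n :=
  if h : β.col + 1 < n then Sum.inl ⟨β.col + 1, h⟩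
  else Sum.inr ⟨2 * n - 2 - β.col, by have := β.row_lt; omega⟩

/-- The row of a label, as an index. -/
def PosRoot.src {n : ℕ} (β : PosRoot n) : Fin n := ⟨β.row, β.row_lt⟩

theorem PosRoot.tgt_eq_inl {n : ℕ} {β : PosRoot n} {k : Fin n} :
    β.tgt = Sum.inl k ↔ (k : ℕ) = β.col + 1 := by
  unfold PosRoot.tgt
  split_ifs with h
  · rw [Sum.inl.injEq, Fin.ext_iff]; exact eq_comm
  · simp only [false_iff]; have := k.2; omega

theorem PosRoot.tgt_eq_inr {n : ℕ} {β : PosRoot n} {k : Fin n} :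
    β.tgt = Sum.inr k ↔ (k : ℕ) + β.col = 2 * n - 2 ∧ β.row ≤ k := by
  have h1 := β.row_lt; have h2 := β.row_le_col; have h3 := β.col_le; have h4 := k.2
  unfold PosRoot.tgt
  split_ifs with h
  · simp only [false_iff]; omega
  · rw [Sum.inr.injEq, Fin.ext_iff]; dsimp only; omega

/-- The letters of a label. -/
def letters {n : ℕ} (β : PosRoot n) : (Fin n ⊕ Fin n) →₀ ℕ :=
  Finsupp.single (Sum.inr β.src) 1 + Finsupp.single β.tgt 1

theorem letters_ne_zero {n : ℕ} {β : PosRoot n} {x : Fin n ⊕ Fin n} :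
    letters β x ≠ 0 ↔ x = Sum.inr β.src ∨ x = β.tgt := by
  simp only [letters, Finsupp.add_apply, Finsupp.single_apply]
  split_ifs with h1 h2 h2 <;> simp [h1, h2, @eq_comm _ x]

/-- The number of occurrences of each letter. -/
def letterDegree {n : ℕ} (s : PosRoot n → ℕ) : (Fin n ⊕ Fin n) →₀ ℕ := ∑ β, s β • letters β

theorem letterDegree_apply {n : ℕ} (s : PosRoot n → ℕ) (x : Fin n ⊕ Fin n) :
    letterDegree s x = ∑ β, s β * letters β x := by
  simp [letterDegree, Finsupp.finsetSum_apply]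

/-- Among the multi-exponents with the same letters, one supported on a chain is the largest. -/
theorem lex_lt_of_letterDegree_eq {n : ℕ} {s t : PosRoot n → ℕ}
    (hs : ∀ β γ, s β ≠ 0 → s γ ≠ 0 → Below β γ ∨ Below γ β)
    (h : letterDegree t = letterDegree s) (hne : t ≠ s) : toLex t < toLex s := by
  rcases lt_trichotomy (toLex t) (toLex s) with h1 | h1 | ⟨b, hb, hlt⟩
  · exact h1
  · exact absurd (toLex.injective h1) hne
  exfalso
  -- At the first difference `b` the exponent `t` is larger. Letter counts agree, so `s` must make
  -- up for each letter of `b` by a label after `b`.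
  have key : ∀ x, letters b x ≠ 0 → (∀ β, b < β → s β ≠ 0 → letters β x = 0) → False := by
    intro x hx hx'
    have e := congrArg (fun f => f x) h
    simp only [letterDegree_apply] at e
    refine (lt_irrefl _ (e ▸ Finset.sum_lt_sum (f := fun β => s β * letters β x)
      (g := fun β => t β * letters β x) ?_ ⟨b, Finset.mem_univ _, ?_⟩))
    · intro β _
      rcases lt_trichotomy β b with h2 | h2 | h2
      · exact le_of_eq (by rw [show s β = t β from hb β h2])
      · subst h2; exact Nat.mul_le_mul_right _ (le_of_lt hlt)
      · by_cases h3 : s β = 0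
        · simp [h3]
        · simp [hx' β h2 h3]
    · exact Nat.mul_lt_mul_of_pos_right hlt (Nat.pos_of_ne_zero hx)
  have k1 := key (Sum.inr b.src) (letters_ne_zero.2 (Or.inl rfl))
  have k2 := key b.tgt (letters_ne_zero.2 (Or.inr rfl))
  have h1 : ∃ β, b < β ∧ s β ≠ 0 ∧ letters β (Sum.inr b.src) ≠ 0 := by
    by_contra hcon; push Not at hcon; exact k1 hcon
  have h2 : ∃ β, b < β ∧ s β ≠ 0 ∧ letters β b.tgt ≠ 0 := by
    by_contra hcon; push Not at hcon; exact k2 hcon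
  obtain ⟨c, hc, hsc, hlc⟩ := h1
  obtain ⟨d, hd, hsd, hld⟩ := h2
  have hcd := hs c d hsc hsd
  rw [PosRoot.lt_iff] at hc hd
  unfold Below at hcd
  have c1 := c.row_le_col; have c2 := c.col_le; have d1 := d.row_le_col; have d2 := d.col_le
  have b1 := b.row_le_col; have b2 := b.col_le; have b3 := b.row_lt; have d3 := d.row_lt
  -- The label `c` lies in the row of `b` and further along it, while `d` lies in a later row and
  -- not beyond the column of `b`. Such labels are incomparable.
  have hc' : c.row = b.row ∧ b.col < c.col := by
    rcases letters_ne_zero.1 hlc with h3 | h3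
    · have := congrArg Fin.val (Sum.inr_injective h3)
      simp only [PosRoot.src] at this
      omega
    · have := PosRoot.tgt_eq_inr.1 h3.symm
      simp only [PosRoot.src] at this
      omega
  have hd' : b.row < d.row ∧ d.col ≤ b.col := by
    rcases letters_ne_zero.1 hld with h3 | h3
    · have := PosRoot.tgt_eq_inr.1 h3
      simp only [PosRoot.src] at this
      omega
    · have : d.col = b.col := by
        rcases hb : b.tgt with k | k
        · have e1 := PosRoot.tgt_eq_inl.1 hb
          have e2 := PosRoot.tgt_eq_inl.1 (h3.symm.trans hb)
          omega
        · have e1 := PosRoot.tgt_eq_inr.1 hb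
          have e2 := PosRoot.tgt_eq_inr.1 (h3.symm.trans hb)
          omega
      omega
  omega

/-! ### The monomial order -/

/-- Multi-exponents are compared by total degree first and lexicographically second. -/
def monomialKey {n : ℕ} (s : PosRoot n → ℕ) : ℕ ×ₗ Lex (PosRoot n → ℕ) :=
  toLex (∑ β, s β, toLex s)

theorem monomialKey_add {n : ℕ} (s t : PosRoot n → ℕ) :
    monomialKey (s + t) = monomialKey s + monomialKey t := by
  simp only [monomialKey, Pi.add_apply, Finset.sum_add_distrib]
  rfl

theorem monomialKey_injective {n : ℕ} : Function.Injective (monomialKey (n := n)) := by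
  intro s t h
  exact toLex.injective (congrArg (fun x => (ofLex x).2) h)

theorem monomialKey_lt_iff {n : ℕ} {s t : PosRoot n → ℕ} :
    monomialKey s < monomialKey t ↔
      ∑ β, s β < ∑ β, t β ∨ ∑ β, s β = ∑ β, t β ∧ toLex s < toLex t := by
  rw [monomialKey, monomialKey, Prod.Lex.toLex_lt_toLex]

/-- The multi-exponent of a list of labels. -/
def multiplicity {n : ℕ} (w : List (PosRoot n)) : PosRoot n → ℕ := fun β => w.count β

theorem multiplicity_append {n : ℕ} (w w' : List (PosRoot n)) :
    multiplicity (w ++ w') = multiplicity w + multiplicity w' := by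
  funext β; simp [multiplicity]

theorem sum_multiplicity {n : ℕ} (w : List (PosRoot n)) :
    ∑ β, multiplicity w β = w.length := by
  have := Multiset.sum_count_eq_card (s := Finset.univ) (m := (w : Multiset (PosRoot n)))
    (fun a _ => Finset.mem_univ a)
  simpa [multiplicity] using this

theorem multiplicity_eq_iff_perm {n : ℕ} {w w' : List (PosRoot n)} :
    multiplicity w = multiplicity w' ↔ w.Perm w' := by
  rw [List.perm_iff_count]
  exact funext_iff

theorem exists_multiplicity_eq {n : ℕ} (s : PosRoot n → ℕ) : ∃ w, multiplicity w = s := by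
  let f : PosRoot n →₀ ℕ := Finsupp.equivFunOnFinite.symm s
  refine ⟨(Finsupp.toMultiset f).toList, funext fun β => ?_⟩
  rw [multiplicity, ← Multiset.coe_count, Multiset.coe_toList, Finsupp.count_toMultiset]
  rfl

theorem letterDegree_multiplicity {n : ℕ} (w : List (PosRoot n)) :
    letterDegree (multiplicity w) = (w.map letters).sum := by
  induction w with
  | nil => simp [letterDegree, multiplicity]
  | cons b w ih =>
    rw [List.map_cons, List.sum_cons, ← ih]
    simp only [letterDegree, multiplicity, List.count_cons, add_smul, Finset.sum_add_distrib]
    rw [add_comm]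
    congr 1
    simp

/-! ### Integral points for a fundamental weight -/

/-- All bounds are `0` or `1`, so chains with one or two members already force `s` to be the
indicator of an antichain. -/
theorem mem_S_single {n : ℕ} {l : Fin n} {s : PosRoot n → ℕ} (hs : s ∈ S (Pi.single l 1)) :
    (∀ β, s β ≠ 0 → s β = 1 ∧ β.row ≤ l ∧ (l : ℕ) ≤ β.col) ∧
      ∀ β γ, s β ≠ 0 → s γ ≠ 0 → β.row ≤ γ.row → β.col ≤ γ.col → β = γ := by
  have H := mem_S_iff.1 hs
  have single_sum : ∀ T : Finset (Fin n), ∑ k ∈ T, (Pi.single l 1 : Fin n → ℕ) k =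
      if l ∈ T then 1 else 0 := by
    intro T; simp [Pi.single_apply]
  have chain_single : ∀ β : PosRoot n, IsLabelChain {β} := by
    intro β γ hγ δ hδ
    rw [Finset.mem_singleton] at hγ hδ
    subst hγ; subst hδ; exact Or.inl ⟨le_rfl, le_rfl⟩
  constructor
  · intro β hβ
    have h1 := H.outer {β} β.src (chain_single β)
      (by intro γ hγ; rw [Finset.mem_singleton] at hγ; subst hγ; exact le_rfl)
    rw [Finset.sum_singleton, single_sum] at h1
    have hrow : β.row ≤ l := by
      by_contra h
      rw [if_neg (by rw [Finset.mem_Ici, Fin.le_def]; exact h)] at h1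
      omega
    refine ⟨?_, hrow, ?_⟩
    · split_ifs at h1 <;> omega
    · by_contra h
      have h2 := H.inner {β} β.src ⟨β.col, by have := l.2; omega⟩ (chain_single β)
        (by intro γ hγ; rw [Finset.mem_singleton] at hγ; subst hγ; exact ⟨le_rfl, le_rfl⟩)
      rw [Finset.sum_singleton, single_sum, if_neg (by
        rw [Finset.mem_Icc, Fin.le_def, Fin.le_def]; exact fun h' => h h'.2)] at h2
      omega
  · intro β γ hβ hγ h1 h2
    by_contra hne
    have h3 := H.outer {β, γ} β.src (by
        intro δ hδ ε hε
        simp only [Finset.mem_insert, Finset.mem_singleton] at hδ hε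
        unfold Below
        rcases hδ with rfl | rfl <;> rcases hε with rfl | rfl <;> omega)
      (by intro δ hδ
          simp only [Finset.mem_insert, Finset.mem_singleton] at hδ
          rcases hδ with rfl | rfl
          · exact le_rfl
          · exact h1)
    rw [Finset.sum_pair hne, single_sum] at h3
    split_ifs at h3 <;> omega

/-! ### Elements of the symplectic Lie algebra and symmetric matrices -/

theorem mem_sp_iff {n : ℕ} {X : Matrix (Fin n ⊕ Fin n) (Fin n ⊕ Fin n) ℂ} :
    X ∈ Sp n ↔ X.transpose * Matrix.J (Fin n) ℂ = -(Matrix.J (Fin n) ℂ * X) := by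
  rw [Sp, LieAlgebra.Symplectic.sp, mem_skewAdjointMatricesLieSubalgebra,
    mem_skewAdjointMatricesSubmodule, Matrix.IsSkewAdjoint, Matrix.IsAdjointPair, mul_neg]

/-- The element `(S + Sᵀ) J` of the symplectic Lie algebra. -/
def ofMat {n : ℕ} : Matrix (Fin n ⊕ Fin n) (Fin n ⊕ Fin n) ℂ →ₗ[ℂ] Sp n where
  toFun A := ⟨(A + A.transpose) * Matrix.J (Fin n) ℂ, by
    rw [mem_sp_iff, Matrix.transpose_mul, Matrix.J_transpose, Matrix.transpose_add,
      Matrix.transpose_transpose]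
    noncomm_ring⟩
  map_add' A B := Subtype.ext (by
    change (A + B + (A + B).transpose) * _ = (A + A.transpose) * _ + (B + B.transpose) * _
    rw [Matrix.transpose_add]; noncomm_ring)
  map_smul' c A := Subtype.ext (by
    change (c • A + (c • A).transpose) * _ = c • ((A + A.transpose) * _)
    rw [Matrix.transpose_smul, ← smul_add, Matrix.smul_mul])

theorem mul_J_apply {n : ℕ} (A : Matrix (Fin n ⊕ Fin n) (Fin n ⊕ Fin n) ℂ) (c d : Fin n ⊕ Fin n) :
    (A * Matrix.J (Fin n) ℂ) c d = Sum.elim (fun _ => 1) (fun _ => -1) d * A c d.swap := by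
  rw [Matrix.mul_apply, Fintype.sum_sum_type]
  rcases d with d | d <;> simp [Matrix.J, Matrix.one_apply]

theorem ofMat_apply {n : ℕ} (A : Matrix (Fin n ⊕ Fin n) (Fin n ⊕ Fin n) ℂ)
    (c d : Fin n ⊕ Fin n) :
    (ofMat A : Matrix (Fin n ⊕ Fin n) (Fin n ⊕ Fin n) ℂ) c d =
      Sum.elim (fun _ => 1) (fun _ => -1) d * (A c d.swap + A d.swap c) :=
  mul_J_apply _ c d

/-- Membership in the symplectic algebra says exactly that `X J` is symmetric, and `J ^ 2 = -1`
recovers `X` from it; the factor one half undoes the symmetrization in `ofMat`. -/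
theorem exists_ofMat {n : ℕ} (X : Sp n) : ∃ A, ofMat A = X ∧ A.transpose = A ∧
    A = (-(1 / 2 : ℂ)) • ((X : Matrix (Fin n ⊕ Fin n) (Fin n ⊕ Fin n) ℂ) * Matrix.J (Fin n) ℂ) := by
  have hX := mem_sp_iff.1 X.2
  have hJ := Matrix.J_squared (Fin n) ℂ
  have hsym : ((X : Matrix (Fin n ⊕ Fin n) (Fin n ⊕ Fin n) ℂ) * Matrix.J (Fin n) ℂ).transpose =
      (X : Matrix (Fin n ⊕ Fin n) (Fin n ⊕ Fin n) ℂ) * Matrix.J (Fin n) ℂ := by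
    rw [Matrix.transpose_mul, Matrix.J_transpose, neg_mul]
    have h2 := congrArg (fun Y => Matrix.J (Fin n) ℂ * Y * Matrix.J (Fin n) ℂ) hX
    simp only [mul_neg, neg_mul, mul_assoc, hJ] at h2
    rw [← mul_assoc (Matrix.J (Fin n) ℂ) (Matrix.J (Fin n) ℂ), hJ] at h2
    simp only [mul_one, neg_mul, one_mul, neg_neg] at h2
    rw [h2]
  refine ⟨_, ?_, ?_, rfl⟩
  · apply Subtype.ext
    change (_ + Matrix.transpose _) * _ = _
    rw [Matrix.transpose_smul, hsym, ← add_smul, Matrix.smul_mul, mul_assoc, hJ]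
    norm_num
  · rw [Matrix.transpose_smul, hsym]

/-- The element attached to a symmetric product of two basis vectors. -/
def pairElt {n : ℕ} (a b : Fin n ⊕ Fin n) : Sp n := ofMat (Matrix.single a b 1)

theorem pairElt_comm {n : ℕ} (a b : Fin n ⊕ Fin n) : pairElt a b = pairElt b a := by
  apply Subtype.ext
  change (_ + Matrix.transpose _) * _ = (_ + Matrix.transpose _) * _
  rw [Matrix.transpose_single, Matrix.transpose_single, add_comm]

theorem ofMat_eq_sum {n : ℕ} (A : Matrix (Fin n ⊕ Fin n) (Fin n ⊕ Fin n) ℂ) :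
    ofMat A = ∑ a, ∑ b, A a b • pairElt a b := by
  conv_lhs => rw [Matrix.matrix_eq_sum_single A]
  simp only [map_sum, pairElt]
  refine Finset.sum_congr rfl fun a _ => Finset.sum_congr rfl fun b _ => ?_
  rw [← map_smul, Matrix.smul_single, smul_eq_mul, mul_one]

/-- The conjugate transpose of an element of the symplectic Lie algebra. -/
def conjSp {n : ℕ} (X : Sp n) : Sp n :=
  ⟨(X : Matrix (Fin n ⊕ Fin n) (Fin n ⊕ Fin n) ℂ).conjTranspose, by
    have hX := congrArg Matrix.conjTranspose (mem_sp_iff.1 X.2)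
    have hJ := Matrix.J_squared (Fin n) ℂ
    have hJ' : (Matrix.J (Fin n) ℂ).conjTranspose = -Matrix.J (Fin n) ℂ := by
      simp [Matrix.J, Matrix.fromBlocks_conjTranspose, Matrix.fromBlocks_neg]
    rw [Matrix.conjTranspose_mul, Matrix.conjTranspose_neg, Matrix.conjTranspose_mul, hJ'] at hX
    rw [mem_sp_iff]
    have h2 := congrArg (fun Y => Matrix.J (Fin n) ℂ * Y * Matrix.J (Fin n) ℂ) hX
    simp only [mul_neg, neg_mul, neg_neg, mul_assoc, hJ] at h2
    rw [← mul_assoc, hJ] at h2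
    simp only [neg_mul, one_mul, neg_neg, mul_one] at h2
    exact h2⟩

/-! ### Weights -/

/-- The weight of a basis vector of the natural module. -/
def basisWeight {n : ℕ} (a : Fin n ⊕ Fin n) : Weight n := Sum.elim eps (fun i => -eps i) a

theorem basisWeight_swap {n : ℕ} (a : Fin n ⊕ Fin n) : basisWeight a.swap = -basisWeight a := by
  rcases a with a | a <;> simp [basisWeight]

theorem cartan_apply {n : ℕ} (h : cartan n) (a : Fin n ⊕ Fin n) :
    ((h : Sp n) : Matrix (Fin n ⊕ Fin n) (Fin n ⊕ Fin n) ℂ) a a = basisWeight a h := by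
  rcases a with i | i
  · rfl
  · have e := congrArg (fun M => M (Sum.inr i) (Sum.inl i)) (mem_sp_iff.1 (h : Sp n).2)
    simp only [Matrix.neg_apply] at e
    rw [mul_J_apply, Matrix.mul_apply, Fintype.sum_sum_type] at e
    simp [Matrix.J, Matrix.one_apply] at e
    rw [e]
    rfl

theorem cartan_lie_apply {n : ℕ} (h : cartan n) (X : Sp n) (c d : Fin n ⊕ Fin n) :
    ((⁅(h : Sp n), X⁆ : Sp n) : Matrix (Fin n ⊕ Fin n) (Fin n ⊕ Fin n) ℂ) c d =
      (basisWeight c + basisWeight d.swap) h *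
        (X : Matrix (Fin n ⊕ Fin n) (Fin n ⊕ Fin n) ℂ) c d := by
  have hd : ((h : Sp n) : Matrix (Fin n ⊕ Fin n) (Fin n ⊕ Fin n) ℂ).IsDiag := h.2
  rw [LieSubalgebra.coe_bracket, Ring.lie_def, Matrix.sub_apply, Matrix.mul_apply,
    Matrix.mul_apply, Finset.sum_eq_single c, Finset.sum_eq_single d, cartan_apply, cartan_apply,
    basisWeight_swap]
  · simp only [LinearMap.add_apply, LinearMap.neg_apply]; ring
  · intro b _ hb; rw [hd hb, mul_zero]
  · simp
  · intro b _ hb; rw [hd hb.symm, zero_mul]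
  · simp

theorem cartan_lie_pairElt {n : ℕ} (h : cartan n) (a b : Fin n ⊕ Fin n) :
    ⁅(h : Sp n), pairElt a b⁆ = (basisWeight a + basisWeight b) h • pairElt a b := by
  apply Subtype.ext
  ext c d
  rw [cartan_lie_apply]
  change _ = _ * (pairElt a b : Matrix (Fin n ⊕ Fin n) (Fin n ⊕ Fin n) ℂ) c d
  rw [pairElt, ofMat_apply]
  by_cases h1 : a = c ∧ b = d.swap
  · rw [h1.1, h1.2]
  · by_cases h2 : a = d.swap ∧ b = c
    · rw [h2.1, h2.2, add_comm]
    · rw [Matrix.single_apply_of_ne _ _ _ _ _ h1, Matrix.single_apply_of_ne _ _ _ _ _ h2]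
      simp

/-- The weight of a letter of the natural module, with letters numbered from `0` to `2n-1`. -/
def numberedWeight (n x : ℕ) : Weight n :=
  if h : x < n then eps ⟨x, h⟩
  else if h : 2 * n - 1 - x < n then -eps ⟨2 * n - 1 - x, h⟩ else 0

/-- With the weights listed as `ε₁, …, εₙ, -εₙ, …, -ε₁`, the simple root of each letter is a
difference of neighbours; the middle one is the long root `2 εₙ`. Sums over intervals of letters
therefore telescope. -/
theorem letterRoot_eq {n x : ℕ} (hx : x + 2 ≤ 2 * n) :
    letterRoot n x = numberedWeight n x - numberedWeight n (x + 1) := by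
  unfold letterRoot numberedWeight simpleRoot
  rcases lt_trichotomy (x + 1) n with h | h | h
  · have e : min x (2 * n - 2 - x) = x := by omega
    simp only [e]
    rw [dif_pos (by omega), dif_pos (by omega), dif_pos (by omega), dif_pos (by omega)]
  · have e : min x (2 * n - 2 - x) = x := by omega
    have e' : 2 * n - 1 - (x + 1) = x := by omega
    simp only [e, e']
    rw [dif_pos (by omega), dif_neg (by omega), dif_pos (by omega), dif_neg (by omega),
      dif_pos (by omega), two_smul, sub_neg_eq_add]
  · have e : min x (2 * n - 2 - x) = 2 * n - 2 - x := by omega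
    have e' : 2 * n - 1 - (x + 1) = 2 * n - 2 - x := by omega
    have e'' : 2 * n - 1 - x = 2 * n - 2 - x + 1 := by omega
    simp only [e, e', e'']
    rw [dif_pos (by omega), dif_pos (by omega), dif_neg (by omega), dif_pos (by omega),
      dif_neg (by omega), dif_pos (by omega)]
    abel

theorem PosRoot.neg_root {n : ℕ} (β : PosRoot n) :
    -β.root = basisWeight (Sum.inr β.src) + basisWeight β.tgt := by
  have h1 := β.row_lt; have h2 := β.row_le_col; have h3 := β.col_le
  have e : β.root = numberedWeight n β.row - numberedWeight n (β.col + 1) := by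
    unfold PosRoot.root
    rw [← Finset.Ico_add_one_right_eq_Icc, ← neg_sub (numberedWeight n (β.col + 1)),
      ← Finset.sum_Ico_sub (numberedWeight n) (by omega), ← Finset.sum_neg_distrib]
    refine Finset.sum_congr rfl fun x hx => ?_
    rw [Finset.mem_Ico] at hx
    rw [letterRoot_eq (by omega), neg_sub]
  rw [e]
  unfold numberedWeight
  rw [dif_pos h1, neg_sub, sub_eq_add_neg, add_comm]
  refine congrArg₂ _ rfl ?_
  rcases h : β.tgt with k | k
  · have := PosRoot.tgt_eq_inl.1 h
    have hk := k.2
    rw [dif_pos (by omega)]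
    simp only [basisWeight, Sum.elim_inl]
    congr 1
    exact Fin.ext this.symm
  · have := PosRoot.tgt_eq_inr.1 h
    have hk := k.2
    rw [dif_neg (by omega), dif_pos (by omega)]
    simp only [basisWeight, Sum.elim_inr]
    congr 2
    exact Fin.ext (by dsimp only; omega)

/-- The standard root vector for `-β`. -/
def negVec {n : ℕ} (β : PosRoot n) : Sp n := pairElt (Sum.inr β.src) β.tgt

/-- The standard root vector for `β`. -/
def posVec {n : ℕ} (β : PosRoot n) : Sp n := pairElt (Sum.inl β.src) β.tgt.swap

theorem tgt_ne_swap {n : ℕ} (β : PosRoot n) : β.tgt ≠ Sum.inl β.src := by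
  intro h
  have := PosRoot.tgt_eq_inl.1 h
  have := β.row_le_col
  simp only [PosRoot.src] at *
  omega

theorem negVec_mem {n : ℕ} (β : PosRoot n) : negVec β ∈ rootSpace (-β.root) := by
  rw [rootSpace, LieModule.mem_weightSpace]
  intro h
  rw [PosRoot.neg_root]
  exact cartan_lie_pairElt h _ _

theorem posVec_mem {n : ℕ} (β : PosRoot n) : posVec β ∈ rootSpace β.root := by
  rw [rootSpace, LieModule.mem_weightSpace]
  intro h
  have e : β.root = basisWeight (Sum.inl β.src) + basisWeight β.tgt.swap := by
    rw [← neg_neg β.root, PosRoot.neg_root, basisWeight_swap]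
    simp only [basisWeight, Sum.elim_inl, Sum.elim_inr, neg_add, neg_neg]
  rw [e]
  exact cartan_lie_pairElt h _ _

/-- Every pair of basis vectors gives a Cartan element or a root vector. -/
theorem pair_cases {n : ℕ} (a b : Fin n ⊕ Fin n) :
    a = b.swap ∨ (∃ β : PosRoot n, (a = Sum.inr β.src ∧ b = β.tgt) ∨
      (b = Sum.inr β.src ∧ a = β.tgt)) ∨
    ∃ β : PosRoot n, (a = Sum.inl β.src ∧ b = β.tgt.swap) ∨
      (b = Sum.inl β.src ∧ a = β.tgt.swap) := by
  have mixed : ∀ i j : Fin n, i < j → ∃ β : PosRoot n, β.src = i ∧ β.tgt = Sum.inl j := by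
    intro i j hij
    have := Fin.lt_def.1 hij
    have hj := j.2
    exact ⟨⟨i, j - 1, i.2, by omega, by omega⟩, rfl, PosRoot.tgt_eq_inl.2 (by dsimp only; omega)⟩
  have pure : ∀ i j : Fin n, i ≤ j → ∃ β : PosRoot n, β.src = i ∧ β.tgt = Sum.inr j := by
    intro i j hij
    have := Fin.le_def.1 hij
    have hj := j.2
    exact ⟨⟨i, 2 * n - 2 - j, i.2, by omega, by omega⟩, rfl,
      PosRoot.tgt_eq_inr.2 ⟨by dsimp only; omega, hij⟩⟩
  rcases a with i | i <;> rcases b with j | j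
  · refine Or.inr (Or.inr ?_)
    rcases le_total i j with h | h
    · obtain ⟨β, h1, h2⟩ := pure i j h
      exact ⟨β, Or.inl (by simp [h1, h2])⟩
    · obtain ⟨β, h1, h2⟩ := pure j i h
      exact ⟨β, Or.inr (by simp [h1, h2])⟩
  · rcases lt_trichotomy i j with h | h | h
    · obtain ⟨β, h1, h2⟩ := mixed i j h
      exact Or.inr (Or.inr ⟨β, Or.inl (by simp [h1, h2])⟩)
    · exact Or.inl (by simp [h])
    · obtain ⟨β, h1, h2⟩ := mixed j i h
      exact Or.inr (Or.inl ⟨β, Or.inr (by simp [h1, h2])⟩)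
  · rcases lt_trichotomy i j with h | h | h
    · obtain ⟨β, h1, h2⟩ := mixed i j h
      exact Or.inr (Or.inl ⟨β, Or.inl (by simp [h1, h2])⟩)
    · exact Or.inl (by simp [h])
    · obtain ⟨β, h1, h2⟩ := mixed j i h
      exact Or.inr (Or.inr ⟨β, Or.inr (by simp [h1, h2])⟩)
  · refine Or.inr (Or.inl ?_)
    rcases le_total i j with h | h
    · obtain ⟨β, h1, h2⟩ := pure i j h
      exact ⟨β, Or.inl (by simp [h1, h2])⟩
    · obtain ⟨β, h1, h2⟩ := pure j i h
      exact ⟨β, Or.inr (by simp [h1, h2])⟩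

/-- This lets the coefficient of a root vector be read off from the entries of a matrix at one
unordered pair of letters. -/
theorem label_unique {n : ℕ} {β γ : PosRoot n}
    (h : (Sum.inr β.src = (Sum.inr γ.src : Fin n ⊕ Fin n) ∧ β.tgt = γ.tgt) ∨
      (Sum.inr β.src = γ.tgt ∧ β.tgt = Sum.inr γ.src)) : β = γ := by
  have b1 := β.row_lt; have b2 := β.row_le_col; have b3 := β.col_le
  have c1 := γ.row_lt; have c2 := γ.row_le_col; have c3 := γ.col_le
  rcases h with ⟨h1, h2⟩ | ⟨h1, h2⟩
  · have h1' := congrArg Fin.val (Sum.inr_injective h1)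
    simp only [PosRoot.src] at h1'
    refine PosRoot.ext h1' ?_
    rcases h : β.tgt with k | k
    · have e1 := PosRoot.tgt_eq_inl.1 h
      have e2 := PosRoot.tgt_eq_inl.1 (h2.symm.trans h)
      omega
    · have e1 := PosRoot.tgt_eq_inr.1 h
      have e2 := PosRoot.tgt_eq_inr.1 (h2.symm.trans h)
      omega
  · have e1 := PosRoot.tgt_eq_inr.1 h1.symm
    have e2 := PosRoot.tgt_eq_inr.1 h2
    simp only [PosRoot.src] at e1 e2
    exact PosRoot.ext (by omega) (by omega)

/-! ### Decomposition modulo the Borel subalgebra. -/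

/-- The span of the Cartan elements and the positive root vectors. -/
def borel (n : ℕ) : Submodule ℂ (Sp n) :=
  Submodule.span ℂ (Set.range (fun i : Fin n => pairElt (Sum.inl i) (Sum.inr i)) ∪
    Set.range posVec)

/-- The coefficient of `negVec β` in `ofMat A`. -/
def negCoeff {n : ℕ} (β : PosRoot n) (A : Matrix (Fin n ⊕ Fin n) (Fin n ⊕ Fin n) ℂ) : ℂ :=
  -- For a long root the two letters coincide and the single entry must be counted once.
  if Sum.inr β.src = β.tgt then A (Sum.inr β.src) β.tgt
  else A (Sum.inr β.src) β.tgt + A β.tgt (Sum.inr β.src)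

theorem negCoeff_single {n : ℕ} (β : PosRoot n) (a b : Fin n ⊕ Fin n) (c : ℂ) :
    negCoeff β (Matrix.single a b c) =
      if (a = Sum.inr β.src ∧ b = β.tgt) ∨ (b = Sum.inr β.src ∧ a = β.tgt) then c else 0 := by
  unfold negCoeff
  simp only [Matrix.single_apply]
  split_ifs <;> grind

theorem ofMat_decomposition {n : ℕ} (A : Matrix (Fin n ⊕ Fin n) (Fin n ⊕ Fin n) ℂ) :
    ofMat A - ∑ β, negCoeff β A • negVec β ∈ borel n := by
  induction A using Matrix.induction_on' with
  | h_zero =>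
    have : ∀ β : PosRoot n, negCoeff β 0 = 0 := fun β => by simp [negCoeff]
    simp only [map_zero, this, zero_smul, Finset.sum_const_zero, sub_zero]
    exact zero_mem _
  | h_add p q hp hq =>
    have : ∀ β : PosRoot n, negCoeff β (p + q) = negCoeff β p + negCoeff β q := fun β => by
      unfold negCoeff
      split_ifs <;> simp only [Matrix.add_apply] <;> ring
    simp only [map_add, this, add_smul, Finset.sum_add_distrib]
    rw [add_sub_add_comm]
    exact add_mem hp hq
  | h_std_basis a b c =>
    have e : ofMat (Matrix.single a b c) = c • pairElt a b := by
      rw [pairElt, ← map_smul, Matrix.smul_single, smul_eq_mul, mul_one]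
    simp only [negCoeff_single]
    rw [e]
    by_cases h : ∃ β : PosRoot n, (a = Sum.inr β.src ∧ b = β.tgt) ∨
      (b = Sum.inr β.src ∧ a = β.tgt)
    · obtain ⟨β, hβ⟩ := h
      rw [Finset.sum_eq_single β, if_pos hβ]
      · have : pairElt a b = negVec β := by
          rcases hβ with ⟨rfl, rfl⟩ | ⟨rfl, rfl⟩
          · rfl
          · exact pairElt_comm _ _
        rw [this, sub_self]
        exact zero_mem _
      · intro γ _ hne
        rw [if_neg, zero_smul]
        intro hγ
        apply hne
        apply label_unique
        rcases hβ with ⟨h1, h2⟩ | ⟨h1, h2⟩ <;> rcases hγ with ⟨h3, h4⟩ | ⟨h3, h4⟩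
        · exact Or.inl ⟨h3.symm.trans h1, h4.symm.trans h2⟩
        · exact Or.inr ⟨h3.symm.trans h2, h4.symm.trans h1⟩
        · exact Or.inr ⟨h3.symm.trans h2, h4.symm.trans h1⟩
        · exact Or.inl ⟨h3.symm.trans h1, h4.symm.trans h2⟩
      · simp
    · push Not at h
      rw [Finset.sum_eq_zero, sub_zero]
      · refine Submodule.smul_mem _ _ (Submodule.subset_span ?_)
        rcases pair_cases a b with h1 | ⟨β, h1⟩ | ⟨β, h1⟩
        · subst h1
          rcases b with b | b
          · exact Or.inl ⟨b, pairElt_comm _ _⟩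
          · exact Or.inl ⟨b, rfl⟩
        · have := h β
          tauto
        · refine Or.inr ⟨β, ?_⟩
          rcases h1 with ⟨rfl, rfl⟩ | ⟨rfl, rfl⟩
          · rfl
          · exact pairElt_comm _ _
      · intro β _
        rw [if_neg, zero_smul]
        have := h β
        tauto

theorem exists_decomposition {n : ℕ} (X : Sp n) :
    ∃ c : PosRoot n → ℂ, X - ∑ β, c β • negVec β ∈ borel n := by
  obtain ⟨A, rfl, -⟩ := exists_ofMat X
  exact ⟨_, ofMat_decomposition A⟩

/-! ### Cartan elements and the uniqueness of root vectors -/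

theorem pairElt_diag_mem {n : ℕ} (i : Fin n) : pairElt (Sum.inl i) (Sum.inr i) ∈ cartan n := by
  change Matrix.IsDiag _
  intro c d hcd
  rw [pairElt, ofMat_apply, Matrix.single_apply, Matrix.single_apply]
  rcases c with c | c <;> rcases d with d | d <;> simp <;> simp at hcd <;> grind

/-- The standard basis of the Cartan subalgebra. -/
def cartanElt {n : ℕ} (i : Fin n) : cartan n := ⟨pairElt (Sum.inl i) (Sum.inr i), pairElt_diag_mem i⟩

theorem eps_cartanElt {n : ℕ} (i j : Fin n) : eps j (cartanElt i) = if j = i then 1 else 0 := by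
  change (pairElt (Sum.inl i) (Sum.inr i) : Matrix (Fin n ⊕ Fin n) (Fin n ⊕ Fin n) ℂ)
    (Sum.inl j) (Sum.inl j) = _
  rw [pairElt, ofMat_apply, Matrix.single_apply, Matrix.single_apply]
  by_cases h : i = j
  · simp [h]
  · simp [h, Ne.symm h]

theorem eps_injective {n : ℕ} : Function.Injective (basisWeight : Fin n ⊕ Fin n → Weight n) := by
  intro a b h
  rcases a with i | i <;> rcases b with j | j
  all_goals
    have h1 := LinearMap.congr_fun h (cartanElt i)
    simp only [basisWeight, Sum.elim_inl, Sum.elim_inr, LinearMap.neg_apply, eps_cartanElt,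
      if_true] at h1
    split_ifs at h1 with h2
  · rw [h2]
  · norm_num at h1
  · norm_num at h1
  · norm_num at h1
  · norm_num at h1
  · norm_num at h1
  · rw [h2]
  · norm_num at h1

/-- On `cartanElt i` the right side is negative, because `b'` cannot cancel the contribution of
`a'`. On the left only the letter `Sum.inr i` has a negative value, so it must occur; the other
letter follows from injectivity of the weights. -/
theorem weight_pair_unique {n : ℕ} {a b a' b' : Fin n ⊕ Fin n} (i : Fin n) (ha' : a' = Sum.inr i)
    (hb' : b' ≠ Sum.inl i)
    (h : basisWeight a + basisWeight b = (basisWeight a' + basisWeight b' : Weight n)) :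
    (a = a' ∧ b = b') ∨ (b = a' ∧ a = b') := by
  have key : a = a' ∨ b = a' := by
    subst ha'
    have h1 := LinearMap.congr_fun h (cartanElt i)
    simp only [LinearMap.add_apply] at h1
    have val : ∀ c : Fin n ⊕ Fin n, basisWeight c (cartanElt i) =
        if c = Sum.inl i then 1 else if c = Sum.inr i then -1 else 0 := by
      intro c
      rcases c with c | c <;> (simp [basisWeight, eps_cartanElt]; try split_ifs <;> simp)
    by_contra hcon
    push Not at hcon
    rw [val, val, val, val, if_neg hb', if_neg hcon.1, if_neg hcon.2] at h1
    simp only [reduceCtorEq, if_false, if_true] at h1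
    split_ifs at h1 <;> norm_num at h1
  rcases key with rfl | rfl
  · exact Or.inl ⟨rfl, eps_injective (add_left_cancel h)⟩
  · rw [add_comm] at h
    exact Or.inr ⟨rfl, eps_injective (add_left_cancel h)⟩

/-- Every nonzero entry of the symmetric matrix of `X` belongs to a pair of letters of weight
`-β.root`, and there is only one such pair. -/
theorem rootSpace_neg_le {n : ℕ} {β : PosRoot n} {X : Sp n} (hX : X ∈ rootSpace (-β.root)) :
    ∃ c : ℂ, X = c • negVec β := by
  rw [rootSpace, LieModule.mem_weightSpace] at hX
  obtain ⟨A, hA, -, hA'⟩ := exists_ofMat X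
  rw [← Submodule.mem_span_singleton.trans (exists_congr fun c => eq_comm), ← hA, ofMat_eq_sum]
  refine Submodule.sum_mem _ fun a _ => Submodule.sum_mem _ fun b _ => ?_
  by_cases h0 : A a b = 0
  · rw [h0, zero_smul]; exact zero_mem _
  refine Submodule.smul_mem _ _ ?_
  have h1 : basisWeight a + basisWeight b = -β.root := by
    ext h
    have e := congrArg (fun Y : Sp n => (Y : Matrix (Fin n ⊕ Fin n) (Fin n ⊕ Fin n) ℂ) a b.swap)
      (hX h)
    have e' : (basisWeight a + basisWeight b) h *
        (X : Matrix (Fin n ⊕ Fin n) (Fin n ⊕ Fin n) ℂ) a b.swap =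
        (-β.root) h * (X : Matrix (Fin n ⊕ Fin n) (Fin n ⊕ Fin n) ℂ) a b.swap := by
      have := cartan_lie_apply h X a b.swap
      rw [Sum.swap_swap] at this
      exact this.symm.trans e
    refine mul_right_cancel₀ ?_ e'
    intro h2
    apply h0
    rw [hA', Matrix.smul_apply, mul_J_apply, h2, mul_zero, smul_zero]
  rw [PosRoot.neg_root] at h1
  rcases weight_pair_unique β.src rfl (tgt_ne_swap β) h1 with ⟨rfl, rfl⟩ | ⟨rfl, rfl⟩
  · exact Submodule.mem_span_singleton_self _
  · rw [pairElt_comm]; exact Submodule.mem_span_singleton_self _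

theorem IsRootVectors.eq_smul {n : ℕ} {f : PosRoot n → nMinus n} (hf : IsRootVectors f) :
    ∃ c : PosRoot n → ℂ, (∀ β, c β ≠ 0) ∧ ∀ β, (f β : Sp n) = c β • negVec β := by
  choose c hc using fun β => rootSpace_neg_le (hf.mem_rootSpace β)
  refine ⟨c, fun β h => hf.ne_zero β (Subtype.ext ?_), hc⟩
  rw [hc, h, zero_smul]; rfl

/-! ### The PBW filtration -/

section Filtration

variable {n : ℕ} {M : Type*} [AddCommGroup M] [Module ℂ M]

/-- The action of a product of standard negative root vectors. -/
def wordAct (ρ : Sp n →ₗ⁅ℂ⁆ Module.End ℂ M) (w : List (PosRoot n)) : Module.End ℂ M :=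
  (w.map fun β => ρ (negVec β)).prod

/-- `v` has weight `χ` and is annihilated by the positive root vectors. -/
structure IsHighest (ρ : Sp n →ₗ⁅ℂ⁆ Module.End ℂ M) (χ : Weight n) (v : M) : Prop where
  cartan_act : ∀ h : cartan n, ρ (h : Sp n) v = χ h • v
  pos_act : ∀ β, ρ (posVec β) v = 0

/-- The span of the products of fewer than `k` negative root vectors, applied to `v`. -/
def filt (ρ : Sp n →ₗ⁅ℂ⁆ Module.End ℂ M) (v : M) (k : ℕ) : Submodule ℂ M :=
  Submodule.span ℂ {x | ∃ w : List (PosRoot n), w.length < k ∧ wordAct ρ w v = x}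

variable {ρ : Sp n →ₗ⁅ℂ⁆ Module.End ℂ M} {χ : Weight n} {v : M}

theorem wordAct_cons (b : PosRoot n) (w : List (PosRoot n)) (x : M) :
    wordAct ρ (b :: w) x = ρ (negVec b) (wordAct ρ w x) := by
  simp [wordAct]

theorem wordAct_append (w w' : List (PosRoot n)) (x : M) :
    wordAct ρ (w ++ w') x = wordAct ρ w (wordAct ρ w' x) := by
  simp [wordAct]

theorem wordAct_mem_filt {w : List (PosRoot n)} {k : ℕ} (h : w.length < k) :
    wordAct ρ w v ∈ filt ρ v k := Submodule.subset_span ⟨w, h, rfl⟩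

theorem filt_mono {k k' : ℕ} (h : k ≤ k') : filt ρ v k ≤ filt ρ v k' :=
  Submodule.span_mono fun _ ⟨w, hw, e⟩ => ⟨w, hw.trans_le h, e⟩

theorem map_mem_of_words {f : Module.End ℂ M} {k : ℕ} {N : Submodule ℂ M}
    (h : ∀ w : List (PosRoot n), w.length < k → f (wordAct ρ w v) ∈ N) {x : M}
    (hx : x ∈ filt ρ v k) : f x ∈ N := by
  have : filt ρ v k ≤ N.comap f := Submodule.span_le.2 fun _ ⟨w, hw, e⟩ => e ▸ h w hw
  exact this hx

theorem negVec_act_mem {b : PosRoot n} {k : ℕ} {x : M} (hx : x ∈ filt ρ v k) :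
    ρ (negVec b) x ∈ filt ρ v (k + 1) :=
  map_mem_of_words (fun w hw => by
    rw [← wordAct_cons]; exact wordAct_mem_filt (by simpa using hw)) hx

theorem IsHighest.borel_act (hv : IsHighest ρ χ v) {y : Sp n} (hy : y ∈ borel n) :
    ρ y v ∈ Submodule.span ℂ {v} := by
  have : borel n ≤ (Submodule.span ℂ {v}).comap ((ρ : Sp n →ₗ[ℂ] Module.End ℂ M).flip v) := by
    refine Submodule.span_le.2 ?_
    rintro _ (⟨i, rfl⟩ | ⟨β, rfl⟩)
    · exact Submodule.mem_span_singleton.2 ⟨χ (cartanElt i), (hv.cartan_act (cartanElt i)).symm⟩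
    · change ρ (posVec β) v ∈ Submodule.span ℂ {v}
      rw [hv.pos_act]; exact zero_mem _
  exact this hy

/-- The two claims need a joint induction: moving a Borel element past a root vector leaves a
commutator that can be any element of the algebra, and it then acts on a word shorter by one letter.
-/
theorem act_mem_aux (hv : IsHighest ρ χ v) (w : List (PosRoot n)) :
    (∀ y ∈ borel n, ρ y (wordAct ρ w v) ∈ filt ρ v (w.length + 1)) ∧
      ∀ X : Sp n, ρ X (wordAct ρ w v) ∈ filt ρ v (w.length + 2) := by
  have second : ∀ w : List (PosRoot n),
      (∀ y ∈ borel n, ρ y (wordAct ρ w v) ∈ filt ρ v (w.length + 1)) →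
      ∀ X : Sp n, ρ X (wordAct ρ w v) ∈ filt ρ v (w.length + 2) := by
    intro w h X
    obtain ⟨c, hc⟩ := exists_decomposition X
    have e : X = (X - ∑ β, c β • negVec β) + ∑ β, c β • negVec β := by abel
    rw [e, map_add, LinearMap.add_apply, map_sum, LinearMap.sum_apply]
    refine add_mem (filt_mono (by omega) (h _ hc)) (Submodule.sum_mem _ fun β _ => ?_)
    rw [map_smul, LinearMap.smul_apply]
    refine Submodule.smul_mem _ _ ?_
    rw [← wordAct_cons]
    exact wordAct_mem_filt (by simp)
  induction w with
  | nil =>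
    have h1 : ∀ y ∈ borel n, ρ y (wordAct ρ [] v) ∈ filt ρ v (([] : List (PosRoot n)).length + 1) := by
      intro y hy
      have h2 := hv.borel_act hy
      have h3 : Submodule.span ℂ {v} ≤ filt ρ v 1 :=
        Submodule.span_le.2 (by
          rintro _ rfl
          exact wordAct_mem_filt (w := []) (by simp))
      exact h3 h2
    exact ⟨h1, second _ h1⟩
  | cons b w ih =>
    have h1 : ∀ y ∈ borel n, ρ y (wordAct ρ (b :: w) v) ∈ filt ρ v ((b :: w).length + 1) := by
      intro y hy
      have e : ρ y (wordAct ρ (b :: w) v) =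
          ρ (negVec b) (ρ y (wordAct ρ w v)) + ρ ⁅y, negVec b⁆ (wordAct ρ w v) := by
        rw [wordAct_cons, LieHom.map_lie, Ring.lie_def]
        simp
      rw [e]
      exact add_mem (negVec_act_mem (ih.1 y hy)) (ih.2 _)
    exact ⟨h1, second _ h1⟩

theorem IsHighest.borel_act_mem (hv : IsHighest ρ χ v) {y : Sp n} (hy : y ∈ borel n) {k : ℕ} {x : M}
    (hx : x ∈ filt ρ v k) : ρ y x ∈ filt ρ v k :=
  map_mem_of_words (fun w hw => filt_mono hw ((act_mem_aux hv w).1 y hy)) hx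

theorem IsHighest.act_mem (hv : IsHighest ρ χ v) (X : Sp n) {k : ℕ} {x : M}
    (hx : x ∈ filt ρ v k) : ρ X x ∈ filt ρ v (k + 1) :=
  map_mem_of_words (fun w hw => filt_mono (by omega) ((act_mem_aux hv w).2 X)) hx

/-- Exchanging two neighbours costs one commutator, so the action on `v` is commutative to leading
order. This is why the order of the factors is irrelevant throughout. -/
theorem IsHighest.perm_sub_mem (hv : IsHighest ρ χ v) {w w' : List (PosRoot n)} (h : w.Perm w') :
    wordAct ρ w v - wordAct ρ w' v ∈ filt ρ v w.length := by
  induction h with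
  | nil => rw [sub_self]; exact zero_mem _
  | cons b h ih =>
    rw [wordAct_cons, wordAct_cons, ← map_sub]
    exact negVec_act_mem ih
  | swap a b w =>
    have e : wordAct ρ (b :: a :: w) v - wordAct ρ (a :: b :: w) v =
        ρ ⁅negVec b, negVec a⁆ (wordAct ρ w v) := by
      simp only [wordAct_cons]
      rw [LieHom.map_lie, Ring.lie_def]
      simp
    rw [e]
    exact (act_mem_aux hv w).2 _
  | trans h₁ h₂ ih₁ ih₂ =>
    rw [← h₁.length_eq] at ih₂
    rw [← sub_add_sub_cancel]
    exact add_mem ih₁ ih₂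

/-- Allows a nilpotent element to be replaced by its negative part: Borel elements preserve the
filtration, so every term containing their difference has lower degree. -/
theorem IsHighest.pow_sub_mem (hv : IsHighest ρ χ v) {X Y : Sp n} (h : X - Y ∈ borel n) (k : ℕ) :
    (ρ X ^ k) v - (ρ Y ^ k) v ∈ filt ρ v k := by
  have hY : ∀ k : ℕ, (ρ Y ^ k) v ∈ filt ρ v (k + 1) := by
    intro k
    induction k with
    | zero => exact wordAct_mem_filt (w := []) (by simp)
    | succ k ih =>
      rw [pow_succ', Module.End.mul_apply]
      exact hv.act_mem Y ih
  induction k with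
  | zero => rw [pow_zero, pow_zero, sub_self]; exact zero_mem _
  | succ k ih =>
    have e : (ρ X ^ (k + 1)) v - (ρ Y ^ (k + 1)) v =
        ρ X ((ρ X ^ k) v - (ρ Y ^ k) v) + ρ (X - Y) ((ρ Y ^ k) v) := by
      rw [pow_succ', pow_succ', Module.End.mul_apply, Module.End.mul_apply, map_sub, map_sub,
        LinearMap.sub_apply]
      abel
    rw [e]
    exact add_mem (hv.act_mem X ih) (hv.borel_act_mem h (hY k))

end Filtration

/-! ### Straightening -/

theorem sum_pow_eq_sum_words {A ι : Type*} [Ring A] [Fintype ι] (a : ι → A) (k : ℕ) :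
    (∑ b, a b) ^ k = ∑ w : Fin k → ι, ((List.ofFn w).map a).prod := by
  induction k with
  | zero => simp
  | succ k ih =>
    rw [pow_succ', ih, Finset.sum_mul_sum, ← Finset.sum_product',
      ← (Fin.consEquiv fun _ : Fin (k + 1) => ι).sum_comp]
    refine Finset.sum_congr rfl fun x _ => ?_
    simp [Fin.consEquiv, List.ofFn_succ]

section Straightening

variable {n : ℕ} {M : Type*} [AddCommGroup M] [Module ℂ M]
  {ρ : Sp n →ₗ⁅ℂ⁆ Module.End ℂ M} {χ : Weight n} {v : M}

/-- The span of the smaller monomials applied to `v`. -/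
def lowerSpan (ρ : Sp n →ₗ⁅ℂ⁆ Module.End ℂ M) (v : M) (s : PosRoot n → ℕ) : Submodule ℂ M :=
  Submodule.span ℂ {x | ∃ w : List (PosRoot n),
    monomialKey (multiplicity w) < monomialKey s ∧ wordAct ρ w v = x}

theorem filt_le_lowerSpan (s : PosRoot n → ℕ) : filt ρ v (∑ β, s β) ≤ lowerSpan ρ v s :=
  Submodule.span_mono fun _ ⟨w, hw, e⟩ =>
    ⟨w, monomialKey_lt_iff.2 (Or.inl (by rwa [sum_multiplicity])), e⟩

/-- If the vector were outside, a functional `φ` would kill the lower span but not the vector.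
Applied to the expansion of the power into words, `φ` gives a polynomial in `z` in which each word
contributes the product of its letters. This polynomial vanishes identically. In its coefficient at
the letters of `s`, words with another exponent are lexicographically smaller, hence killed, and the
rearrangements of `w₀` all have the same nonzero contribution. -/
theorem mem_lowerSpan_of_chain (hv : IsHighest ρ χ v) {s : PosRoot n → ℕ}
    (hs : ∀ β γ, s β ≠ 0 → s γ ≠ 0 → Below β γ ∨ Below γ β) (κ : PosRoot n → ℂ)
    (hκ : ∀ β, s β ≠ 0 → κ β ≠ 0) (a : Fin n ⊕ Fin n)
    (h : ∀ z : Fin n ⊕ Fin n → ℂ, z a ≠ 0 →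
      (ρ (∑ β, (κ β * (z (Sum.inr β.src) * z β.tgt)) • negVec β) ^ (∑ β, s β)) v ∈
        filt ρ v (∑ β, s β))
    {w₀ : List (PosRoot n)} (hw₀ : multiplicity w₀ = s) : wordAct ρ w₀ v ∈ lowerSpan ρ v s := by
  classical
  set k := ∑ β, s β with hk
  have hlen : w₀.length = k := by rw [← sum_multiplicity, hw₀]
  by_contra hcon
  obtain ⟨φ, hφ, hker⟩ := Submodule.exists_le_ker_of_notMem hcon
  have hφ0 : ∀ x ∈ lowerSpan ρ v s, φ x = 0 := fun x hx => hker hx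
  let deg : (Fin k → PosRoot n) → ((Fin n ⊕ Fin n) →₀ ℕ) := fun w => ((List.ofFn w).map letters).sum
  let co : (Fin k → PosRoot n) → ℂ := fun w =>
    ((List.ofFn w).map κ).prod * φ (wordAct ρ (List.ofFn w) v)
  let P : MvPolynomial (Fin n ⊕ Fin n) ℂ := ∑ w, MvPolynomial.monomial (deg w) (co w)
  have evalMon : ∀ (z : Fin n ⊕ Fin n → ℂ) (l : List (PosRoot n)),
      ((l.map letters).sum.prod fun i e => z i ^ e) =
        (l.map fun β => z (Sum.inr β.src) * z β.tgt).prod := by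
    intro z l
    induction l with
    | nil => simp
    | cons b l ih =>
      rw [List.map_cons, List.sum_cons, List.map_cons, List.prod_cons, ← ih,
        Finsupp.prod_add_index' (by simp) (by intros; rw [pow_add])]
      congr 1
      rw [letters, Finsupp.prod_add_index' (by simp) (by intros; rw [pow_add]),
        Finsupp.prod_single_index (by simp), Finsupp.prod_single_index (by simp), pow_one, pow_one]
  have wordScale : ∀ (c : PosRoot n → ℂ) (l : List (PosRoot n)),
      (l.map fun β => c β • ρ (negVec β)).prod = (l.map c).prod • wordAct ρ l := by
    intro c l
    induction l with
    | nil => simp [wordAct]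
    | cons b l ih =>
      rw [List.map_cons, List.prod_cons, ih, List.map_cons, List.prod_cons, smul_mul_smul_comm]
      rfl
  have hP : ∀ z : Fin n ⊕ Fin n → ℂ, z a ≠ 0 → MvPolynomial.eval z P = 0 := by
    intro z hz
    have h1 := hφ0 _ (filt_le_lowerSpan s (h z hz))
    rw [map_sum] at h1
    simp only [map_smul] at h1
    rw [sum_pow_eq_sum_words, LinearMap.sum_apply, map_sum] at h1
    rw [← h1]
    simp only [P, map_sum, MvPolynomial.eval_monomial]
    refine Finset.sum_congr rfl fun w _ => ?_
    rw [evalMon, wordScale, LinearMap.smul_apply, map_smul, smul_eq_mul,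
      List.prod_map_mul (f := κ) (g := fun β => z (Sum.inr β.src) * z β.tgt)]
    simp only [co]; ring
  have hP0 : P = 0 := by
    -- Values are known only where `z a` is nonzero; the factor `X a` covers the rest and cancels
    -- because the polynomial ring is a domain.
    have h1 : MvPolynomial.X a * P = 0 := by
      apply MvPolynomial.funext
      intro z
      rw [map_mul, MvPolynomial.eval_X, map_zero]
      by_cases hz : z a = 0
      · rw [hz, zero_mul]
      · rw [hP z hz, mul_zero]
    exact (mul_eq_zero.1 h1).resolve_left (MvPolynomial.X_ne_zero a)
  have hcoeff := congrArg (MvPolynomial.coeff (letterDegree s)) hP0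
  simp only [P, MvPolynomial.coeff_sum, MvPolynomial.coeff_monomial, MvPolynomial.coeff_zero] at hcoeff
  have hterm : ∀ w : Fin k → PosRoot n, (if deg w = letterDegree s then co w else 0) =
      if multiplicity (List.ofFn w) = s then (w₀.map κ).prod * φ (wordAct ρ w₀ v) else 0 := by
    intro w
    have hd : deg w = letterDegree (multiplicity (List.ofFn w)) := (letterDegree_multiplicity _).symm
    by_cases h1 : multiplicity (List.ofFn w) = s
    · rw [if_pos h1, if_pos (by rw [hd, h1])]
      have hp : (List.ofFn w).Perm w₀ := multiplicity_eq_iff_perm.1 (h1.trans hw₀.symm)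
      have h2 := hφ0 _ (filt_le_lowerSpan s (by
        have := hv.perm_sub_mem hp
        rwa [List.length_ofFn] at this))
      rw [map_sub, sub_eq_zero] at h2
      simp only [co]
      rw [h2, (hp.map κ).prod_eq]
    · rw [if_neg h1]
      split_ifs with h2
      · have h3 := lex_lt_of_letterDegree_eq hs (hd.symm.trans h2) h1
        have h4 : φ (wordAct ρ (List.ofFn w) v) = 0 := hφ0 _ (Submodule.subset_span
          ⟨_, monomialKey_lt_iff.2 (Or.inr ⟨by rw [sum_multiplicity, List.length_ofFn], h3⟩), rfl⟩)
        simp only [co, h4, mul_zero]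
      · rfl
  simp only [hterm] at hcoeff
  rw [← Finset.sum_filter, Finset.sum_const, nsmul_eq_mul, mul_eq_zero, mul_eq_zero] at hcoeff
  rcases hcoeff with h1 | h1 | h1
  · rw [Nat.cast_eq_zero, Finset.card_eq_zero, Finset.filter_eq_empty_iff] at h1
    subst hw₀
    apply h1 (x := fun i => w₀.get (Fin.cast hlen.symm i)) (Finset.mem_univ _)
    congr 1
    apply List.ext_get (by simp [hlen])
    intro i h1 h2
    simp
  · rw [List.prod_eq_zero_iff, List.mem_map] at h1
    obtain ⟨β, hβ, h0⟩ := h1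
    exact hκ β (by
      rw [← hw₀]; exact (List.count_pos_iff.2 hβ).ne') h0
  · exact hφ h1

/-- Nilpotency of the rank one elements on a highest weight vector. -/
structure NilpotencyBound (ρ : Sp n →ₗ⁅ℂ⁆ Module.End ℂ M) (m : Fin n → ℕ) (v : M) : Prop where
  -- The square of a vector. Its negative part involves only labels in rows from `i` on.
  outer : ∀ (i : Fin n) (x y : Fin n → ℂ), (∀ k < i, x k = 0) → (∀ k < i, y k = 0) →
    (ρ (ofMat (Matrix.vecMulVec (Sum.elim y x) (Sum.elim y x))) ^
      (∑ k ∈ Finset.Ici i, m k + 1)) v = 0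
  -- Orthogonality of `x` and `y` makes the matrix square to zero. The support of `y` reaches `j +
  -- 1` because that is the target of a label in column `j`.
  inner : ∀ (i j : Fin n) (x y : Fin n → ℂ), (j : ℕ) + 1 < n →
    (∀ k, k < i ∨ j < k → x k = 0) → (∀ k : Fin n, k < i ∨ (j : ℕ) + 1 < k → y k = 0) →
    ∑ k, x k * y k = 0 →
    (ρ (ofMat (Matrix.vecMulVec (Sum.elim (fun _ => 0) x) (Sum.elim y fun _ => 0))) ^
      (∑ k ∈ Finset.Icc i j, m k + 1)) v = 0

/-! ### Straightening laws for chains that violate a bound. -/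

theorem mem_lowerSpan_outer {m : Fin n → ℕ} (hv : IsHighest ρ χ v) (hm : NilpotencyBound ρ m v)
    {s : PosRoot n → ℕ} (hs : ∀ β γ, s β ≠ 0 → s γ ≠ 0 → Below β γ ∨ Below γ β) (i : Fin n)
    (hi : ∀ β, s β ≠ 0 → (i : ℕ) ≤ β.row) (hlt : ∑ k ∈ Finset.Ici i, m k < ∑ β, s β)
    {w₀ : List (PosRoot n)} (hw₀ : multiplicity w₀ = s) : wordAct ρ w₀ v ∈ lowerSpan ρ v s := by
  refine mem_lowerSpan_of_chain hv hs
    -- In the square of a vector a product of two different letters appears twice, a square only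
    -- once.
    (fun β => if (i : ℕ) ≤ β.row then (if Sum.inr β.src = β.tgt then 1 else 2) else 0) ?_
    (Sum.inr i) ?_ hw₀
  · intro β hβ
    rw [if_pos (hi β hβ)]
    split_ifs <;> norm_num
  · intro z _
    let x : Fin n → ℂ := fun k => if k < i then 0 else z (Sum.inr k)
    let y : Fin n → ℂ := fun k => if k < i then 0 else z (Sum.inl k)
    have hX := hm.outer i x y (fun k hk => if_pos hk) (fun k hk => if_pos hk)
    have hX' := Module.End.pow_map_zero_of_le (Nat.succ_le_of_lt hlt) hX
    have hdec := ofMat_decomposition (Matrix.vecMulVec (Sum.elim y x) (Sum.elim y x))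
    have e : ∀ β : PosRoot n, negCoeff β (Matrix.vecMulVec (Sum.elim y x) (Sum.elim y x)) =
        (if (i : ℕ) ≤ β.row then (if Sum.inr β.src = β.tgt then 1 else 2) else 0) *
          (z (Sum.inr β.src) * z β.tgt) := by
      intro β
      have hu : (Sum.elim y x) (Sum.inr β.src) = if (i : ℕ) ≤ β.row then z (Sum.inr β.src) else 0 := by
        simp only [x, Sum.elim_inr, Fin.lt_def, PosRoot.src]
        split_ifs <;> first | rfl | omega
      have ht : (i : ℕ) ≤ β.row → (Sum.elim y x) β.tgt = z β.tgt := by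
        intro hb
        have h1 := β.row_le_col
        rcases h : β.tgt with k | k
        · have := PosRoot.tgt_eq_inl.1 h
          simp only [y, Sum.elim_inl, Fin.lt_def]
          rw [if_neg (by omega)]
        · have := PosRoot.tgt_eq_inr.1 h
          simp only [x, Sum.elim_inr, Fin.lt_def]
          rw [if_neg (by omega)]
      unfold negCoeff
      simp only [Matrix.vecMulVec_apply]
      by_cases hb : (i : ℕ) ≤ β.row
      · rw [hu, ht hb, if_pos hb, if_pos hb]
        split_ifs <;> ring
      · rw [hu, if_neg hb, if_neg hb]
        simp
    simp only [e] at hdec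
    have := hv.pow_sub_mem hdec (∑ β, s β)
    rw [hX', zero_sub, neg_mem_iff] at this
    exact this

theorem mem_lowerSpan_inner {m : Fin n → ℕ} (hv : IsHighest ρ χ v) (hm : NilpotencyBound ρ m v)
    {s : PosRoot n → ℕ} (hs : ∀ β γ, s β ≠ 0 → s γ ≠ 0 → Below β γ ∨ Below γ β) (i j : Fin n)
    (hij : i ≤ j) (hj : (j : ℕ) + 1 < n)
    (hi : ∀ β, s β ≠ 0 → (i : ℕ) ≤ β.row ∧ β.col ≤ j)
    (hlt : ∑ k ∈ Finset.Icc i j, m k < ∑ β, s β)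
    {w₀ : List (PosRoot n)} (hw₀ : multiplicity w₀ = s) : wordAct ρ w₀ v ∈ lowerSpan ρ v s := by
  refine mem_lowerSpan_of_chain hv hs
    (fun β => if (i : ℕ) ≤ β.row ∧ β.col ≤ j then 1 else 0) ?_ (Sum.inr i) ?_ hw₀
  · intro β hβ
    rw [if_pos (hi β hβ)]
    norm_num
  · intro z hz
    let x : Fin n → ℂ := fun k => if k < i ∨ j < k then 0 else z (Sum.inr k)
    let y₀ : Fin n → ℂ := fun k => if k ≤ i ∨ (j : ℕ) + 1 < k then 0 else z (Sum.inl k)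
    -- No label in rows from `i` on has target `Sum.inl i`, so this coordinate affects only the
    -- Borel part and is free to enforce orthogonality. Dividing by `z (Sum.inr i)` is the reason
    -- for the restriction on `z`.
    let y : Fin n → ℂ := fun k => y₀ k + if k = i then -(∑ k, x k * y₀ k) / z (Sum.inr i) else 0
    have hxi : x i = z (Sum.inr i) := if_neg (by simp [hij])
    have hX := hm.inner i j x y hj (fun k hk => if_pos hk)
      (fun k hk => by
        have hij' := Fin.le_def.1 hij
        have h1 : k ≠ i := by
          rintro rfl
          rcases hk with hk | hk
          · exact lt_irrefl _ hk
          · omega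
        simp only [y, y₀]
        rw [if_neg h1, add_zero, if_pos (hk.imp le_of_lt id)])
      (by
        simp only [y, mul_add, Finset.sum_add_distrib, mul_ite, mul_zero, Finset.sum_ite_eq',
          Finset.mem_univ, if_true]
        rw [hxi]; field_simp; ring)
    have hX' := Module.End.pow_map_zero_of_le (Nat.succ_le_of_lt hlt) hX
    have hdec := ofMat_decomposition
      (Matrix.vecMulVec (Sum.elim (fun _ => 0) x) (Sum.elim y fun _ => 0))
    have e : ∀ β : PosRoot n,
        negCoeff β (Matrix.vecMulVec (Sum.elim (fun _ => 0) x) (Sum.elim y fun _ => 0)) =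
        (if (i : ℕ) ≤ β.row ∧ β.col ≤ j then 1 else 0) * (z (Sum.inr β.src) * z β.tgt) := by
      intro β
      have h1 := β.row_le_col
      unfold negCoeff
      simp only [Matrix.vecMulVec_apply, Sum.elim_inr, mul_zero, add_zero, ite_self]
      rcases h : β.tgt with k | k
      · have hk := PosRoot.tgt_eq_inl.1 h
        simp only [Sum.elim_inl, x, y, y₀, PosRoot.src, Fin.lt_def, Fin.le_def, Fin.ext_iff]
        by_cases hb : (i : ℕ) ≤ β.row ∧ β.col ≤ j
        · rw [if_pos hb, if_neg (by omega), if_neg (by omega), if_neg (by omega)]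
          ring
        · rw [if_neg hb, zero_mul]
          by_cases hb' : β.row < i ∨ (j : ℕ) < β.row
          · rw [if_pos hb', zero_mul]
          · rw [if_neg (c := (k : ℕ) = i) (by omega), if_pos (c := (k : ℕ) ≤ i ∨ _) (by omega)]
            ring
      · have hk := PosRoot.tgt_eq_inr.1 h
        rw [if_neg (by have := k.2; have := β.row_lt; have := β.col_le; omega)]
        simp
    simp only [e] at hdec
    have := hv.pow_sub_mem hdec (∑ β, s β)
    rw [hX', zero_sub, neg_mem_iff] at this
    exact this

/-- The monomials with exponents in `S(λ)`, in any order, span the cyclic module. -/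
theorem wordAct_mem_span {m : Fin n → ℕ} (hv : IsHighest ρ χ v) (hm : NilpotencyBound ρ m v)
    (w : (PosRoot n → ℕ) → List (PosRoot n)) (hw : ∀ s ∈ S m, multiplicity (w s) = s) (u) :
    wordAct ρ u v ∈ Submodule.span ℂ ((fun s => wordAct ρ (w s) v) '' S m) := by
  classical
  set N := Submodule.span ℂ ((fun s => wordAct ρ (w s) v) '' S m) with hN
  induction hk : monomialKey (multiplicity u) using WellFoundedLT.induction generalizing u with
  | ind k ih =>
  subst hk
  have low : lowerSpan ρ v (multiplicity u) ≤ N :=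
    Submodule.span_le.2 fun x ⟨w', hw', e⟩ => e ▸ ih _ hw' w' rfl
  have perm_mem : ∀ u' : List (PosRoot n), u.Perm u' → wordAct ρ u' v ∈ N → wordAct ρ u v ∈ N := by
    intro u' hp h
    have h1 := hv.perm_sub_mem hp
    rw [← sum_multiplicity] at h1
    have := add_mem (low (filt_le_lowerSpan _ h1)) h
    rwa [sub_add_cancel] at this
  by_cases hS : multiplicity u ∈ S m
  · refine perm_mem _ (multiplicity_eq_iff_perm.1 (hw _ hS).symm) ?_
    exact Submodule.subset_span ⟨_, hS, rfl⟩
  rw [mem_S_iff] at hS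
  -- the part of the exponent on a violating chain
  have reduce : ∀ C : Finset (PosRoot n), IsLabelChain C →
      (∀ (s : PosRoot n → ℕ) (w₀ : List (PosRoot n)),
        (∀ β γ, s β ≠ 0 → s γ ≠ 0 → Below β γ ∨ Below γ β) → (∀ β, s β ≠ 0 → β ∈ C) →
        ∑ β, s β = ∑ β ∈ C, multiplicity u β → multiplicity w₀ = s →
        wordAct ρ w₀ v ∈ lowerSpan ρ v s) → wordAct ρ u v ∈ N := by
    intro C hC h
    let s : PosRoot n → ℕ := fun β => if β ∈ C then multiplicity u β else 0
    have hsC : ∀ β, s β ≠ 0 → β ∈ C := by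
      intro β hβ
      by_contra hb
      exact hβ (if_neg hb)
    obtain ⟨u₁, hu₁⟩ := exists_multiplicity_eq (multiplicity u - s)
    obtain ⟨u₂, hu₂⟩ := exists_multiplicity_eq s
    have hadd : multiplicity u = multiplicity u₁ + s := by
      rw [hu₁]
      funext β
      have : s β ≤ multiplicity u β := by
        simp only [s]; split_ifs <;> omega
      exact (Nat.sub_add_cancel this).symm
    -- The part on the chain is placed next to `v`, where straightening applies. The remaining
    -- factors then act on smaller monomials, and additivity of `monomialKey` keeps the products
    -- smaller.
    refine perm_mem (u₁ ++ u₂) (multiplicity_eq_iff_perm.1 ?_) ?_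
    · rw [multiplicity_append, hu₂, hadd]
    · rw [wordAct_append]
      have h1 := h s u₂ (fun β γ hβ hγ => hC β (hsC β hβ) γ (hsC γ hγ)) hsC
        (by simp [s, Finset.sum_ite_mem]) hu₂
      have h2 : lowerSpan ρ v s ≤ N.comap (wordAct ρ u₁) := by
        refine Submodule.span_le.2 fun x ⟨w', hw', e⟩ => ?_
        subst e
        change wordAct ρ u₁ (wordAct ρ w' v) ∈ N
        rw [← wordAct_append]
        refine low (Submodule.subset_span ⟨_, ?_, rfl⟩)
        rw [multiplicity_append, hadd, monomialKey_add, monomialKey_add]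
        exact add_lt_add_right hw' _
      exact h2 h1
  have outer : ∀ (C : Finset (PosRoot n)) (i : Fin n), IsLabelChain C →
      (∀ β ∈ C, (i : ℕ) ≤ β.row) →
      ∑ k ∈ Finset.Ici i, m k < ∑ β ∈ C, multiplicity u β → wordAct ρ u v ∈ N :=
    fun C i hC hi hlt => reduce C hC fun s w₀ hs hsC hsum hw₀ =>
      mem_lowerSpan_outer hv hm hs i (fun β hβ => hi β (hsC β hβ)) (hsum ▸ hlt) hw₀
  by_contra hcon
  refine hS ⟨fun C i j hC hb => ?_, fun C i hC hb => ?_⟩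
  · by_contra hlt
    rw [not_le] at hlt
    by_cases hj : (j : ℕ) + 1 < n
    · refine hcon (reduce C hC fun s w₀ hs hsC hsum hw₀ =>
        mem_lowerSpan_inner hv hm hs i j ?_ hj (fun β hβ => hb β (hsC β hβ)) (hsum ▸ hlt) hw₀)
      rcases C.eq_empty_or_nonempty with rfl | ⟨c, hc⟩
      · simp at hlt
      · have := hb c hc; have := c.row_le_col
        exact Fin.le_def.2 (by omega)
    -- For the last index `j` the two kinds of bound have the same right side, and the outer law
    -- applies.
    · refine hcon (outer C i hC (fun β hβ => (hb β hβ).1) ?_)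
      have : Finset.Ici i = Finset.Icc i j := by
        ext k
        rw [Finset.mem_Ici, Finset.mem_Icc, Fin.le_def, Fin.le_def]
        have := k.2; omega
      rwa [this]
  · by_contra hlt
    rw [not_le] at hlt
    exact hcon (outer C i hC hb hlt)

end Straightening

open scoped Kronecker

/-! ### Matrix models of highest weight modules -/

/-- The action on column vectors given by a matrix representation. -/
def matRep {n : ℕ} {I : Type} [Fintype I] [DecidableEq I] (ρ : Sp n →ₗ⁅ℂ⁆ Matrix I I ℂ) :
    Sp n →ₗ⁅ℂ⁆ Module.End ℂ (I → ℂ) where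
  toFun X := Matrix.toLin' (ρ X)
  map_add' X Y := by rw [map_add, map_add]
  map_smul' c X := by rw [map_smul, map_smul, RingHom.id_apply]
  map_lie' {X Y} := by
    rw [LieHom.map_lie, Ring.lie_def, Ring.lie_def, map_sub, Matrix.toLin'_mul, Matrix.toLin'_mul]
    rfl

theorem matRep_apply {n : ℕ} {I : Type} [Fintype I] [DecidableEq I]
    (ρ : Sp n →ₗ⁅ℂ⁆ Matrix I I ℂ) (X : Sp n) (u : I → ℂ) : matRep ρ X u = (ρ X).mulVec u := rfl

theorem matRep_pow_apply {n : ℕ} {I : Type} [Fintype I] [DecidableEq I]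
    (ρ : Sp n →ₗ⁅ℂ⁆ Matrix I I ℂ) (X : Sp n) (k : ℕ) (u : I → ℂ) :
    (matRep ρ X ^ k) u = (ρ X ^ k).mulVec u := by
  induction k with
  | zero => simp
  | succ k ih =>
    rw [pow_succ', pow_succ', Module.End.mul_apply, ih, matRep_apply, Matrix.mulVec_mulVec]

/-- `s` is detected by a functional on the module generated by `t`, triangularly for the monomial
order. -/
def IsDetected {n : ℕ} {M : Type*} [AddCommGroup M] [Module ℂ M]
    (ρ : Sp n →ₗ⁅ℂ⁆ Module.End ℂ M) (t : M) (s : PosRoot n → ℕ) : Prop :=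
  ∃ φ : M →ₗ[ℂ] ℂ,
    (∀ w, monomialKey (multiplicity w) < monomialKey s → φ (wordAct ρ w t) = 0) ∧
    -- Positive integers rather than nonzero scalars: contributions of different distributions over
    -- tensor factors are added and must not cancel.
    ∀ w, multiplicity w = s → ∃ k : ℕ, 0 < k ∧ φ (wordAct ρ w t) = k

/-- A unitary matrix representation with a highest weight vector for which the nilpotency bounds
hold and all points of `S(λ)` are detected. -/
structure IsModel {n : ℕ} (m : Fin n → ℕ) {I : Type} [Fintype I] [DecidableEq I]
    (ρ : Sp n →ₗ⁅ℂ⁆ Matrix I I ℂ) (t : I → ℂ) : Prop where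
  adjoint : ∀ X, ρ (conjSp X) = (ρ X).conjTranspose
  highest : IsHighest (matRep ρ) (domWeight m) t
  nilpotent : NilpotencyBound (matRep ρ) m t
  detected : ∀ s ∈ S m, IsDetected (matRep ρ) t s

/-- There is a model of highest weight `m`. -/
def HasModel {n : ℕ} (m : Fin n → ℕ) : Prop :=
  ∃ (I : Type) (_ : Fintype I) (_ : DecidableEq I) (ρ : Sp n →ₗ⁅ℂ⁆ Matrix I I ℂ) (t : I → ℂ),
    IsModel m ρ t

theorem domWeight_add {n : ℕ} (m m' : Fin n → ℕ) :
    domWeight (m + m') = domWeight m + domWeight m' := by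
  simp [domWeight, add_smul, Finset.sum_add_distrib]

theorem hasModel_zero (n : ℕ) : HasModel (0 : Fin n → ℕ) := by
  have hpow : ∀ (X : Sp n) (k : ℕ),
      (matRep (0 : Sp n →ₗ⁅ℂ⁆ Matrix Unit Unit ℂ) X ^ (k + 1)) (fun _ => 1) = 0 := by
    intro X k
    rw [matRep_pow_apply, LieHom.zero_apply, zero_pow (by omega), Matrix.zero_mulVec]
  have hzero : ∀ X : Sp n,
      matRep (0 : Sp n →ₗ⁅ℂ⁆ Matrix Unit Unit ℂ) X (fun _ => 1) = 0 := by
    intro X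
    rw [matRep_apply, LieHom.zero_apply, Matrix.zero_mulVec]
  refine ⟨Unit, inferInstance, inferInstance, 0, fun _ => 1, ?_, ⟨?_, ?_⟩, ⟨?_, ?_⟩, ?_⟩
  · intro X; simp
  · intro h
    rw [hzero]
    simp [domWeight]
  · intro β; exact hzero _
  · intro i x y _ _; exact hpow _ _
  · intro i j x y _ _ _ _; exact hpow _ _
  · intro s hs
    have hs0 : s = 0 := by
      funext β
      have h := (mem_S_iff.1 hs).outer {β} ⟨β.row, β.row_lt⟩
        (by intro γ hγ δ hδ
            rw [Finset.mem_singleton] at hγ hδ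
            subst hγ; subst hδ; exact Or.inl ⟨le_rfl, le_rfl⟩)
        (by intro γ hγ; rw [Finset.mem_singleton] at hγ; subst hγ; exact le_rfl)
      simpa using h
    subst hs0
    refine ⟨LinearMap.proj (), fun w hw => ?_, fun w hw => ⟨1, one_pos, ?_⟩⟩
    · rw [monomialKey_lt_iff] at hw
      rcases hw with hw | ⟨hw, hw'⟩
      · simp at hw
      · have : multiplicity w = 0 := by
          funext β
          simp only [Pi.zero_apply, Finset.sum_const_zero, Finset.sum_eq_zero_iff] at hw
          exact hw β (Finset.mem_univ _)
        rw [this] at hw'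
        exact absurd hw' (lt_irrefl _)
    · have : w = [] := by
        have h1 := sum_multiplicity w
        rw [hw] at h1
        exact List.length_eq_zero_iff.1 (by simpa using h1.symm)
      subst this
      simp [wordAct]

/-! ### Tensor products of models -/

section Tensor

/-- The tensor product of two column vectors. -/
def tensorVec {I I' : Type} (u : I → ℂ) (u' : I' → ℂ) : I × I' → ℂ := fun p => u p.1 * u' p.2

theorem kronecker_mulVec_tensorVec {I I' : Type} [Fintype I] [Fintype I'] (A : Matrix I I ℂ) (B : Matrix I' I' ℂ) (u : I → ℂ)
    (u' : I' → ℂ) :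
    (A ⊗ₖ B).mulVec (tensorVec u u') = tensorVec (A.mulVec u) (B.mulVec u') := by
  funext p
  simp only [Matrix.mulVec, dotProduct, tensorVec, Matrix.kroneckerMap_apply,
    Fintype.sum_prod_type, Finset.sum_mul_sum]
  exact Finset.sum_congr rfl fun i _ => Finset.sum_congr rfl fun j _ => by ring

theorem tensorVec_zero_left {I I' : Type} (u' : I' → ℂ) : tensorVec (0 : I → ℂ) u' = 0 := by
  funext p; simp [tensorVec]

theorem tensorVec_zero_right {I I' : Type} (u : I → ℂ) : tensorVec u (0 : I' → ℂ) = 0 := by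
  funext p; simp [tensorVec]

variable {n : ℕ} {I I' : Type} [Fintype I] [DecidableEq I] [Fintype I'] [DecidableEq I']

/-- The tensor product of two matrix representations. -/
def tensorRep (ρ : Sp n →ₗ⁅ℂ⁆ Matrix I I ℂ) (ρ' : Sp n →ₗ⁅ℂ⁆ Matrix I' I' ℂ) :
    Sp n →ₗ⁅ℂ⁆ Matrix (I × I') (I × I') ℂ where
  toFun X := ρ X ⊗ₖ (1 : Matrix I' I' ℂ) + (1 : Matrix I I ℂ) ⊗ₖ ρ' X
  map_add' X Y := by
    rw [map_add, map_add, Matrix.add_kronecker, Matrix.kronecker_add]; abel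
  map_smul' c X := by
    rw [map_smul, map_smul, Matrix.smul_kronecker, Matrix.kronecker_smul, RingHom.id_apply, smul_add]
  map_lie' {X Y} := by
    simp only [LieHom.map_lie, Ring.lie_def, add_mul, mul_add, ← Matrix.mul_kronecker_mul, one_mul,
      mul_one, sub_eq_add_neg, Matrix.add_kronecker, Matrix.kronecker_add]
    have e1 : (-(ρ Y * ρ X)) ⊗ₖ (1 : Matrix I' I' ℂ) = -((ρ Y * ρ X) ⊗ₖ (1 : Matrix I' I' ℂ)) := by
      ext; simp [Matrix.kroneckerMap_apply]
    have e2 : (1 : Matrix I I ℂ) ⊗ₖ (-(ρ' Y * ρ' X)) = -((1 : Matrix I I ℂ) ⊗ₖ (ρ' Y * ρ' X)) := by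
      ext; simp [Matrix.kroneckerMap_apply]
    rw [e1, e2]
    abel

variable {ρ : Sp n →ₗ⁅ℂ⁆ Matrix I I ℂ} {ρ' : Sp n →ₗ⁅ℂ⁆ Matrix I' I' ℂ} {t : I → ℂ} {t' : I' → ℂ}

theorem tensorRep_apply (X : Sp n) :
    tensorRep ρ ρ' X = ρ X ⊗ₖ (1 : Matrix I' I' ℂ) + (1 : Matrix I I ℂ) ⊗ₖ ρ' X := rfl

theorem tensorRep_mulVec (X : Sp n) (u : I → ℂ) (u' : I' → ℂ) :
    (tensorRep ρ ρ' X).mulVec (tensorVec u u') =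
      tensorVec ((ρ X).mulVec u) u' + tensorVec u ((ρ' X).mulVec u') := by
  rw [tensorRep_apply, Matrix.add_mulVec, kronecker_mulVec_tensorVec, kronecker_mulVec_tensorVec,
    Matrix.one_mulVec, Matrix.one_mulVec]

/-- The element acts as a sum of two commuting operators, and in each binomial term one exponent
exceeds its bound. Nilpotency bounds thus add up under tensor products. -/
theorem tensor_pow_eq_zero {X : Sp n} {p q : ℕ} (h : (matRep ρ X ^ (p + 1)) t = 0)
    (h' : (matRep ρ' X ^ (q + 1)) t' = 0) :
    (matRep (tensorRep ρ ρ') X ^ (p + q + 1)) (tensorVec t t') = 0 := by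
  rw [matRep_pow_apply] at h h' ⊢
  have hc : Commute (ρ X ⊗ₖ (1 : Matrix I' I' ℂ)) ((1 : Matrix I I ℂ) ⊗ₖ ρ' X) := by
    rw [Commute, SemiconjBy, ← Matrix.mul_kronecker_mul, ← Matrix.mul_kronecker_mul]
    simp
  have hp : ∀ i j : ℕ, (ρ X ⊗ₖ (1 : Matrix I' I' ℂ)) ^ i * ((1 : Matrix I I ℂ) ⊗ₖ ρ' X) ^ j =
      (ρ X ^ i) ⊗ₖ (ρ' X ^ j) := by
    have h1 : ∀ i : ℕ, (ρ X ⊗ₖ (1 : Matrix I' I' ℂ)) ^ i = (ρ X ^ i) ⊗ₖ (1 : Matrix I' I' ℂ) := by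
      intro i
      induction i with
      | zero => simp
      | succ i ih => rw [pow_succ, ih, ← Matrix.mul_kronecker_mul, pow_succ, one_mul]
    have h2 : ∀ j : ℕ, ((1 : Matrix I I ℂ) ⊗ₖ ρ' X) ^ j = (1 : Matrix I I ℂ) ⊗ₖ (ρ' X ^ j) := by
      intro j
      induction j with
      | zero => simp
      | succ j ih => rw [pow_succ, ih, ← Matrix.mul_kronecker_mul, pow_succ, one_mul]
    intro i j
    rw [h1, h2, ← Matrix.mul_kronecker_mul, one_mul, mul_one]
  have key : ∀ i j : ℕ, i + j = p + q + 1 →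
      ((ρ X ^ i) ⊗ₖ (ρ' X ^ j)).mulVec (tensorVec t t') = 0 := by
    intro i j hij
    rw [kronecker_mulVec_tensorVec]
    by_cases hi : p + 1 ≤ i
    · obtain ⟨d, rfl⟩ := Nat.exists_eq_add_of_le hi
      rw [add_comm, pow_add, ← Matrix.mulVec_mulVec, h, Matrix.mulVec_zero, tensorVec_zero_left]
    · obtain ⟨d, rfl⟩ := Nat.exists_eq_add_of_le (show q + 1 ≤ j by omega)
      rw [add_comm (q + 1), pow_add (ρ' X), ← Matrix.mulVec_mulVec, h', Matrix.mulVec_zero,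
        tensorVec_zero_right]
  rw [tensorRep_apply, hc.add_pow', Matrix.sum_mulVec]
  refine Finset.sum_eq_zero fun ij hij => ?_
  rw [hp, Matrix.smul_mulVec, key _ _ (Finset.HasAntidiagonal.mem_antidiagonal.1 hij), smul_zero]

/-- A word acts on `t ⊗ t'` by distributing its letters over the factors. The monomial key is
additive, so with total exponent `s + s'` a distribution other than `s` and `s'` has a part below
its target and contributes zero. Those that remain contribute positive integers. -/
theorem IsDetected.tensor {s s' : PosRoot n → ℕ} (h : IsDetected (matRep ρ) t s)
    (h' : IsDetected (matRep ρ') t' s') :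
    IsDetected (matRep (tensorRep ρ ρ')) (tensorVec t t') (s + s') := by
  obtain ⟨φ, hφ, hφ1⟩ := h
  obtain ⟨φ', hφ', hφ1'⟩ := h'
  let Φ : (I × I' → ℂ) →ₗ[ℂ] ℂ :=
    { toFun := fun u => φ fun i => φ' fun j => u (i, j)
      map_add' := fun u u' => by
        rw [← map_add]; congr 1; funext i
        rw [Pi.add_apply, ← map_add]; rfl
      map_smul' := fun c u => by
        rw [RingHom.id_apply, ← map_smul]; congr 1; funext i
        rw [Pi.smul_apply, ← map_smul]; rfl }
  have hΦ : ∀ u u', Φ (tensorVec u u') = φ u * φ' u' := by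
    intro u u'
    have e : (fun i => φ' fun j => tensorVec u u' (i, j)) = φ' u' • u := by
      funext i
      have : (fun j => tensorVec u u' (i, j)) = u i • u' := rfl
      rw [this, map_smul, Pi.smul_apply, smul_eq_mul, smul_eq_mul, mul_comm]
    change φ _ = _
    rw [e, map_smul, smul_eq_mul, mul_comm]
  -- the two tensor factors are reached by words `a` and `a'`
  let E : List (PosRoot n) → List (PosRoot n) → List (PosRoot n) → ℂ := fun a a' w =>
    Φ (((((a.map fun β => ρ (negVec β)).prod) ⊗ₖ ((a'.map fun β => ρ' (negVec β)).prod)) *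
      (w.map fun β => tensorRep ρ ρ' (negVec β)).prod).mulVec (tensorVec t t'))
  have E_cons : ∀ a a' b w, E a a' (b :: w) = E (a ++ [b]) a' w + E a (a' ++ [b]) w := by
    intro a a' b w
    simp only [E]
    rw [← map_add, ← Matrix.add_mulVec, ← add_mul, List.map_cons, List.prod_cons, ← mul_assoc,
      tensorRep_apply, mul_add, ← Matrix.mul_kronecker_mul, ← Matrix.mul_kronecker_mul]
    simp
  have prod_act : ∀ {K : Type} [Fintype K] [DecidableEq K] (σ : Sp n →ₗ⁅ℂ⁆ Matrix K K ℂ)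
      (w : List (PosRoot n)) (u : K → ℂ),
      ((w.map fun β => σ (negVec β)).prod).mulVec u = wordAct (matRep σ) w u := by
    intro K _ _ σ w u
    induction w with
    | nil => simp [wordAct]
    | cons b w ih =>
      rw [wordAct_cons, ← ih, matRep_apply, Matrix.mulVec_mulVec, List.map_cons, List.prod_cons]
  have E_nil : ∀ a a', E a a' [] =
      φ (wordAct (matRep ρ) a t) * φ' (wordAct (matRep ρ') a' t') := by
    intro a a'
    simp only [E, List.map_nil, List.prod_nil, mul_one]
    rw [kronecker_mulVec_tensorVec, hΦ, prod_act, prod_act]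
  have E_start : ∀ w, Φ (wordAct (matRep (tensorRep ρ ρ')) w (tensorVec t t')) = E [] [] w := by
    intro w
    simp only [E, List.map_nil, List.prod_nil, Matrix.one_kronecker_one, one_mul]
    rw [prod_act]
  have mult_snoc : ∀ (a : List (PosRoot n)) (b : PosRoot n) (w : List (PosRoot n)),
      multiplicity (a ++ [b]) + multiplicity w = multiplicity a + multiplicity (b :: w) := by
    intro a b w
    rw [← multiplicity_append, ← multiplicity_append]
    simp
  have mult_mid : ∀ (a a' : List (PosRoot n)) (b : PosRoot n) (w : List (PosRoot n)),
      multiplicity (a ++ [b]) + multiplicity a' + multiplicity w =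
        multiplicity a + multiplicity a' + multiplicity (b :: w) ∧
      multiplicity a + multiplicity (a' ++ [b]) + multiplicity w =
        multiplicity a + multiplicity a' + multiplicity (b :: w) := by
    intro a a' b w
    constructor
    · rw [add_right_comm, mult_snoc, add_right_comm]
    · rw [add_assoc, mult_snoc, add_assoc]
  have small : ∀ w a a', monomialKey (multiplicity a + multiplicity a' + multiplicity w) <
      monomialKey (s + s') → E a a' w = 0 := by
    intro w
    induction w with
    | nil =>
      intro a a' hlt
      rw [E_nil]
      have h0 : multiplicity ([] : List (PosRoot n)) = 0 := funext fun β => by simp [multiplicity]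
      rw [h0, add_zero, monomialKey_add, monomialKey_add] at hlt
      rcases lt_or_lt_of_add_lt_add hlt with h1 | h1
      · rw [hφ a h1, zero_mul]
      · rw [hφ' a' h1, mul_zero]
    | cons b w ih =>
      intro a a' hlt
      rw [E_cons, ih _ _ (by rw [(mult_mid a a' b w).1]; exact hlt),
        ih _ _ (by rw [(mult_mid a a' b w).2]; exact hlt), add_zero]
  have exact_val : ∀ w a a', multiplicity a + multiplicity a' + multiplicity w = s + s' →
      ∃ k : ℕ, E a a' w = k ∧ (multiplicity a ≤ s → multiplicity a' ≤ s' → 0 < k) := by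
    intro w
    induction w with
    | nil =>
      intro a a' he
      have h0 : multiplicity ([] : List (PosRoot n)) = 0 := funext fun β => by simp [multiplicity]
      rw [h0, add_zero] at he
      by_cases ha : multiplicity a = s
      · have ha' : multiplicity a' = s' := by rw [ha] at he; exact add_left_cancel he
        obtain ⟨k, hk, ek⟩ := hφ1 a ha
        obtain ⟨k', hk', ek'⟩ := hφ1' a' ha'
        exact ⟨k * k', by rw [E_nil, ek, ek']; push_cast; rfl, fun _ _ => Nat.mul_pos hk hk'⟩
      · refine ⟨0, ?_, fun h1 h2 => ?_⟩
        · have hk := congrArg monomialKey he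
          rw [monomialKey_add, monomialKey_add] at hk
          rcases lt_or_gt_of_ne (fun e => ha (monomialKey_injective e)) with h1 | h1
          · rw [E_nil, hφ a h1, zero_mul]; simp
          · have h2 : monomialKey (multiplicity a') < monomialKey s' := by
              by_contra h2
              exact absurd hk (add_lt_add_of_lt_of_le h1 (not_lt.1 h2)).ne'
            rw [E_nil, hφ' a' h2, mul_zero]; simp
        · exfalso
          apply ha
          funext β
          have e1 := congrFun he β
          have e2 : multiplicity a β ≤ s β := h1 β
          have e3 : multiplicity a' β ≤ s' β := h2 β
          simp only [Pi.add_apply] at e1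
          omega
    | cons b w ih =>
      intro a a' he
      obtain ⟨k, hk, hk1⟩ := ih (a ++ [b]) a' (by rw [(mult_mid a a' b w).1]; exact he)
      obtain ⟨k', hk', hk1'⟩ := ih a (a' ++ [b]) (by rw [(mult_mid a a' b w).2]; exact he)
      refine ⟨k + k', by rw [E_cons, hk, hk']; push_cast; rfl, fun h1 h2 => ?_⟩
      have snoc_le : ∀ (c : List (PosRoot n)) (r : PosRoot n → ℕ), multiplicity c ≤ r →
          multiplicity c b < r b → multiplicity (c ++ [b]) ≤ r := by
        intro c r hc hb β
        have hcβ : multiplicity c β ≤ r β := hc β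
        simp only [multiplicity, List.count_append, List.count_singleton] at *
        by_cases hβ : b = β
        · subst hβ; simp; omega
        · simp [hβ]; omega
      have e1 := congrFun he b
      simp only [Pi.add_apply] at e1
      have e2 : 0 < multiplicity (b :: w) b := by simp [multiplicity]
      have e3 : multiplicity a b ≤ s b := h1 b
      have e4 : multiplicity a' b ≤ s' b := h2 b
      -- One good distribution is followed: the next letter goes to a factor that still has room for
      -- it.
      by_cases hb : multiplicity a b < s b
      · have := hk1 (snoc_le a s h1 hb) h2; omega
      · have := hk1' h1 (snoc_le a' s' h2 (by omega)); omega
  refine ⟨Φ, fun w hw => ?_, fun w hw => ?_⟩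
  · rw [E_start]
    refine small w [] [] ?_
    have h0 : multiplicity ([] : List (PosRoot n)) = 0 := funext fun β => by simp [multiplicity]
    rwa [h0, zero_add, zero_add]
  · rw [E_start]
    have h0 : multiplicity ([] : List (PosRoot n)) = 0 := funext fun β => by simp [multiplicity]
    obtain ⟨k, hk, hk1⟩ := exact_val w [] [] (by rw [h0, zero_add, zero_add, hw])
    refine ⟨k, hk1 ?_ ?_, hk⟩ <;> rw [h0] <;> exact fun β => Nat.zero_le _

end Tensor

theorem HasModel.add {n : ℕ} {m m' : Fin n → ℕ} (hm : HasModel m) (hm' : HasModel m')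
    (hS : ∀ s ∈ S (m + m'), ∃ s₁ ∈ S m, ∃ s₂ ∈ S m', s = s₁ + s₂) : HasModel (m + m') := by
  obtain ⟨I, _, _, ρ, t, h⟩ := hm
  obtain ⟨I', _, _, ρ', t', h'⟩ := hm'
  refine ⟨I × I', inferInstance, inferInstance, tensorRep ρ ρ', tensorVec t t', ?_, ⟨?_, ?_⟩,
    ⟨?_, ?_⟩, ?_⟩
  · intro X
    rw [tensorRep_apply, tensorRep_apply, Matrix.conjTranspose_add, Matrix.conjTranspose_kronecker,
      Matrix.conjTranspose_kronecker, h.adjoint, h'.adjoint, Matrix.conjTranspose_one,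
      Matrix.conjTranspose_one]
  · intro x
    have e1 := h.highest.cartan_act x
    have e2 := h'.highest.cartan_act x
    rw [matRep_apply] at e1 e2 ⊢
    rw [tensorRep_mulVec, e1, e2, domWeight_add]
    funext p
    simp only [tensorVec, Pi.add_apply, Pi.smul_apply, smul_eq_mul, LinearMap.add_apply]
    ring
  · intro β
    have e1 := h.highest.pos_act β
    have e2 := h'.highest.pos_act β
    rw [matRep_apply] at e1 e2 ⊢
    rw [tensorRep_mulVec, e1, e2, tensorVec_zero_left, tensorVec_zero_right, add_zero]
  · intro i x y hx hy
    simp only [Pi.add_apply, Finset.sum_add_distrib]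
    exact tensor_pow_eq_zero (h.nilpotent.outer i x y hx hy) (h'.nilpotent.outer i x y hx hy)
  · intro i j x y hj hx hy hxy
    simp only [Pi.add_apply, Finset.sum_add_distrib]
    exact tensor_pow_eq_zero (h.nilpotent.inner i j x y hj hx hy hxy)
      (h'.nilpotent.inner i j x y hj hx hy hxy)
  · intro s hs
    obtain ⟨s₁, h₁, s₂, h₂, rfl⟩ := hS s hs
    exact (h.detected s₁ h₁).tensor (h'.detected s₂ h₂)

theorem hasModel_of_fundamental {n : ℕ} (hf : ∀ l : Fin n, HasModel (Pi.single l 1 : Fin n → ℕ))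
    (m : Fin n → ℕ) : HasModel m := by
  induction hk : ∑ k, m k generalizing m with
  | zero =>
    have : m = 0 := by
      funext k
      exact Finset.sum_eq_zero_iff.1 hk k (Finset.mem_univ _)
    subst this
    exact hasModel_zero n
  | succ d ih =>
    obtain ⟨k, -, hk0⟩ := Finset.exists_ne_zero_of_sum_ne_zero (by rw [hk]; omega : ∑ k, m k ≠ 0)
    -- The smallest index is split off, as the decomposition of points of `S` requires.
    obtain ⟨l, hl0, hl⟩ := (Finset.univ.filter fun k => m k ≠ 0).exists_min_image id
      ⟨k, by simp [hk0]⟩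
    simp only [Finset.mem_filter, Finset.mem_univ, true_and, id] at hl0 hl
    have e : m = (m - Pi.single l 1) + Pi.single l 1 := by
      funext k
      by_cases hkl : k = l
      · subst hkl; simp; omega
      · simp [hkl]
    have hlow : ∀ k < l, (m - Pi.single l 1 : Fin n → ℕ) k = 0 := by
      intro k hkl
      have : m k = 0 := by
        by_contra h0
        exact absurd (hl k h0) (not_le.2 hkl)
      simp [this]
    have hsum : ∑ k, (m - Pi.single l 1 : Fin n → ℕ) k = d := by
      rw [e] at hk
      simp only [Pi.add_apply, Finset.sum_add_distrib] at hk
      simp only [Finset.sum_pi_single', Finset.mem_univ, if_true] at hk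
      omega
    rw [e]
    exact (ih _ hsum).add (hf l) fun s hs => exists_add_of_mem_S hlow hs

/-! ### Tensor powers of the natural module -/

section Sites

variable {B ι : Type}

/-- Pure tensors, as a multilinear map. -/
def pureTensor [Fintype ι] : MultilinearMap ℂ (fun _ : ι => B → ℂ) ((ι → B) → ℂ) :=
  MultilinearMap.pi fun b =>
    (MultilinearMap.mkPiAlgebra ℂ ι ℂ).compLinearMap fun j => LinearMap.proj (b j)

theorem pureTensor_apply [Fintype ι] (u : ι → B → ℂ) (b : ι → B) :
    pureTensor u b = ∏ j, u j (b j) := by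
  simp [pureTensor]

/-- Antisymmetrized tensors. -/
def wedge [Fintype ι] [DecidableEq ι] : (B → ℂ) [⋀^ι]→ₗ[ℂ] ((ι → B) → ℂ) := MultilinearMap.alternatization pureTensor

theorem wedge_eq [Fintype ι] [DecidableEq ι] (u : ι → B → ℂ) :
    wedge u = ∑ σ : Equiv.Perm ι, Equiv.Perm.sign σ • pureTensor (fun j => u (σ j)) := by
  rw [wedge, MultilinearMap.alternatization_apply]
  rfl

variable [Fintype B] [DecidableEq ι]

/-- The action of a matrix on one tensor factor. -/
def siteAct (i : ι) (X : Matrix B B ℂ) : Module.End ℂ ((ι → B) → ℂ) where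
  toFun F b := ∑ a, X (b i) a * F (Function.update b i a)
  map_add' F G := by
    funext b; simp only [Pi.add_apply, mul_add, Finset.sum_add_distrib]
  map_smul' c F := by
    funext b; simp only [Pi.smul_apply, smul_eq_mul, RingHom.id_apply, Finset.mul_sum]
    exact Finset.sum_congr rfl fun a _ => by ring

theorem siteAct_apply (i : ι) (X : Matrix B B ℂ) (F : (ι → B) → ℂ) (b : ι → B) :
    siteAct i X F b = ∑ a, X (b i) a * F (Function.update b i a) := rfl

theorem siteAct_mul (i : ι) (X Y : Matrix B B ℂ) :
    siteAct i X * siteAct i Y = siteAct i (X * Y) := by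
  refine LinearMap.ext fun F => funext fun b => ?_
  rw [Module.End.mul_apply]
  simp only [siteAct_apply, Function.update_self, Function.update_idem, Finset.mul_sum,
    Matrix.mul_apply, Finset.sum_mul]
  rw [Finset.sum_comm]
  exact Finset.sum_congr rfl fun a _ => Finset.sum_congr rfl fun c _ => by ring

theorem siteAct_commute {i j : ι} (h : i ≠ j) (X Y : Matrix B B ℂ) :
    siteAct i X * siteAct j Y = siteAct j Y * siteAct i X := by
  refine LinearMap.ext fun F => funext fun b => ?_
  rw [Module.End.mul_apply, Module.End.mul_apply]
  simp only [siteAct_apply, Function.update_of_ne h, Function.update_of_ne h.symm, Finset.mul_sum]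
  rw [Finset.sum_comm]
  refine Finset.sum_congr rfl fun a _ => Finset.sum_congr rfl fun c _ => ?_
  rw [Function.update_comm h]
  ring

theorem siteAct_add (i : ι) (X Y : Matrix B B ℂ) :
    siteAct i (X + Y) = siteAct i X + siteAct i Y := by
  refine LinearMap.ext fun F => funext fun b => ?_
  simp only [siteAct_apply, LinearMap.add_apply, Pi.add_apply, Matrix.add_apply, add_mul,
    Finset.sum_add_distrib]

theorem siteAct_sub (i : ι) (X Y : Matrix B B ℂ) :
    siteAct i (X - Y) = siteAct i X - siteAct i Y := by
  refine LinearMap.ext fun F => funext fun b => ?_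
  simp only [siteAct_apply, LinearMap.sub_apply, Pi.sub_apply, Matrix.sub_apply, sub_mul,
    Finset.sum_sub_distrib]

theorem siteAct_smul (i : ι) (c : ℂ) (X : Matrix B B ℂ) :
    siteAct i (c • X) = c • siteAct i X := by
  refine LinearMap.ext fun F => funext fun b => ?_
  simp only [siteAct_apply, LinearMap.smul_apply, Pi.smul_apply, Matrix.smul_apply, smul_eq_mul,
    Finset.mul_sum, mul_assoc]

theorem siteAct_lie [Fintype ι] (X Y : Matrix B B ℂ) :
    (∑ i : ι, siteAct i (X * Y - Y * X)) =
      (∑ i : ι, siteAct i X) * (∑ i : ι, siteAct i Y) -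
        (∑ i : ι, siteAct i Y) * (∑ i : ι, siteAct i X) := by
  rw [Finset.sum_mul_sum, Finset.sum_mul_sum, Finset.sum_comm (f := fun i j => siteAct i Y * _),
    ← Finset.sum_sub_distrib]
  refine Finset.sum_congr rfl fun i _ => ?_
  rw [← Finset.sum_sub_distrib, Finset.sum_eq_single i]
  · rw [siteAct_sub, siteAct_mul, siteAct_mul]
  · intro j _ hj
    rw [siteAct_commute hj.symm, sub_self]
  · simp

theorem siteAct_toMatrix [DecidableEq B] [Fintype ι] (i : ι) (X : Matrix B B ℂ) (b c : ι → B) :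
    LinearMap.toMatrix' (siteAct i X) b c = if ∀ j, j ≠ i → b j = c j then X (b i) (c i) else 0 := by
  rw [LinearMap.toMatrix'_apply]
  have e : (fun j' => if j' = c then (1 : ℂ) else 0) = Pi.single c 1 := by
    funext j; simp [Pi.single_apply]
  rw [siteAct_apply]
  split_ifs with h
  · rw [Finset.sum_eq_single (c i)]
    · have : Function.update b i (c i) = c := by
        funext j
        by_cases hj : j = i
        · subst hj; simp
        · rw [Function.update_of_ne hj, h j hj]
      rw [this]; simp
    · intro a _ ha
      have : Function.update b i a ≠ c := by
        rintro rfl; simp at ha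
      simp [this]
    · simp
  · refine Finset.sum_eq_zero fun a _ => ?_
    have : Function.update b i a ≠ c := by
      rintro rfl
      exact h fun j hj => by rw [Function.update_of_ne hj]
    simp [this]

theorem siteAct_pureTensor [Fintype ι] (i : ι) (X : Matrix B B ℂ) (u : ι → B → ℂ) :
    siteAct i X (pureTensor u) = pureTensor (Function.update u i (X.mulVec (u i))) := by
  funext b
  rw [siteAct_apply]
  simp only [pureTensor_apply]
  rw [← Finset.mul_prod_erase _ _ (Finset.mem_univ i), Function.update_self, Matrix.mulVec,
    dotProduct, Finset.sum_mul]
  refine Finset.sum_congr rfl fun a _ => ?_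
  rw [← Finset.mul_prod_erase _ _ (Finset.mem_univ i), Function.update_self, ← mul_assoc]
  congr 1
  refine Finset.prod_congr rfl fun j hj => ?_
  rw [Function.update_of_ne (Finset.ne_of_mem_erase hj),
    Function.update_of_ne (Finset.ne_of_mem_erase hj)]

theorem sum_siteAct_wedge [Fintype ι] (X : Matrix B B ℂ) (u : ι → B → ℂ) :
    (∑ i, siteAct i X) (wedge u) = ∑ i, wedge (Function.update u i (X.mulVec (u i))) := by
  simp only [wedge_eq]
  rw [map_sum]
  conv_rhs => rw [Finset.sum_comm]
  refine Finset.sum_congr rfl fun σ _ => ?_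
  rw [LinearMap.sum_apply]
  refine Fintype.sum_equiv σ _ _ fun i => ?_
  rw [Units.smul_def, map_zsmul, siteAct_pureTensor, Units.smul_def]
  congr 2
  funext j
  by_cases h : j = i
  · subst h; simp
  · rw [Function.update_of_ne h, Function.update_of_ne (fun e => h (σ.injective e))]

/-- A matrix of rank one, and square zero, on the factors of a wedge squares to zero there. -/
theorem sum_siteAct_sq_wedge [Fintype ι] {X : Matrix B B ℂ} {u : ι → B → ℂ} {g : ι → ℂ} {z : B → ℂ}
    (hu : ∀ j, X.mulVec (u j) = g j • z) (hz : X.mulVec z = 0) :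
    (∑ i, siteAct i X) ((∑ i, siteAct i X) (wedge u)) = 0 := by
  rw [sum_siteAct_wedge, map_sum]
  refine Finset.sum_eq_zero fun i _ => ?_
  rw [sum_siteAct_wedge]
  refine Finset.sum_eq_zero fun j _ => ?_
  by_cases hij : j = i
  · subst hij
    rw [Function.update_self, hu, Matrix.mulVec_smul, hz, smul_zero]
    exact wedge.map_coord_zero j (Function.update_self _ _ _)
  · rw [Function.update_of_ne hij, hu, hu, AlternatingMap.map_update_smul,
      Function.update_comm (Ne.symm hij),
      AlternatingMap.map_update_smul]
    rw [wedge.map_eq_zero_of_eq _ (i := i) (j := j) _ (Ne.symm hij), smul_zero, smul_zero]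
    rw [Function.update_self, Function.update_of_ne hij, Function.update_self]

end Sites

/-- The tensor power of the natural representation. -/
def powerRep (n : ℕ) (ι : Type) [Fintype ι] [DecidableEq ι] :
    Sp n →ₗ⁅ℂ⁆ Matrix (ι → Fin n ⊕ Fin n) (ι → Fin n ⊕ Fin n) ℂ where
  toFun X := LinearMap.toMatrix' (∑ i, siteAct i (X : Matrix (Fin n ⊕ Fin n) (Fin n ⊕ Fin n) ℂ))
  map_add' X Y := by
    rw [← map_add, ← Finset.sum_add_distrib]
    have e : ((X + Y : Sp n) : Matrix (Fin n ⊕ Fin n) (Fin n ⊕ Fin n) ℂ) = X + Y := rfl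
    simp only [e, siteAct_add]
  map_smul' c X := by
    rw [RingHom.id_apply, ← map_smul, Finset.smul_sum]
    have e : ((c • X : Sp n) : Matrix (Fin n ⊕ Fin n) (Fin n ⊕ Fin n) ℂ) =
        c • (X : Matrix (Fin n ⊕ Fin n) (Fin n ⊕ Fin n) ℂ) := rfl
    simp only [e, siteAct_smul]
  map_lie' {X Y} := by
    rw [LieSubalgebra.coe_bracket, Ring.lie_def, Ring.lie_def, siteAct_lie, map_sub,
      LinearMap.toMatrix'_mul, LinearMap.toMatrix'_mul]

theorem powerRep_conj (n : ℕ) (ι : Type) [Fintype ι] [DecidableEq ι] (X : Sp n) :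
    powerRep n ι (conjSp X) = (powerRep n ι X).conjTranspose := by
  ext b c
  change LinearMap.toMatrix' _ b c = star (LinearMap.toMatrix' _ c b)
  simp only [map_sum, Matrix.sum_apply, siteAct_toMatrix, star_sum]
  refine Finset.sum_congr rfl fun i _ => ?_
  have e : (∀ j, j ≠ i → b j = c j) ↔ ∀ j, j ≠ i → c j = b j :=
    forall_congr' fun j => imp_congr Iff.rfl eq_comm
  by_cases h : ∀ j, j ≠ i → b j = c j
  · rw [if_pos h, if_pos (e.1 h)]; rfl
  · rw [if_neg h, if_neg (fun h' => h (e.2 h')), star_zero]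

theorem matRep_powerRep {n : ℕ} {ι : Type} [Fintype ι] [DecidableEq ι] (X : Sp n) :
    matRep (powerRep n ι) X =
      ∑ i, siteAct i (X : Matrix (Fin n ⊕ Fin n) (Fin n ⊕ Fin n) ℂ) :=
  Matrix.toLin'_toMatrix' _

/-! ### The highest weight vector of a fundamental module -/

section Fundamental

variable {n : ℕ} (l : Fin n)

/-- The index of the natural module attached to a tensor factor. -/
def siteIndex (p : Fin (l + 1)) : Fin n := ⟨p, by have := p.2; have := l.2; omega⟩

theorem siteIndex_injective : Function.Injective (siteIndex l) := fun p q h =>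
  Fin.ext (by have := Fin.ext_iff.1 h; exact this)

/-- The first basis vectors of the natural module. -/
def siteVec (p : Fin (l + 1)) : Fin n ⊕ Fin n → ℂ := Pi.single (Sum.inl (siteIndex l p)) 1

/-- The wedge of the first basis vectors of the natural module. -/
def fundVec : (Fin (l + 1) → Fin n ⊕ Fin n) → ℂ := wedge (siteVec l)

/-- The weights of the factors add up to the fundamental weight. A positive root vector either kills
a factor or turns it into a basis vector of smaller index, which already occurs in the wedge. -/
theorem fundVec_isHighest :
    IsHighest (matRep (powerRep n (Fin (l + 1)))) (domWeight (Pi.single l 1)) (fundVec l) := by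
  constructor
  · intro h
    rw [matRep_powerRep, fundVec, sum_siteAct_wedge]
    have hd : ((h : Sp n) : Matrix (Fin n ⊕ Fin n) (Fin n ⊕ Fin n) ℂ).IsDiag := h.2
    have e : ∀ p, ((h : Sp n) : Matrix (Fin n ⊕ Fin n) (Fin n ⊕ Fin n) ℂ).mulVec (siteVec l p) =
        (eps (siteIndex l p) h) • siteVec l p := by
      intro p
      funext c
      rw [siteVec, Matrix.mulVec_single_one, Matrix.col_apply, Pi.smul_apply, smul_eq_mul]
      by_cases hc : c = Sum.inl (siteIndex l p)
      · subst hc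
        rw [Pi.single_eq_same, mul_one]; rfl
      · rw [Pi.single_eq_of_ne hc, mul_zero, hd hc]
    simp only [e, AlternatingMap.map_update_smul, Function.update_eq_self]
    rw [← Finset.sum_smul]
    congr 1
    have e2 : domWeight (Pi.single l 1 : Fin n → ℕ) = fundWeight l := by
      simp [domWeight, Pi.single_apply]
    rw [e2, fundWeight, LinearMap.sum_apply]
    refine Finset.sum_bij (fun p _ => siteIndex l p) ?_ ?_ ?_ ?_
    · intro p _
      rw [Finset.mem_Iic, Fin.le_def]
      have := p.2
      simp only [siteIndex]; omega
    · intro p _ q _ h; exact siteIndex_injective l h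
    · intro k hk
      rw [Finset.mem_Iic, Fin.le_def] at hk
      exact ⟨⟨k, by omega⟩, Finset.mem_univ _, rfl⟩
    · intro p _; rfl
  · intro β
    rw [matRep_powerRep, fundVec, sum_siteAct_wedge]
    refine Finset.sum_eq_zero fun p _ => ?_
    have e : ((posVec β : Sp n) : Matrix (Fin n ⊕ Fin n) (Fin n ⊕ Fin n) ℂ).mulVec (siteVec l p) =
        (if β.tgt = Sum.inl (siteIndex l p) then (1 : ℂ) else 0) •
          (Pi.single (Sum.inl β.src) 1 : Fin n ⊕ Fin n → ℂ) := by
      funext c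
      rw [siteVec, Matrix.mulVec_single_one, Matrix.col_apply, posVec, pairElt, ofMat_apply,
        Matrix.single_apply, Matrix.single_apply]
      have h1 : β.tgt.swap = Sum.inr (siteIndex l p) ↔ β.tgt = Sum.inl (siteIndex l p) := by
        rcases β.tgt with k | k <;> simp
      simp only [Sum.elim_inl, Sum.swap_inl, reduceCtorEq, false_and, if_false, add_zero, one_mul, h1,
        Pi.smul_apply, smul_eq_mul, Pi.single_apply]
      by_cases h2 : β.tgt = Sum.inl (siteIndex l p) <;> by_cases h3 : c = Sum.inl β.src <;>
        simp [h2, h3, @eq_comm _ _ c]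
    rw [e, AlternatingMap.map_update_smul]
    split_ifs with h
    · have h1 := PosRoot.tgt_eq_inl.1 h
      have h2 := β.row_le_col
      have h3 := p.2
      simp only [siteIndex] at h1
      have hne : p ≠ ⟨β.row, by omega⟩ := by
        intro he
        have := congrArg Fin.val he
        simp only at this; omega
      rw [wedge.map_eq_zero_of_eq _ (i := p) (j := ⟨β.row, by omega⟩) _ hne, smul_zero]
      rw [Function.update_self, Function.update_of_ne hne.symm]
      rfl
    · rw [zero_smul]

/-- Both kinds of elements send every factor to a multiple of one vector `z` and kill `z`, so their
square vanishes on the wedge. When the bound does not count `l`, the first power must vanish. Then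
either `x` is zero on all factors, or the element preserves the span of the factors and acts on
their wedge by its trace `x · y = 0`. -/
theorem fundVec_nilpotent :
    NilpotencyBound (matRep (powerRep n (Fin (l + 1)))) (Pi.single l 1) (fundVec l) := by
  have single_sum : ∀ T : Finset (Fin n), ∑ k ∈ T, (Pi.single l 1 : Fin n → ℕ) k =
      if l ∈ T then 1 else 0 := by
    intro T; simp [Pi.single_apply]
  constructor
  · intro i x y hx hy
    set z := Sum.elim y x with hz
    have hcol : ∀ p, ((ofMat (Matrix.vecMulVec z z) : Sp n) :
        Matrix (Fin n ⊕ Fin n) (Fin n ⊕ Fin n) ℂ).mulVec (siteVec l p) =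
          (2 * x (siteIndex l p)) • z := by
      intro p
      funext c
      rw [siteVec, Matrix.mulVec_single_one, Matrix.col_apply, ofMat_apply]
      simp only [Matrix.vecMulVec_apply, hz, Sum.swap_inl, Sum.elim_inl, Sum.elim_inr,
        Pi.smul_apply, smul_eq_mul]
      ring
    have hker : ((ofMat (Matrix.vecMulVec z z) : Sp n) :
        Matrix (Fin n ⊕ Fin n) (Fin n ⊕ Fin n) ℂ).mulVec z = 0 := by
      funext c
      rw [Matrix.mulVec, dotProduct, Fintype.sum_sum_type, ← Finset.sum_add_distrib]
      refine Finset.sum_eq_zero fun k _ => ?_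
      simp only [ofMat_apply, Matrix.vecMulVec_apply, hz, Sum.swap_inl, Sum.swap_inr, Sum.elim_inl,
        Sum.elim_inr]
      ring
    rw [single_sum, matRep_powerRep, fundVec]
    split_ifs with h
    · rw [pow_succ', pow_one, Module.End.mul_apply]
      exact sum_siteAct_sq_wedge hcol hker
    · rw [zero_add, pow_one, sum_siteAct_wedge]
      refine Finset.sum_eq_zero fun p _ => ?_
      rw [hcol, hx, mul_zero, zero_smul]
      · exact wedge.map_coord_zero p (Function.update_self _ _ _)
      · rw [Finset.mem_Ici, Fin.le_def] at h
        rw [Fin.lt_def]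
        have := p.2
        simp only [siteIndex]; omega
  · intro i j x y hj hx hy hxy
    set z : Fin n ⊕ Fin n → ℂ := Sum.elim y fun _ => 0 with hz
    set A := Matrix.vecMulVec (Sum.elim (fun _ => 0) x) z with hA
    have hcol : ∀ p, ((ofMat A : Sp n) :
        Matrix (Fin n ⊕ Fin n) (Fin n ⊕ Fin n) ℂ).mulVec (siteVec l p) =
          (x (siteIndex l p)) • z := by
      intro p
      funext c
      rw [siteVec, Matrix.mulVec_single_one, Matrix.col_apply, ofMat_apply]
      simp only [hA, Matrix.vecMulVec_apply, hz, Sum.swap_inl, Sum.elim_inl, Sum.elim_inr,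
        Pi.smul_apply, smul_eq_mul]
      ring
    have hker : ((ofMat A : Sp n) :
        Matrix (Fin n ⊕ Fin n) (Fin n ⊕ Fin n) ℂ).mulVec z = 0 := by
      funext c
      rw [Matrix.mulVec, dotProduct, Fintype.sum_sum_type]
      simp only [hA, ofMat_apply, Matrix.vecMulVec_apply, hz, Sum.swap_inl, Sum.swap_inr,
        Sum.elim_inl, Sum.elim_inr, mul_zero, Finset.sum_const_zero, add_zero, zero_add, one_mul,
        Pi.zero_apply]
      have e : ∀ k, x k * Sum.elim y (fun _ => 0) c * y k =
          x k * y k * Sum.elim y (fun _ => 0) c := fun k => by ring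
      simp only [e]
      rw [← Finset.sum_mul, hxy, zero_mul]
    rw [single_sum, matRep_powerRep, fundVec]
    split_ifs with h
    · rw [pow_succ', pow_one, Module.End.mul_apply]
      exact sum_siteAct_sq_wedge hcol hker
    · rw [zero_add, pow_one, sum_siteAct_wedge]
      simp only [hcol, AlternatingMap.map_update_smul]
      by_cases hil : i ≤ l
      · have hjl : (j : ℕ) + 1 ≤ l := by
          rw [Finset.mem_Icc] at h
          have : ¬ l ≤ j := fun h' => h ⟨hil, h'⟩
          rw [Fin.le_def] at this; omega
        have hzsum : z = ∑ q : Fin (l + 1), y (siteIndex l q) • siteVec l q := by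
          funext c
          rw [Finset.sum_apply]
          simp only [Pi.smul_apply, smul_eq_mul, siteVec]
          rcases c with c | c
          · by_cases hc : (c : ℕ) < l + 1
            · rw [Finset.sum_eq_single ⟨c, hc⟩]
              · rw [show siteIndex l ⟨c, hc⟩ = c from rfl]; simp [hz]
              · intro q _ hq
                rw [Pi.single_eq_of_ne, mul_zero]
                intro he
                apply hq
                have := congrArg Fin.val (Sum.inl_injective he)
                exact Fin.ext this.symm
              · simp
            · have h0 : y c = 0 := hy c (Or.inr (by omega))
              rw [Finset.sum_eq_zero]
              · simp [hz, h0]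
              · intro q _
                rw [Pi.single_eq_of_ne, mul_zero]
                intro he
                have := congrArg Fin.val (Sum.inl_injective he)
                have := q.2
                simp only [siteIndex] at *
                omega
          · simp [hz]
        have hrepl : ∀ p, wedge (Function.update (siteVec l) p z) =
            y (siteIndex l p) • wedge (siteVec l) := by
          intro p
          rw [hzsum, AlternatingMap.map_update_sum, Finset.sum_eq_single p]
          · rw [AlternatingMap.map_update_smul, Function.update_eq_self]
          · intro q _ hq
            rw [AlternatingMap.map_update_smul,
              wedge.map_eq_zero_of_eq _ (i := p) (j := q) _ hq.symm, smul_zero]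
            rw [Function.update_self, Function.update_of_ne hq]
          · simp
        simp only [hrepl, smul_smul]
        rw [← Finset.sum_smul]
        have : ∑ p : Fin (l + 1), x (siteIndex l p) * y (siteIndex l p) = ∑ k, x k * y k := by
          rw [← Finset.sum_image (g := siteIndex l) (f := fun k => x k * y k)
            (fun a _ b _ h => siteIndex_injective l h)]
          refine Finset.sum_subset (Finset.subset_univ _) fun k _ hk => ?_
          have : ¬ (k : ℕ) < l + 1 := fun h' =>
            hk (Finset.mem_image.2 ⟨⟨k, h'⟩, Finset.mem_univ _, rfl⟩)
          rw [hy k (Or.inr (by omega)), mul_zero]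
        rw [this, hxy, zero_smul]
      · refine Finset.sum_eq_zero fun p _ => ?_
        rw [hx, zero_smul]
        left
        rw [Fin.lt_def]
        rw [Fin.le_def] at hil
        have := p.2
        simp only [siteIndex]; omega

end Fundamental

/-! ### Detection of the points of `S(ω_l)` -/

theorem negVec_apply {n : ℕ} (γ : PosRoot n) (c : Fin n ⊕ Fin n) (d : Fin n) :
    ((negVec γ : Sp n) : Matrix (Fin n ⊕ Fin n) (Fin n ⊕ Fin n) ℂ) c (Sum.inl d) =
      (if Sum.inr γ.src = c ∧ γ.tgt = Sum.inr d then 1 else 0) +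
        if (Sum.inr γ.src : Fin n ⊕ Fin n) = Sum.inr d ∧ γ.tgt = c then 1 else 0 := by
  rw [negVec, pairElt, ofMat_apply, Matrix.single_apply, Matrix.single_apply, Sum.elim_inl, one_mul,
    Sum.swap_inl]

theorem eq_of_negVec_apply_ne_zero {n : ℕ} {γ β : PosRoot n}
    (h : ((negVec γ : Sp n) : Matrix (Fin n ⊕ Fin n) (Fin n ⊕ Fin n) ℂ) β.tgt
      (Sum.inl β.src) ≠ 0) : γ = β := by
  rw [negVec_apply] at h
  apply label_unique
  by_contra hcon
  push Not at hcon
  rw [if_neg (fun h' => hcon.2 h'.1 h'.2), if_neg (fun h' => hcon.1 h'.1 h'.2)] at h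
  simp at h

section Detection

variable {n : ℕ} (l : Fin n)

/-- The basis vector of the natural module attached to a tensor factor. -/
def siteLetter (p : Fin (l + 1)) : Fin n ⊕ Fin n := Sum.inl (siteIndex l p)

theorem siteLetter_injective : Function.Injective (siteLetter l) := fun _ _ h =>
  siteIndex_injective l (Sum.inl_injective h)

theorem fundVec_apply (b : Fin (l + 1) → Fin n ⊕ Fin n) :
    fundVec l b = ∑ σ : Equiv.Perm (Fin (l + 1)),
      Equiv.Perm.sign σ • ∏ p, (if b p = siteLetter l (σ p) then (1 : ℂ) else 0) := by
  rw [fundVec, wedge_eq, Finset.sum_apply]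
  refine Finset.sum_congr rfl fun σ _ => ?_
  rw [Pi.smul_apply, pureTensor_apply]
  refine congrArg _ (Finset.prod_congr rfl fun p _ => ?_)
  rw [siteVec, Pi.single_apply, siteLetter]

theorem exists_perm_of_fundVec_ne_zero {b : Fin (l + 1) → Fin n ⊕ Fin n} (h : fundVec l b ≠ 0) :
    ∃ τ : Equiv.Perm (Fin (l + 1)), ∀ p, b p = siteLetter l (τ p) := by
  rw [fundVec_apply] at h
  obtain ⟨σ, -, hσ⟩ := Finset.exists_ne_zero_of_sum_ne_zero h
  refine ⟨σ, fun p => ?_⟩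
  by_contra hp
  apply hσ
  rw [Finset.prod_eq_zero (Finset.mem_univ p) (if_neg hp), smul_zero]

theorem fundVec_siteLetter : fundVec l (siteLetter l) = 1 := by
  rw [fundVec_apply, Finset.sum_eq_single 1]
  · simp
  · intro σ _ hσ
    obtain ⟨p, hp⟩ : ∃ p, σ p ≠ p := by
      by_contra hcon
      push Not at hcon
      exact hσ (Equiv.ext hcon)
    rw [Finset.prod_eq_zero (Finset.mem_univ p)
      (if_neg fun h => hp (siteLetter_injective l h).symm), smul_zero]
  · simp

theorem negVec_act_apply (γ : PosRoot n) (G : (Fin (l + 1) → Fin n ⊕ Fin n) → ℂ)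
    (b : Fin (l + 1) → Fin n ⊕ Fin n) :
    matRep (powerRep n (Fin (l + 1))) (negVec γ) G b =
      ∑ p, ∑ a, ((negVec γ : Sp n) : Matrix (Fin n ⊕ Fin n) (Fin n ⊕ Fin n) ℂ) (b p) a *
        G (Function.update b p a) := by
  rw [matRep_powerRep, LinearMap.sum_apply, Finset.sum_apply]
  rfl

/-- The tensor factors at which `b` is not one of the first basis vectors. -/
def outside (b : Fin (l + 1) → Fin n ⊕ Fin n) : Finset (Fin (l + 1)) :=
  Finset.univ.filter fun p => ∀ q, b p ≠ siteLetter l q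

/-- Each outside factor of `b` is reached from a basis vector by a single root vector, the other
factors are untouched, and the root vectors used make up `w`. -/
structure Reaches (w : List (PosRoot n)) (b : Fin (l + 1) → Fin n ⊕ Fin n)
    (τ : Equiv.Perm (Fin (l + 1))) (lab : Fin (l + 1) → PosRoot n) : Prop where
  inside : ∀ p, p ∉ outside l b → b p = siteLetter l (τ p)
  moved : ∀ p, p ∈ outside l b → ((negVec (lab p) : Sp n) :
    Matrix (Fin n ⊕ Fin n) (Fin n ⊕ Fin n) ℂ) (b p) (siteLetter l (τ p)) ≠ 0
  labels : (w : Multiset (PosRoot n)) = (outside l b).val.map lab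

variable {l}

/-- A root vector changes one tensor factor, so it creates at most one new outside factor. In the
extremal case the changed factor was one of the first basis vectors just before. -/
theorem reaches_step {w : List (PosRoot n)} {b : Fin (l + 1) → Fin n ⊕ Fin n} {γ : PosRoot n}
    {i : Fin (l + 1)} {a : Fin n ⊕ Fin n}
    (h : ((negVec γ : Sp n) : Matrix (Fin n ⊕ Fin n) (Fin n ⊕ Fin n) ℂ) (b i) a ≠ 0)
    (h1 : (outside l (Function.update b i a)).card ≤ w.length)
    (h2 : (outside l (Function.update b i a)).card = w.length →
      ∃ τ lab, Reaches l w (Function.update b i a) τ lab) :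
    (outside l b).card ≤ w.length + 1 ∧ ((outside l b).card = w.length + 1 →
      i ∈ outside l b ∧ ∃ τ lab, Reaches l (γ :: w) b τ lab ∧ lab i = γ ∧
        a = siteLetter l (τ i)) := by
  have hsub : outside l b ⊆ insert i (outside l (Function.update b i a)) := by
    intro p hp
    rw [Finset.mem_insert]
    by_cases hpi : p = i
    · exact Or.inl hpi
    · right
      simpa [outside, Function.update_of_ne hpi] using hp
  have hle := Finset.card_le_card hsub
  have hins := Finset.card_insert_le i (outside l (Function.update b i a))
  refine ⟨by omega, fun hc => ?_⟩
  have heq : outside l b = insert i (outside l (Function.update b i a)) :=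
    Finset.eq_of_subset_of_card_le hsub (by omega)
  have hi : i ∉ outside l (Function.update b i a) := by
    intro hi
    rw [Finset.insert_eq_of_mem hi] at heq
    rw [heq] at hc
    omega
  obtain ⟨τ, lab, hR⟩ := h2 (by rw [heq, Finset.card_insert_of_notMem hi] at hc; omega)
  have ha : a = siteLetter l (τ i) := by
    have := hR.inside i hi
    rwa [Function.update_self] at this
  refine ⟨heq ▸ Finset.mem_insert_self _ _, τ, Function.update lab i γ, ⟨?_, ?_, ?_⟩,
    Function.update_self _ _ _, ha⟩
  · intro p hp
    rw [heq, Finset.mem_insert, not_or] at hp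
    have := hR.inside p hp.2
    rwa [Function.update_of_ne hp.1] at this
  · intro p hp
    by_cases hpi : p = i
    · subst hpi
      rw [Function.update_self, ← ha]
      exact h
    · rw [heq, Finset.mem_insert] at hp
      have := hR.moved p (hp.resolve_left hpi)
      rw [Function.update_of_ne hpi] at this
      rwa [Function.update_of_ne hpi]
  · rw [heq, Finset.insert_val_of_notMem hi, Multiset.map_cons, Function.update_self,
      ← Multiset.cons_coe, hR.labels]
    congr 1
    refine Multiset.map_congr rfl fun p hp => ?_
    rw [Function.update_of_ne]
    rintro rfl
    exact hi hp

/-- A nonzero coordinate is witnessed by successive changes of single factors, starting from a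
permutation of the first basis vectors. A word as short as the number of outside factors spends
exactly one letter on each. -/
theorem reaches_of_ne_zero (w : List (PosRoot n)) (b : Fin (l + 1) → Fin n ⊕ Fin n)
    (h : wordAct (matRep (powerRep n (Fin (l + 1)))) w (fundVec l) b ≠ 0) :
    (outside l b).card ≤ w.length ∧
      ((outside l b).card = w.length → ∃ τ lab, Reaches l w b τ lab) := by
  induction w generalizing b with
  | nil =>
    obtain ⟨τ, hτ⟩ := exists_perm_of_fundVec_ne_zero l (b := b) (by simpa [wordAct] using h)
    have h0 : outside l b = ∅ := by
      rw [outside, Finset.filter_eq_empty_iff]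
      intro p _ hp
      exact hp _ (hτ p)
    refine ⟨by simp [h0], fun _ => ⟨τ, fun _ => PosRoot.simple l, fun p _ => hτ p, ?_, ?_⟩⟩
    · intro p hp; simp [h0] at hp
    · simp [h0]
  | cons γ w ih =>
    rw [wordAct_cons, negVec_act_apply] at h
    obtain ⟨i, -, hi⟩ := Finset.exists_ne_zero_of_sum_ne_zero h
    obtain ⟨a, -, ha⟩ := Finset.exists_ne_zero_of_sum_ne_zero hi
    have ih' := ih _ (right_ne_zero_of_mul ha)
    have := reaches_step (left_ne_zero_of_mul ha) ih'.1 ih'.2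
    refine ⟨this.1, fun hc => ?_⟩
    obtain ⟨-, τ, lab, hR, -⟩ := this.2 hc
    exact ⟨τ, lab, hR⟩

variable (l) in
/-- Labels `β p`, one for each row `p ∈ A`, with decreasing columns beyond `l`. -/
structure IsAntichainOf (A : Finset (Fin (l + 1))) (β : Fin (l + 1) → PosRoot n) : Prop where
  row : ∀ p ∈ A, (β p).row = p
  col : ∀ p ∈ A, (l : ℕ) ≤ (β p).col
  anti : ∀ p ∈ A, ∀ q ∈ A, p < q → (β q).col < (β p).col

variable (l) in
/-- The basis vector reached by the root vectors of an antichain. -/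
def antichainPoint (A : Finset (Fin (l + 1))) (β : Fin (l + 1) → PosRoot n)
    (p : Fin (l + 1)) : Fin n ⊕ Fin n := if p ∈ A then (β p).tgt else siteLetter l p

variable {A : Finset (Fin (l + 1))} {β : Fin (l + 1) → PosRoot n}

theorem IsAntichainOf.outside_eq (h : IsAntichainOf l A β) :
    outside l (antichainPoint l A β) = A := by
  ext p
  rw [outside, Finset.mem_filter]
  simp only [Finset.mem_univ, true_and]
  unfold antichainPoint
  constructor
  · intro hp
    by_contra hpA
    rw [if_neg hpA] at hp
    exact hp p rfl
  · intro hp q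
    rw [if_pos hp]
    intro he
    have h1 := PosRoot.tgt_eq_inl.1 he
    have h2 := h.col p hp
    have h3 := q.2
    simp only [siteIndex] at h1
    omega

theorem IsAntichainOf.src_eq (h : IsAntichainOf l A β) {p : Fin (l + 1)} (hp : p ∈ A) :
    (β p).src = siteIndex l p := Fin.ext (h.row p hp)

theorem IsAntichainOf.nodup (h : IsAntichainOf l A β) : (A.val.map β).Nodup := by
  refine Multiset.Nodup.map_on (fun p hp q hq e => ?_) A.nodup
  have h1 := h.row p hp
  rw [e, h.row q hq] at h1
  exact Fin.ext h1.symm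

/-- The word of an antichain is the lexicographically smallest one reaching its point. -/
theorem IsAntichainOf.lex_lt (h : IsAntichainOf l A β) {w : List (PosRoot n)}
    {τ : Equiv.Perm (Fin (l + 1))} {lab : Fin (l + 1) → PosRoot n}
    (hR : Reaches l w (antichainPoint l A β) τ lab) :
    (τ = 1 ∧ ∀ p ∈ A, lab p = β p) ∨
      toLex (fun γ => (A.val.map β).count γ) < toLex (multiplicity w) := by
  have hout := h.outside_eq
  have hmult : multiplicity w = fun γ => (A.val.map lab).count γ := by
    funext γ
    rw [multiplicity, ← Multiset.coe_count, hR.labels, hout]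
  have fix : ∀ p, p ∉ A → τ p = p := by
    intro p hp
    have h1 := hR.inside p (by rwa [hout])
    rw [antichainPoint, if_neg hp] at h1
    exact (siteLetter_injective l h1).symm
  have moved : ∀ p ∈ A, ((negVec (lab p) : Sp n) : Matrix (Fin n ⊕ Fin n) (Fin n ⊕ Fin n) ℂ)
      (β p).tgt (siteLetter l (τ p)) ≠ 0 := by
    intro p hp
    have h1 := hR.moved p (by rwa [hout])
    rwa [antichainPoint, if_pos hp] at h1
  have lab_of_fix : ∀ p ∈ A, τ p = p → lab p = β p := by
    intro p hp hτ
    apply eq_of_negVec_apply_ne_zero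
    have h1 := moved p hp
    rw [hτ, siteLetter, ← h.src_eq hp] at h1
    exact h1
  by_cases hτ : τ = 1
  · exact Or.inl ⟨hτ, fun p hp => lab_of_fix p hp (by rw [hτ]; rfl)⟩
  right
  obtain ⟨p₀, hp₀⟩ : ∃ p, τ p ≠ p := by
    by_contra hcon
    push Not at hcon
    exact hτ (Equiv.ext hcon)
  -- At the first site `i` moved by `τ`, the vector of row `i` is used at a later site `j`.
  obtain ⟨i, hi, hmin⟩ := (Finset.univ.filter fun p => τ p ≠ p).exists_min_image id
    ⟨p₀, by simp [hp₀]⟩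
  simp only [Finset.mem_filter, Finset.mem_univ, true_and, id] at hi hmin
  have hiA : i ∈ A := by
    by_contra hc
    exact hi (fix i hc)
  set j := τ.symm i with hj
  have hτj : τ j = i := τ.apply_symm_apply i
  have hji : j ≠ i := fun e => hi (by rw [e] at hτj; exact hτj)
  have hjmoved : τ j ≠ j := by rw [hτj]; exact hji.symm
  have hij : i < j := lt_of_le_of_ne (hmin j hjmoved) hji.symm
  have hjA : j ∈ A := by
    by_contra hc
    exact hjmoved (fix j hc)
  have hcol := h.anti i hiA j hjA hij
  have c1 := (β i).col_le
  have c2 := h.row i hiA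
  have c3 := h.col j hjA
  have c4 := i.2
  have c5 := l.2
  -- The label that carries row `i` to the target of `β j`. As columns decrease along the antichain,
  -- it precedes `β i`; it occurs in `w` but not in the antichain.
  let γ₀ : PosRoot n := ⟨i, (β j).col, by omega, by omega, by omega⟩
  have htgt : γ₀.tgt = (β j).tgt := by
    rcases hc : (β j).tgt with k | k
    · exact PosRoot.tgt_eq_inl.2 (PosRoot.tgt_eq_inl.1 hc)
    · have h1 := PosRoot.tgt_eq_inr.1 hc
      have h2 := h.row j hjA
      exact PosRoot.tgt_eq_inr.2 ⟨h1.1, by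
        have := Fin.lt_def.1 hij
        change (i : ℕ) ≤ k
        omega⟩
  have hlab : lab j = γ₀ := by
    apply eq_of_negVec_apply_ne_zero
    have h1 := moved j hjA
    rw [hτj] at h1
    rw [htgt]
    exact h1
  have hγ₀ : (A.val.map lab).count γ₀ ≠ 0 := by
    rw [Multiset.count_ne_zero, Multiset.mem_map]
    exact ⟨j, hjA, hlab⟩
  have hγ₀' : (A.val.map β).count γ₀ = 0 := by
    rw [Multiset.count_eq_zero, Multiset.mem_map]
    rintro ⟨p, hp, e⟩
    have h1 := h.row p hp
    rw [e] at h1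
    have h2 : p = i := Fin.ext h1.symm
    rw [h2] at e
    have h3 := congrArg PosRoot.col e
    change (β i).col = (β j).col at h3
    omega
  -- Antichain labels before `γ₀` come from sites fixed by `τ`, where `lab` and `β` agree.
  have before : ∀ γ < γ₀, (A.val.map β).count γ ≤ (A.val.map lab).count γ := by
    intro γ hγ
    by_cases hmem : γ ∈ A.val.map β
    · have h1 := Multiset.nodup_iff_count_le_one.1 h.nodup γ
      refine h1.trans (Multiset.one_le_count_iff_mem.2 ?_)
      obtain ⟨p, hp, e⟩ := Multiset.mem_map.1 hmem
      refine Multiset.mem_map.2 ⟨p, hp, ?_⟩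
      rw [lab_of_fix p hp, e]
      by_contra hpf
      have hip : i ≤ p := hmin p hpf
      have h2 := h.row p hp
      rw [e] at h2
      have h3 := PosRoot.lt_iff.1 hγ
      have h4 := Fin.le_def.1 hip
      have h5 : γ.row ≤ i := by
        rcases h3 with h3 | h3
        · exact h3.le
        · exact h3.1.le
      have h6 : p = i := Fin.ext (by omega)
      rw [h6] at e
      have h7 : γ.col < (β j).col := by
        rcases h3 with h3 | h3
        · have : γ.row < i := h3
          omega
        · exact h3.2
      rw [← e] at h7
      omega
    · rw [Multiset.count_eq_zero_of_notMem hmem]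
      exact Nat.zero_le _
  rw [hmult]
  rcases lt_trichotomy (toLex (fun γ => (A.val.map β).count γ))
    (toLex (fun γ => (A.val.map lab).count γ)) with h1 | h1 | ⟨c, hc, hlt⟩
  · exact h1
  · have h2 : (A.val.map β).count γ₀ = (A.val.map lab).count γ₀ :=
      congrFun (toLex.injective h1) γ₀
    omega
  · exfalso
    have hlt' : (A.val.map lab).count c < (A.val.map β).count c := hlt
    rcases lt_trichotomy c γ₀ with h2 | h2 | h2
    · have := before c h2; omega
    · rw [h2] at hlt'; omega
    · have h3 : (A.val.map lab).count γ₀ = (A.val.map β).count γ₀ := hc γ₀ h2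
      omega

/-- Induction on the word, undoing its first root vector. Any other term would come from a
nontrivial permutation and have a lexicographically larger exponent, so a single term survives and
no sign appears. -/
theorem IsAntichainOf.exists_value (w : List (PosRoot n)) (A : Finset (Fin (l + 1)))
    (h : IsAntichainOf l A β) (hw : (w : Multiset (PosRoot n)) = A.val.map β) :
    ∃ k : ℕ, 0 < k ∧ wordAct (matRep (powerRep n (Fin (l + 1)))) w (fundVec l)
      (antichainPoint l A β) = k := by
  induction w generalizing A with
  | nil =>
    have hA : A = ∅ := by
      have := congrArg Multiset.card hw
      simpa using this.symm
    subst hA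
    refine ⟨1, one_pos, ?_⟩
    have : antichainPoint l ∅ β = siteLetter l := by
      funext p; simp [antichainPoint]
    rw [this, Nat.cast_one, ← fundVec_siteLetter l]
    simp [wordAct]
  | cons γ w ih =>
    have hγ : γ ∈ A.val.map β := by rw [← hw]; simp
    obtain ⟨p, hp, rfl⟩ := Multiset.mem_map.1 hγ
    have hp : p ∈ A := hp
    have hA : A.val = p ::ₘ (A.erase p).val := by
      rw [← Finset.insert_val_of_notMem (Finset.notMem_erase p A), Finset.insert_erase hp]
    have hw' : (w : Multiset (PosRoot n)) = (A.erase p).val.map β := by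
      rw [hA, Multiset.map_cons, ← Multiset.cons_coe] at hw
      exact (Multiset.cons_inj_right _).1 hw
    have h' : IsAntichainOf l (A.erase p) β :=
      ⟨fun q hq => h.row q (Finset.mem_of_mem_erase hq),
        fun q hq => h.col q (Finset.mem_of_mem_erase hq),
        fun q hq r hr => h.anti q (Finset.mem_of_mem_erase hq) r (Finset.mem_of_mem_erase hr)⟩
    obtain ⟨k, hk, ek⟩ := ih (A.erase p) h' hw'
    have only : ∀ i a, ((negVec (β p) : Sp n) : Matrix (Fin n ⊕ Fin n) (Fin n ⊕ Fin n) ℂ)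
        (antichainPoint l A β i) a * wordAct (matRep (powerRep n (Fin (l + 1)))) w (fundVec l)
          (Function.update (antichainPoint l A β) i a) ≠ 0 → i = p ∧ a = siteLetter l p := by
      intro i a hne
      have h1 := reaches_of_ne_zero w _ (right_ne_zero_of_mul hne)
      have h2 := reaches_step (left_ne_zero_of_mul hne) h1.1 h1.2
      have hcard : (outside l (antichainPoint l A β)).card = w.length + 1 := by
        have := congrArg Multiset.card hw
        rw [h.outside_eq]
        simpa using this.symm
      obtain ⟨hi, τ, lab, hR, hlab, ha⟩ := h2.2 hcard
      rw [h.outside_eq] at hi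
      rcases h.lex_lt hR with ⟨hτ, hl⟩ | hlt
      · have e : β i = β p := (hl i hi).symm.trans hlab
        have hip : i = p := by
          have e1 := h.row i hi
          rw [e, h.row p hp] at e1
          exact Fin.ext e1.symm
        refine ⟨hip, ?_⟩
        rw [ha, hτ, hip]; rfl
      · exfalso
        have : multiplicity (β p :: w) = fun γ => (A.val.map β).count γ := by
          funext γ
          rw [multiplicity, ← Multiset.coe_count, hw]
        rw [this] at hlt
        exact lt_irrefl _ hlt
    rw [wordAct_cons, negVec_act_apply, Finset.sum_eq_single p, Finset.sum_eq_single (siteLetter l p)]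
    · have hupd : Function.update (antichainPoint l A β) p (siteLetter l p) =
          antichainPoint l (A.erase p) β := by
        funext q
        by_cases hq : q = p
        · subst hq; simp [antichainPoint]
        · rw [Function.update_of_ne hq]; simp [antichainPoint, hq]
      rw [hupd, ek, antichainPoint, if_pos hp, siteLetter, ← h.src_eq hp, negVec_apply]
      -- The matrix entry is `2` for a long root, whose letters coincide, and `1` otherwise.
      by_cases hc : Sum.inr (β p).src = (β p).tgt ∧ (β p).tgt = Sum.inr (β p).src
      · exact ⟨2 * k, by omega, by rw [if_pos hc, if_pos ⟨rfl, rfl⟩]; push_cast; ring⟩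
      · exact ⟨k, hk, by rw [if_neg hc, if_pos ⟨rfl, rfl⟩]; ring⟩
    · intro a _ ha
      by_contra hne
      exact ha (only p a hne).2
    · simp
    · intro i _ hi
      refine Finset.sum_eq_zero fun a _ => ?_
      by_contra hne
      exact hi (only i a hne).1
    · simp

/-- The functional is the coordinate at the point reached by the antichain `s`: shorter words cannot
reach it, and words of the same length that do have a lexicographically larger exponent or `s`
itself. -/
theorem fundVec_detected {s : PosRoot n → ℕ} (hs : s ∈ S (Pi.single l 1)) :
    IsDetected (matRep (powerRep n (Fin (l + 1)))) (fundVec l) s := by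
  classical
  obtain ⟨h1, h2⟩ := mem_S_single hs
  let A : Finset (Fin (l + 1)) := Finset.univ.filter fun p => ∃ γ, s γ ≠ 0 ∧ γ.row = p
  let β : Fin (l + 1) → PosRoot n := fun p =>
    if h : ∃ γ, s γ ≠ 0 ∧ γ.row = p then h.choose else PosRoot.simple l
  have hβ : ∀ p ∈ A, s (β p) ≠ 0 ∧ (β p).row = p := by
    intro p hp
    have hp' : ∃ γ, s γ ≠ 0 ∧ γ.row = p := (Finset.mem_filter.1 hp).2
    simp only [β, dif_pos hp']
    exact hp'.choose_spec
  have hA : IsAntichainOf l A β := by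
    refine ⟨fun p hp => (hβ p hp).2, fun p hp => (h1 _ (hβ p hp).1).2.2, fun p hp q hq hpq => ?_⟩
    by_contra hc
    have h3 := (hβ p hp).2
    have h4 := (hβ q hq).2
    have h5 := Fin.lt_def.1 hpq
    have := h2 _ _ (hβ p hp).1 (hβ q hq).1 (by omega) (not_lt.1 hc)
    rw [this] at h3
    omega
  have hcount : (fun γ => (A.val.map β).count γ) = s := by
    funext γ
    by_cases h0 : s γ = 0
    · rw [h0, Multiset.count_eq_zero, Multiset.mem_map]
      rintro ⟨p, hp, rfl⟩
      exact (hβ p hp).1 h0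
    · have h3 := h1 γ h0
      rw [h3.1]
      refine Multiset.count_eq_one_of_mem hA.nodup (Multiset.mem_map.2 ?_)
      have hp : (⟨γ.row, by omega⟩ : Fin (l + 1)) ∈ A :=
        Finset.mem_filter.2 ⟨Finset.mem_univ _, γ, h0, rfl⟩
      refine ⟨_, hp, ?_⟩
      have h4 := hβ _ hp
      rcases le_total (β ⟨γ.row, by omega⟩).col γ.col with h5 | h5
      · exact h2 _ _ h4.1 h0 h4.2.le h5
      · exact (h2 _ _ h0 h4.1 h4.2.ge h5).symm
  have hsum : ∑ γ, s γ = A.card := by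
    obtain ⟨w, hw⟩ := exists_multiplicity_eq s
    have e : (w : Multiset (PosRoot n)) = A.val.map β := by
      ext γ
      rw [Multiset.coe_count]
      exact (congrFun hw γ).trans (congrFun hcount γ).symm
    rw [← hw, sum_multiplicity, ← Multiset.coe_card, e, Multiset.card_map, Finset.card_val]
  refine ⟨LinearMap.proj (antichainPoint l A β), fun w hw => ?_, fun w hw => ?_⟩
  · by_contra hne
    obtain ⟨h3, h4⟩ := reaches_of_ne_zero w (antichainPoint l A β) hne
    rw [hA.outside_eq] at h3 h4
    rw [monomialKey_lt_iff, sum_multiplicity, hsum] at hw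
    rcases hw with hw | ⟨hw, hw'⟩
    · omega
    · obtain ⟨τ, lab, hR⟩ := h4 hw.symm
      rcases hA.lex_lt hR with ⟨-, hl⟩ | hlt
      · have : multiplicity w = s := by
          rw [← hcount]
          funext γ
          rw [multiplicity, ← Multiset.coe_count, hR.labels, hA.outside_eq]
          congr 1
          exact Multiset.map_congr rfl fun p hp => hl p hp
        rw [this] at hw'
        exact lt_irrefl _ hw'
      · rw [hcount] at hlt
        exact lt_irrefl _ (hlt.trans hw')
  · refine hA.exists_value w A ?_
    ext γ
    rw [Multiset.coe_count]
    exact (congrFun hw γ).trans (congrFun hcount γ).symm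

end Detection

theorem hasModel {n : ℕ} (m : Fin n → ℕ) : HasModel m :=
  hasModel_of_fundamental (fun l => ⟨_, inferInstance, inferInstance, powerRep n (Fin (l + 1)),
    fundVec l, powerRep_conj _ _, fundVec_isHighest l, fundVec_nilpotent l,
    fun _ hs => fundVec_detected hs⟩) m

/-! ### Weights of words and the grading element -/

section Weights

variable {n : ℕ} {M : Type*} [AddCommGroup M] [Module ℂ M]
  {ρ : Sp n →ₗ⁅ℂ⁆ Module.End ℂ M} {χ : Weight n} {v : M}

theorem wt_multiplicity_cons (b : PosRoot n) (w : List (PosRoot n)) :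
    wt (multiplicity (b :: w)) = b.root + wt (multiplicity w) := by
  have e : multiplicity (b :: w) = multiplicity w + Pi.single b 1 := by
    funext β
    simp only [multiplicity, List.count_cons, Pi.add_apply, Pi.single_apply, beq_iff_eq]
    congr 1
    exact if_congr eq_comm rfl rfl
  rw [e, wt, wt]
  simp [add_smul, Finset.sum_add_distrib, Pi.single_apply, ite_smul, add_comm]

theorem IsHighest.cartan_act_word (hv : IsHighest ρ χ v) (h : cartan n) (w : List (PosRoot n)) :
    ρ (h : Sp n) (wordAct ρ w v) = (χ - wt (multiplicity w)) h • wordAct ρ w v := by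
  induction w with
  | nil =>
    have : wt (multiplicity ([] : List (PosRoot n))) = 0 := by simp [wt, multiplicity]
    rw [this, sub_zero]
    exact hv.cartan_act h
  | cons b w ih =>
    have hb : ⁅(h : Sp n), negVec b⁆ = (-b.root) h • negVec b :=
      (LieModule.mem_weightSpace _ _).1 (negVec_mem b) h
    have e : ρ (h : Sp n) (ρ (negVec b) (wordAct ρ w v)) =
        ρ (negVec b) (ρ (h : Sp n) (wordAct ρ w v)) + ρ ⁅(h : Sp n), negVec b⁆ (wordAct ρ w v) := by
      rw [LieHom.map_lie, Ring.lie_def]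
      simp
    rw [wordAct_cons, e, ih, hb, map_smul, map_smul, LinearMap.smul_apply, ← add_smul,
      wt_multiplicity_cons]
    congr 1
    simp only [LinearMap.sub_apply, LinearMap.neg_apply, LinearMap.add_apply]
    ring

/-- A Cartan element on which all positive roots take positive integral values. -/
def gradingElt (n : ℕ) : cartan n := ∑ i : Fin n, ((n - i : ℕ) : ℂ) • cartanElt i

theorem eps_gradingElt (i : Fin n) : eps i (gradingElt n) = ((n - i : ℕ) : ℂ) := by
  rw [gradingElt, map_sum]
  simp [eps_cartanElt]

theorem exists_root_gradingElt (β : PosRoot n) :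
    ∃ k : ℕ, 0 < k ∧ β.root (gradingElt n) = k := by
  have h1 := β.row_lt
  have h2 := β.row_le_col
  have e : β.root (gradingElt n) = -((-β.root) (gradingElt n)) := by simp
  rw [e, PosRoot.neg_root]
  rcases h : β.tgt with k | k
  · have hk := PosRoot.tgt_eq_inl.1 h
    refine ⟨k - β.row, by omega, ?_⟩
    simp only [basisWeight, Sum.elim_inl, Sum.elim_inr, LinearMap.add_apply, LinearMap.neg_apply,
      eps_gradingElt, PosRoot.src]
    rw [Nat.cast_sub (by omega), Nat.cast_sub (by omega), Nat.cast_sub (by omega)]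
    ring
  · refine ⟨(n - β.row) + (n - k), by omega, ?_⟩
    simp only [basisWeight, Sum.elim_inr, LinearMap.add_apply, LinearMap.neg_apply,
      eps_gradingElt, PosRoot.src]
    rw [Nat.cast_add]
    ring

theorem exists_wt_gradingElt (w : List (PosRoot n)) (hw : w ≠ []) :
    ∃ k : ℕ, 0 < k ∧ wt (multiplicity w) (gradingElt n) = k := by
  have aux : ∀ w : List (PosRoot n), ∃ k : ℕ, wt (multiplicity w) (gradingElt n) = k := by
    intro w
    induction w with
    | nil => exact ⟨0, by simp [wt, multiplicity]⟩
    | cons b w ih =>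
      obtain ⟨k, hk⟩ := ih
      obtain ⟨k', -, hk'⟩ := exists_root_gradingElt b
      exact ⟨k' + k, by rw [wt_multiplicity_cons, LinearMap.add_apply, hk, hk', Nat.cast_add]⟩
  rcases w with _ | ⟨b, w⟩
  · exact absurd rfl hw
  · obtain ⟨k, hk⟩ := aux w
    obtain ⟨k', h0, hk'⟩ := exists_root_gradingElt b
    exact ⟨k' + k, by omega,
      by rw [wt_multiplicity_cons, LinearMap.add_apply, hk, hk', Nat.cast_add]⟩

variable (ρ v) in
/-- The span of the nonempty products of negative root vectors, applied to `v`. -/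
def lowerPart : Submodule ℂ M :=
  Submodule.span ℂ {x | ∃ w : List (PosRoot n), w ≠ [] ∧ wordAct ρ w v = x}

variable (ρ v) in
/-- The span of the products of negative root vectors, applied to `v`. -/
def cyclic : Submodule ℂ M := Submodule.span ℂ (Set.range fun w => wordAct ρ w v)

theorem wordAct_mem_cyclic (w : List (PosRoot n)) : wordAct ρ w v ∈ cyclic ρ v :=
  Submodule.subset_span ⟨w, rfl⟩

theorem self_mem_cyclic : v ∈ cyclic ρ v := wordAct_mem_cyclic []

theorem cyclic_le_iff {N : Submodule ℂ M} : cyclic ρ v ≤ N ↔ ∀ w, wordAct ρ w v ∈ N := by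
  rw [cyclic, Submodule.span_le, Set.range_subset_iff]
  rfl

theorem filt_le_cyclic (k : ℕ) : filt ρ v k ≤ cyclic ρ v :=
  Submodule.span_mono fun _ ⟨w, _, e⟩ => ⟨w, e⟩

theorem IsHighest.act_mem_cyclic (hv : IsHighest ρ χ v) (X : Sp n) {x : M}
    (hx : x ∈ cyclic ρ v) : ρ X x ∈ cyclic ρ v := by
  have : cyclic ρ v ≤ (cyclic ρ v).comap (ρ X) :=
    cyclic_le_iff.2 fun w => filt_le_cyclic _ ((act_mem_aux hv w).2 X)
  exact this hx

theorem exists_smul_add_lowerPart {x : M} (hx : x ∈ cyclic ρ v) :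
    ∃ c : ℂ, ∃ y ∈ lowerPart ρ v, x = c • v + y := by
  have : cyclic ρ v ≤ Submodule.span ℂ {v} ⊔ lowerPart ρ v := by
    refine cyclic_le_iff.2 fun w => ?_
    rcases eq_or_ne w [] with rfl | hw
    · exact Submodule.mem_sup_left (Submodule.mem_span_singleton_self v)
    · exact Submodule.mem_sup_right (Submodule.subset_span ⟨w, hw, rfl⟩)
  obtain ⟨a, ha, y, hy, e⟩ := Submodule.mem_sup.1 (this hx)
  obtain ⟨c, rfl⟩ := Submodule.mem_span_singleton.1 ha
  exact ⟨c, y, hy, e.symm⟩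

/-- The grading element has different eigenvalues on `v` and on all nonempty words, and eigenspaces
are independent. -/
theorem IsHighest.eq_zero_of_smul_mem_lowerPart (hv : IsHighest ρ χ v) {c : ℂ}
    (hc : c • v ∈ lowerPart ρ v) : c • v = 0 := by
  have hind := Module.End.eigenspaces_iSupIndep (ρ (gradingElt n : Sp n)) (χ (gradingElt n))
  have hle : lowerPart ρ v ≤ ⨆ (j : ℂ) (_ : j ≠ χ (gradingElt n)),
      Module.End.eigenspace (ρ (gradingElt n : Sp n)) j := by
    refine Submodule.span_le.2 ?_
    rintro _ ⟨w, hw, rfl⟩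
    obtain ⟨k, hk, e⟩ := exists_wt_gradingElt w hw
    refine Submodule.mem_iSup_of_mem (χ (gradingElt n) - k) (Submodule.mem_iSup_of_mem ?_ ?_)
    · rw [Ne, sub_eq_self, Nat.cast_eq_zero]; omega
    · rw [Module.End.mem_eigenspace_iff, hv.cartan_act_word, LinearMap.sub_apply, e]
  refine Submodule.disjoint_def.1 hind _ ?_ (hle hc)
  exact Submodule.smul_mem _ _ (Module.End.mem_eigenspace_iff.2 (hv.cartan_act _))

end Weights

/-! ### Transfer from the model -/

section Transfer

variable {n : ℕ} {M M' : Type*} [AddCommGroup M] [Module ℂ M] [AddCommGroup M'] [Module ℂ M']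

/-- The direct sum of two representations. -/
def prodRep (ρ : Sp n →ₗ⁅ℂ⁆ Module.End ℂ M) (σ : Sp n →ₗ⁅ℂ⁆ Module.End ℂ M') :
    Sp n →ₗ⁅ℂ⁆ Module.End ℂ (M × M') where
  toFun X := (ρ X).prodMap (σ X)
  map_add' X Y := by rw [map_add, map_add, LinearMap.prodMap_add]
  map_smul' c X := by rw [map_smul, map_smul, LinearMap.prodMap_smul, RingHom.id_apply]
  map_lie' {X Y} := by
    rw [LieHom.map_lie, LieHom.map_lie]
    rfl

variable {ρ : Sp n →ₗ⁅ℂ⁆ Module.End ℂ M} {σ : Sp n →ₗ⁅ℂ⁆ Module.End ℂ M'} {χ : Weight n}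
  {v : M} {t : M'}

theorem prodRep_apply (X : Sp n) (x : M) (y : M') : prodRep ρ σ X (x, y) = (ρ X x, σ X y) := rfl

theorem IsHighest.prod (hv : IsHighest ρ χ v) (ht : IsHighest σ χ t) :
    IsHighest (prodRep ρ σ) χ (v, t) where
  cartan_act h := by rw [prodRep_apply, hv.cartan_act, ht.cartan_act]; rfl
  pos_act β := by rw [prodRep_apply, hv.pos_act, ht.pos_act]; rfl

theorem wordAct_prodRep (w : List (PosRoot n)) :
    wordAct (prodRep ρ σ) w (v, t) = (wordAct ρ w v, wordAct σ w t) := by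
  induction w with
  | nil => rfl
  | cons b w ih => rw [wordAct_cons, ih, prodRep_apply, wordAct_cons, wordAct_cons]

theorem fst_mem_of_mem_cyclic {p : M × M'} (hp : p ∈ cyclic (prodRep ρ σ) (v, t)) :
    p.1 ∈ cyclic ρ v := by
  have : cyclic (prodRep ρ σ) (v, t) ≤ (cyclic ρ v).comap (LinearMap.fst ℂ M M') :=
    cyclic_le_iff.2 fun w => by
      rw [wordAct_prodRep]; exact wordAct_mem_cyclic w
  exact this hp

theorem snd_mem_of_mem_cyclic {p : M × M'} (hp : p ∈ cyclic (prodRep ρ σ) (v, t)) :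
    p.2 ∈ cyclic σ t := by
  have : cyclic (prodRep ρ σ) (v, t) ≤ (cyclic σ t).comap (LinearMap.snd ℂ M M') :=
    cyclic_le_iff.2 fun w => by
      rw [wordAct_prodRep]; exact wordAct_mem_cyclic w
  exact this hp

theorem mem_lowerPart_of_mem_prod {p : M × M'} (hp : p ∈ lowerPart (prodRep ρ σ) (v, t)) :
    p.1 ∈ lowerPart ρ v ∧ p.2 ∈ lowerPart σ t := by
  have : lowerPart (prodRep ρ σ) (v, t) ≤ (lowerPart ρ v).prod (lowerPart σ t) := by
    refine Submodule.span_le.2 ?_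
    rintro _ ⟨w, hw, rfl⟩
    rw [wordAct_prodRep]
    exact ⟨Submodule.subset_span ⟨w, hw, rfl⟩, Submodule.subset_span ⟨w, hw, rfl⟩⟩
  exact this hp

/-- The kernel of the second projection of the diagonal cyclic module does not contain `v`. -/
theorem self_zero_notMem (hv : IsHighest ρ χ v) (ht : IsHighest σ χ t) (hv0 : v ≠ 0) (ht0 : t ≠ 0) :
    (v, (0 : M')) ∉ cyclic (prodRep ρ σ) (v, t) := by
  intro hmem
  obtain ⟨c, y, hy, e⟩ := exists_smul_add_lowerPart hmem
  obtain ⟨hy1, hy2⟩ := mem_lowerPart_of_mem_prod hy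
  have e1 : v = c • v + y.1 := congrArg Prod.fst e
  have e2 : 0 = c • t + y.2 := congrArg Prod.snd e
  have h1 : y.1 = (1 - c) • v := by rw [sub_smul, one_smul, eq_sub_iff_add_eq, add_comm]; exact e1.symm
  have h2 : y.2 = (-c) • t := by rw [neg_smul, eq_neg_iff_add_eq_zero, add_comm]; exact e2.symm
  have h3 := hv.eq_zero_of_smul_mem_lowerPart (h1 ▸ hy1)
  have h4 := ht.eq_zero_of_smul_mem_lowerPart (h2 ▸ hy2)
  have h5 : 1 - c = 0 := (smul_eq_zero.1 h3).resolve_right hv0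
  have h6 : -c = 0 := (smul_eq_zero.1 h4).resolve_right ht0
  rw [neg_eq_zero] at h6
  rw [h6, sub_zero] at h5
  exact one_ne_zero h5

/-- The kernel of the first projection of the diagonal cyclic module lies in the lower part. -/
theorem mem_lowerPart_of_zero_mem (hv : IsHighest ρ χ v) (hv0 : v ≠ 0) {x : M'}
    (hx : ((0 : M), x) ∈ cyclic (prodRep ρ σ) (v, t)) : x ∈ lowerPart σ t := by
  obtain ⟨c, y, hy, e⟩ := exists_smul_add_lowerPart hx
  obtain ⟨hy1, hy2⟩ := mem_lowerPart_of_mem_prod hy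
  have e1 : 0 = c • v + y.1 := congrArg Prod.fst e
  have e2 : x = c • t + y.2 := congrArg Prod.snd e
  have h1 : y.1 = (-c) • v := by rw [neg_smul, eq_neg_iff_add_eq_zero, add_comm]; exact e1.symm
  have h3 := hv.eq_zero_of_smul_mem_lowerPart (h1 ▸ hy1)
  have h5 : c = 0 := neg_eq_zero.1 ((smul_eq_zero.1 h3).resolve_right hv0)
  rw [e2, h5, zero_smul, zero_add]
  exact hy2

/-- Adjoints of lowering operators are raising operators, up to a harmless sign coming from `J`.
This makes the lower part of a model orthogonal to its highest weight vector. -/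
theorem conjSp_negVec (β : PosRoot n) :
    conjSp (negVec β) = posVec β ∨ conjSp (negVec β) = -posVec β := by
  rcases h : β.tgt with k | k
  · left
    apply Subtype.ext
    ext c d
    change star ((negVec β : Matrix (Fin n ⊕ Fin n) (Fin n ⊕ Fin n) ℂ) d c) =
      (posVec β : Matrix (Fin n ⊕ Fin n) (Fin n ⊕ Fin n) ℂ) c d
    rw [negVec, posVec, pairElt, pairElt, ofMat_apply, ofMat_apply, h]
    rcases c with c | c <;> rcases d with d | d <;> simp [Matrix.single_apply]
    split_ifs <;> simp
  · right
    apply Subtype.ext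
    ext c d
    change star ((negVec β : Matrix (Fin n ⊕ Fin n) (Fin n ⊕ Fin n) ℂ) d c) =
      -(posVec β : Matrix (Fin n ⊕ Fin n) (Fin n ⊕ Fin n) ℂ) c d
    rw [negVec, posVec, pairElt, pairElt, ofMat_apply, ofMat_apply, h]
    rcases c with c | c <;> rcases d with d | d <;> simp [Matrix.single_apply]
    split_ifs <;> simp

end Transfer

/-! ### The Hermitian form of a model and its comparison with an irreducible module. -/

section Model

variable {n : ℕ} {m : Fin n → ℕ} {I : Type} [Fintype I] [DecidableEq I]
  {ρ : Sp n →ₗ⁅ℂ⁆ Matrix I I ℂ} {t : I → ℂ}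

theorem star_matRep_dotProduct (hm : IsModel m ρ t) (X : Sp n) (x y : I → ℂ) :
    star (matRep ρ X x) ⬝ᵥ y = star x ⬝ᵥ matRep ρ (conjSp X) y := by
  rw [matRep_apply, matRep_apply, hm.adjoint, Matrix.star_mulVec, Matrix.dotProduct_mulVec]

theorem IsModel.star_dotProduct_lowerPart (hm : IsModel m ρ t) {y : I → ℂ}
    (hy : y ∈ lowerPart (matRep ρ) t) : star y ⬝ᵥ t = 0 := by
  induction hy using Submodule.span_induction with
  | mem x hx =>
    obtain ⟨w, hw, rfl⟩ := hx
    rcases w with _ | ⟨b, w⟩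
    · exact absurd rfl hw
    · rw [wordAct_cons, star_matRep_dotProduct hm]
      have h0 := hm.highest.pos_act b
      rcases conjSp_negVec b with e | e
      · rw [e, h0, dotProduct_zero]
      · rw [e, map_neg, LinearMap.neg_apply, h0, neg_zero, dotProduct_zero]
  | zero => simp
  | add x y _ _ hx hy => rw [star_add, add_dotProduct, hx, hy, add_zero]
  | smul c x _ hx => rw [star_smul, smul_dotProduct, hx, smul_zero]

theorem IsModel.ne_zero (hm : IsModel m ρ t) : t ≠ 0 := by
  have h0 : (0 : PosRoot n → ℕ) ∈ S m := by
    rw [mem_S_iff]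
    exact ⟨fun C i j _ _ => by simp, fun C i _ _ => by simp⟩
  obtain ⟨φ, -, hφ⟩ := hm.detected 0 h0
  obtain ⟨k, hk, e⟩ := hφ [] (by funext β; simp [multiplicity])
  intro ht
  rw [ht, map_zero, map_zero] at e
  have : k = 0 := by exact_mod_cast e.symm
  omega

variable {M : Type*} [AddCommGroup M] [Module ℂ M] {σ : Sp n →ₗ⁅ℂ⁆ Module.End ℂ M} {v : M}

/-- The diagonal cyclic module meets the model trivially. -/
theorem IsModel.eq_zero_of_zero_mem (hm : IsModel m ρ t) (hv : IsHighest σ (domWeight m) v)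
    (hv0 : v ≠ 0) {x : I → ℂ} (hx : ((0 : M), x) ∈ cyclic (prodRep σ (matRep ρ)) (v, t)) :
    x = 0 := by
  have hprod := hv.prod hm.highest
  -- The vectors `y` paired with `0` are stable under the algebra, so adjunction moves the word onto
  -- `y`. What remains is orthogonality of `t` to the lower part.
  have key : ∀ (w : List (PosRoot n)) (y : I → ℂ),
      ((0 : M), y) ∈ cyclic (prodRep σ (matRep ρ)) (v, t) →
      star (wordAct (matRep ρ) w t) ⬝ᵥ y = 0 := by
    intro w
    induction w with
    | nil =>
      intro y hy
      have h1 := hm.star_dotProduct_lowerPart (mem_lowerPart_of_zero_mem hv hv0 hy)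
      change star t ⬝ᵥ y = 0
      rw [Matrix.star_dotProduct, h1, star_zero]
    | cons b w ih =>
      intro y hy
      rw [wordAct_cons, star_matRep_dotProduct hm]
      refine ih _ ?_
      have := hprod.act_mem_cyclic (conjSp (negVec b)) hy
      rwa [prodRep_apply, map_zero] at this
  have h1 : x ∈ cyclic (matRep ρ) t := snd_mem_of_mem_cyclic hx
  have h2 : star x ⬝ᵥ x = 0 := by
    -- Since `x` lies in the cyclic module itself, it is orthogonal to itself, and the form is
    -- positive definite.
    have h3 : ∀ y ∈ cyclic (matRep ρ) t, star y ⬝ᵥ x = 0 := by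
      intro y hy
      induction hy using Submodule.span_induction with
      | mem y hy => obtain ⟨w, rfl⟩ := hy; exact key w x hx
      | zero => simp
      | add x y _ _ hx hy => rw [star_add, add_dotProduct, hx, hy, add_zero]
      | smul c x _ hx => rw [star_smul, smul_dotProduct, hx, smul_zero]
    exact h3 x h1
  open scoped ComplexOrder in exact dotProduct_star_self_eq_zero.1 h2

/-- The cyclic module of the model is isomorphic to every cyclic module of the same highest weight
that has no proper submodules. -/
theorem IsModel.exists_equiv (hm : IsModel m ρ t) (hv : IsHighest σ (domWeight m) v) (hv0 : v ≠ 0)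
    (hirr : ∀ N : Submodule ℂ M, (∀ X, ∀ x ∈ N, σ X x ∈ N) → v ∉ N → N = ⊥) :
    ∃ e : cyclic (matRep ρ) t ≃ₗ[ℂ] cyclic σ v,
      ∀ w, (e ⟨wordAct (matRep ρ) w t, wordAct_mem_cyclic w⟩ : M) = wordAct σ w v := by
  have hprod := hv.prod hm.highest
  let U := cyclic (prodRep σ (matRep ρ)) (v, t)
  let p₁ : U →ₗ[ℂ] cyclic σ v :=
    ((LinearMap.fst ℂ M (I → ℂ)).comp U.subtype).codRestrict _ fun u => fst_mem_of_mem_cyclic u.2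
  let p₂ : U →ₗ[ℂ] cyclic (matRep ρ) t :=
    ((LinearMap.snd ℂ M (I → ℂ)).comp U.subtype).codRestrict _ fun u => snd_mem_of_mem_cyclic u.2
  let gen : List (PosRoot n) → U := fun w => ⟨(wordAct σ w v, wordAct (matRep ρ) w t), by
    rw [← wordAct_prodRep]; exact wordAct_mem_cyclic w⟩
  have h₁ : Function.Bijective p₁ := by
    constructor
    · refine (injective_iff_map_eq_zero p₁).2 fun u hu => ?_
      have e1 : (u : M × (I → ℂ)).1 = 0 := congrArg Subtype.val hu
      have e2 : ((0 : M), (u : M × (I → ℂ)).2) ∈ U := by rw [← e1]; exact u.2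
      exact Subtype.ext (Prod.ext e1 (hm.eq_zero_of_zero_mem hv hv0 e2))
    · rintro ⟨x, hx⟩
      have : cyclic σ v ≤ p₁.range.map (cyclic σ v).subtype :=
        cyclic_le_iff.2 fun w => ⟨p₁ (gen w), ⟨gen w, rfl⟩, rfl⟩
      obtain ⟨_, ⟨u, rfl⟩, e⟩ := this hx
      exact ⟨u, Subtype.ext e⟩
  -- The kernel of the projection to the model is a submodule of `M` avoiding `v`; irreducibility
  -- enters here.
  have hN : U.comap (LinearMap.inl ℂ M (I → ℂ)) = ⊥ := by
    refine hirr _ (fun X x hx => ?_) (self_zero_notMem hv hm.highest hv0 hm.ne_zero)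
    have := hprod.act_mem_cyclic X hx
    rwa [LinearMap.inl_apply, prodRep_apply, map_zero] at this
  have h₂ : Function.Bijective p₂ := by
    constructor
    · refine (injective_iff_map_eq_zero p₂).2 fun u hu => ?_
      have e1 : (u : M × (I → ℂ)).2 = 0 := congrArg Subtype.val hu
      have e2 : (u : M × (I → ℂ)).1 ∈ U.comap (LinearMap.inl ℂ M (I → ℂ)) := by
        change ((u : M × (I → ℂ)).1, (0 : I → ℂ)) ∈ U
        rw [← e1]; exact u.2
      rw [hN] at e2
      exact Subtype.ext (Prod.ext e2 e1)
    · rintro ⟨x, hx⟩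
      have : cyclic (matRep ρ) t ≤ p₂.range.map (cyclic (matRep ρ) t).subtype :=
        cyclic_le_iff.2 fun w => ⟨p₂ (gen w), ⟨gen w, rfl⟩, rfl⟩
      obtain ⟨_, ⟨u, rfl⟩, e⟩ := this hx
      exact ⟨u, Subtype.ext e⟩
  refine ⟨(LinearEquiv.ofBijective p₂ h₂).symm.trans (LinearEquiv.ofBijective p₁ h₁), fun w => ?_⟩
  have e : (LinearEquiv.ofBijective p₂ h₂).symm ⟨wordAct (matRep ρ) w t, wordAct_mem_cyclic w⟩ =
      gen w := (LinearEquiv.symm_apply_eq _).2 rfl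
  rw [LinearEquiv.trans_apply, e]
  rfl

/-- Detected exponents give linearly independent vectors. -/
theorem linearIndependent_of_isDetected {w : (PosRoot n → ℕ) → List (PosRoot n)}
    (hw : ∀ s ∈ S m, multiplicity (w s) = s) (hd : ∀ s ∈ S m, IsDetected σ v s) :
    LinearIndependent ℂ fun s : S m => wordAct σ (w s) v := by
  rw [linearIndependent_iff]
  intro l hl
  by_contra hne
  -- The functional detecting the largest exponent of a relation kills all its other terms.
  obtain ⟨s, hs, hmax⟩ := l.support.exists_max_image (fun s => monomialKey (s : PosRoot n → ℕ))
    (Finsupp.support_nonempty_iff.2 hne)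
  obtain ⟨φ, h0, h1⟩ := hd s s.2
  obtain ⟨k, hk, e⟩ := h1 (w s) (hw s s.2)
  have h2 := congrArg φ hl
  rw [Finsupp.linearCombination_apply, Finsupp.sum, map_sum, map_zero,
    Finset.sum_eq_single s] at h2
  · rw [map_smul, e, smul_eq_mul, mul_eq_zero, Nat.cast_eq_zero] at h2
    rcases h2 with h2 | h2
    · exact Finsupp.mem_support_iff.1 hs h2
    · omega
  · intro s' hs' hss
    rw [map_smul, h0 _ ?_, smul_zero]
    rw [hw s' s'.2]
    exact lt_of_le_of_ne (hmax s' hs') fun h => hss (Subtype.ext (monomialKey_injective h))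
  · intro h; exact absurd hs h

/-- The nilpotency bounds are established only in the model, so spanning as well as independence is
proved there and carried over by the isomorphism. -/
theorem exists_wordAct_basis (hv : IsHighest σ (domWeight m) v) (hv0 : v ≠ 0)
    (hirr : ∀ N : Submodule ℂ M, (∀ X, ∀ x ∈ N, σ X x ∈ N) → v ∉ N → N = ⊥)
    (htop : cyclic σ v = ⊤) (w : (PosRoot n → ℕ) → List (PosRoot n))
    (hw : ∀ s ∈ S m, multiplicity (w s) = s) :
    ∃ b : Module.Basis (S m) ℂ M, ∀ s : S m, b s = wordAct σ (w s) v := by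
  obtain ⟨I, _, _, ρ, t, hm⟩ := hasModel m
  obtain ⟨e, he⟩ := hm.exists_equiv hv hv0 hirr
  let c : S m → cyclic (matRep ρ) t := fun s => ⟨wordAct (matRep ρ) (w s) t, wordAct_mem_cyclic _⟩
  have hli : LinearIndependent ℂ c :=
    LinearIndependent.of_comp (cyclic (matRep ρ) t).subtype
      (linearIndependent_of_isDetected hw hm.detected)
  have hsp : ⊤ ≤ Submodule.span ℂ (Set.range c) := by
    rintro ⟨x, hx⟩ -
    have h1 : cyclic (matRep ρ) t ≤
        (Submodule.span ℂ (Set.range c)).map (cyclic (matRep ρ) t).subtype := by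
      refine cyclic_le_iff.2 fun u => ?_
      rw [Submodule.map_span, ← Set.range_comp]
      have h2 := wordAct_mem_span hm.highest hm.nilpotent w hw u
      rwa [Set.image_eq_range] at h2
    obtain ⟨y, hy, e⟩ := h1 hx
    have : y = ⟨x, hx⟩ := Subtype.ext e
    rwa [← this]
  refine ⟨((Module.Basis.mk hli hsp).map e).map (LinearEquiv.ofTop _ htop), fun s => ?_⟩
  rw [Module.Basis.map_apply, Module.Basis.map_apply, Module.Basis.mk_apply]
  exact he (w s)

end Model

/-! ### The irreducible module -/

section Irreducible

variable {n : ℕ} {m : Fin n → ℕ} {V : Type*} [AddCommGroup V] [Module ℂ V]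
  [LieRingModule (Sp n) V] [LieModule ℂ (Sp n) V] {v : V}

theorem IsHighestWeightVector.isHighest {χ : Weight n} (hv : IsHighestWeightVector χ v) :
    IsHighest (LieModule.toEnd ℂ (Sp n) V) χ v where
  cartan_act h := (LieModule.mem_weightSpace _ _).1 hv.mem_weightSpace h
  pos_act β := hv.nPlus_lie _
    (LieSubalgebra.subset_lieSpan (Set.mem_iUnion.2 ⟨β, posVec_mem β⟩))

theorem eq_bot_or_eq_top_of_stable [hV : LieModule.IsIrreducible ℂ (Sp n) V] (N : Submodule ℂ V)
    (hN : ∀ X : Sp n, ∀ x ∈ N, LieModule.toEnd ℂ (Sp n) V X x ∈ N) : N = ⊥ ∨ N = ⊤ := by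
  let N' : LieSubmodule ℂ (Sp n) V := { N with lie_mem := fun {X x} hx => hN X x hx }
  rcases eq_bot_or_eq_top N' with h | h
  · left
    exact congrArg LieSubmodule.toSubmodule h
  · right
    exact congrArg LieSubmodule.toSubmodule h

theorem exists_basis_of_isIrreducible (hV : LieModule.IsIrreducible ℂ (Sp n) V)
    (hv : IsHighestWeightVector (domWeight m) v) (w : (PosRoot n → ℕ) → List (PosRoot n))
    (hw : ∀ s ∈ S m, multiplicity (w s) = s) :
    ∃ b : Module.Basis (S m) ℂ V,
      ∀ s : S m, b s = wordAct (LieModule.toEnd ℂ (Sp n) V) (w s) v := by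
  refine exists_wordAct_basis hv.isHighest hv.ne_zero (fun N hN hvN => ?_) ?_ w hw
  · refine (eq_bot_or_eq_top_of_stable N hN).resolve_right ?_
    rintro rfl
    exact hvN Submodule.mem_top
  · refine (eq_bot_or_eq_top_of_stable (cyclic (LieModule.toEnd ℂ (Sp n) V) v) fun X x hx =>
      hv.isHighest.act_mem_cyclic X hx).resolve_left fun h => hv.ne_zero ?_
    have := self_mem_cyclic (ρ := LieModule.toEnd ℂ (Sp n) V) (v := v)
    rwa [h, Submodule.mem_bot] at this

theorem envAction_orderedMonomial {f : PosRoot n → nMinus n} {c : PosRoot n → ℂ}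
    (hc : ∀ β, (f β : Sp n) = c β • negVec β) (w : List (PosRoot n)) (x : V) :
    envAction n V (orderedMonomial f w) x =
      (w.map c).prod • wordAct (LieModule.toEnd ℂ (Sp n) V) w x := by
  induction w with
  | nil => simp [orderedMonomial, wordAct]
  | cons b w ih =>
    have e : envAction n V (orderedMonomial f (b :: w)) x =
        LieModule.toEnd ℂ (Sp n) V (f b : Sp n) (envAction n V (orderedMonomial f w) x) := by
      rw [orderedMonomial, List.map_cons, List.prod_cons, map_mul, Module.End.mul_apply, envAction,
        UniversalEnvelopingAlgebra.lift_ι_apply]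
      rfl
    rw [e, ih, hc, map_smul, map_smul, LinearMap.smul_apply, smul_smul, wordAct_cons, List.map_cons,
      List.prod_cons, mul_comm]

theorem exists_orderedMonomial_basis (hV : LieModule.IsIrreducible ℂ (Sp n) V)
    (hv : IsHighestWeightVector (domWeight m) v) {f : PosRoot n → nMinus n} (hf : IsRootVectors f)
    (w : (PosRoot n → ℕ) → List (PosRoot n)) (hw : ∀ s ∈ S m, IsArrangement s (w s)) :
    ∃ b : Module.Basis (S m) ℂ V,
      ∀ s : S m, b s = envAction n V (orderedMonomial f (w s)) v := by
  obtain ⟨b, hb⟩ := exists_basis_of_isIrreducible hV hv w fun s hs => funext (hw s hs)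
  obtain ⟨c, hc0, hc⟩ := hf.eq_smul
  have hu : ∀ s : S m, IsUnit ((w s).map c).prod := fun s => by
    rw [isUnit_iff_ne_zero, Ne, List.prod_eq_zero_iff, List.mem_map]
    rintro ⟨β, -, h⟩
    exact hc0 β h
  refine ⟨b.isUnitSMul hu, fun s => ?_⟩
  rw [Module.Basis.isUnitSMul_apply, hb, envAction_orderedMonomial hc]

/-! ### Weight multiplicities and the character. -/

theorem finrank_weightSpace_of_basis {ι : Type*} [Fintype ι] (b : Module.Basis ι ℂ V)
    {g : ι → Weight n} (hg : ∀ i (h : cartan n), ⁅h, b i⁆ = g i h • b i) (μ : Weight n)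
    [DecidablePred fun i => g i = μ] :
    Module.finrank ℂ (LieModule.weightSpace V (μ : cartan n → ℂ)) =
      (Finset.univ.filter fun i => g i = μ).card := by
  have e : (LieModule.weightSpace V (μ : cartan n → ℂ)).toSubmodule =
      Submodule.span ℂ (Set.range fun i : {i // g i = μ} => b i) := by
    apply le_antisymm
    · intro x hx
      have hx' := (LieModule.mem_weightSpace (M := V) (L := cartan n) (R := ℂ) _ x).1 hx
      rw [← b.sum_repr x]
      refine Submodule.sum_mem _ fun i _ => ?_
      by_cases hi : g i = μ
      · exact Submodule.smul_mem _ _ (Submodule.subset_span ⟨⟨i, hi⟩, rfl⟩)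
      · have : b.repr x i = 0 := by
          by_contra hne
          apply hi
          ext h
          have h1 : ⁅h, x⁆ = ∑ i, (b.repr x i * g i h) • b i := by
            conv_lhs => rw [← b.sum_repr x]
            rw [lie_sum]
            exact Finset.sum_congr rfl fun i _ => by rw [lie_smul, hg, smul_smul]
          have h2 := congrArg (fun y => b.repr y i) (h1.symm.trans (hx' h))
          simp only [b.repr_sum_self, map_smul, Finsupp.smul_apply, smul_eq_mul] at h2
          rw [mul_comm] at h2
          exact mul_right_cancel₀ hne h2
        rw [this, zero_smul]
        exact zero_mem _
    · refine Submodule.span_le.2 ?_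
      rintro _ ⟨⟨i, rfl⟩, rfl⟩
      exact (LieModule.mem_weightSpace (M := V) (L := cartan n) (R := ℂ) _ (b i)).2 (hg i)
  change Module.finrank ℂ (LieModule.weightSpace V (μ : cartan n → ℂ)).toSubmodule = _
  have hli : LinearIndependent ℂ fun i : {i // g i = μ} => b i :=
    b.linearIndependent.comp _ Subtype.val_injective
  rw [e, finrank_span_eq_card hli, Fintype.card_subtype]

theorem formalChar_eq_sum_of_basis {ι : Type*} [Fintype ι] (b : Module.Basis ι ℂ V)
    {g : ι → Weight n} (hg : ∀ i (h : cartan n), ⁅h, b i⁆ = g i h • b i) :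
    formalChar n V = ∑ i, AddMonoidAlgebra.single (g i) (1 : ℤ) := by
  classical
  rw [Finset.sum_comp (fun μ => AddMonoidAlgebra.single μ (1 : ℤ)) g, formalChar,
    finsum_eq_sum_of_support_subset (s := Finset.univ.image g)]
  · refine Finset.sum_congr rfl fun μ _ => ?_
    rw [finrank_weightSpace_of_basis b hg, AddMonoidAlgebra.smul_single, nsmul_eq_mul, mul_one]
  · intro μ hμ
    rw [Function.mem_support, finrank_weightSpace_of_basis b hg] at hμ
    rw [Finset.mem_coe, Finset.mem_image]
    by_contra hcon
    push Not at hcon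
    apply hμ
    rw [Finset.filter_false_of_mem fun i hi => hcon i hi]
    simp

end Irreducible

end

end SymplecticPBW

theorem mainTheorem3 (n : ℕ) (m : Fin n → ℕ)
    (V : Type*) [AddCommGroup V] [Module ℂ V]
    [LieRingModule (SymplecticPBW.Sp n) V] [LieModule ℂ (SymplecticPBW.Sp n) V]
    (hV : LieModule.IsIrreducible ℂ (SymplecticPBW.Sp n) V)
    (v : V) (hv : SymplecticPBW.IsHighestWeightVector (SymplecticPBW.domWeight m) v) :
    (∀ f : SymplecticPBW.PosRoot n → SymplecticPBW.nMinus n, SymplecticPBW.IsRootVectors f →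
      ∀ w : (SymplecticPBW.PosRoot n → ℕ) → List (SymplecticPBW.PosRoot n),
        (∀ s ∈ SymplecticPBW.S m, SymplecticPBW.IsArrangement s (w s)) →
        ∃ b : Module.Basis (SymplecticPBW.S m) ℂ V, ∀ s : SymplecticPBW.S m,
          b s = SymplecticPBW.envAction n V (SymplecticPBW.orderedMonomial f (w s)) v) ∧
    ((SymplecticPBW.S m).Finite ∧ Module.Finite ℂ V ∧
      Module.finrank ℂ V = (SymplecticPBW.S m).ncard) ∧
    SymplecticPBW.formalChar n V =
      ∑ᶠ s ∈ SymplecticPBW.S m,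
        AddMonoidAlgebra.single (SymplecticPBW.domWeight m - SymplecticPBW.wt s) (1 : ℤ) := by
  refine ⟨fun f hf w hw => SymplecticPBW.exists_orderedMonomial_basis hV hv hf w hw, ?_⟩
  -- Dimension and character do not depend on the arrangement, so any choice of words serves.
  choose w hw using SymplecticPBW.exists_multiplicity_eq (n := n)
  obtain ⟨b, hb⟩ := SymplecticPBW.exists_basis_of_isIrreducible hV hv w fun s _ => hw s
  have hfin := SymplecticPBW.finite_S m
  have : Fintype (SymplecticPBW.S m) := hfin.fintype
  refine ⟨⟨hfin, Module.Finite.of_basis b, ?_⟩, ?_⟩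
  · rw [Module.finrank_eq_card_basis b, Set.ncard_eq_toFinset_card', Set.toFinset_card]
  · rw [SymplecticPBW.formalChar_eq_sum_of_basis b
      (g := fun s => SymplecticPBW.domWeight m - SymplecticPBW.wt (s : SymplecticPBW.PosRoot n → ℕ))]
    · rw [← finsum_set_coe_eq_finsum_mem, finsum_eq_sum_of_fintype]
    · intro s h
      have := hv.isHighest.cartan_act_word h (w s)
      rw [hw] at this
      rw [hb]
      exact this
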